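/- **Setting.** A bias-free fully connected feedforward network $f(\theta,x)\in\mathbb R$ with parameters $\theta\in\mathbb R^P$, input $x\in\mathbb R^{n_{in}}$, any number of hidden layers of any widths, and activation $u\mapsto c_l\max(u,0)$ in the $l$-th hidden layer ($c_l=1$ is the plain ReLU). All derivatives of $f$ are computed by the chain rule with $\mathrm{ReLU}'(0)=0$; the *tangent sensitivity* is the $P\times n_{in}$ matrix $S(\theta,x)=\partial(\nabla_\theta f)/\partial x\,(\theta,x)$. Let $P_{x,y}$ be a probability distribution of pairs $(x,y)$ with real labels (in binary classification $y\in\{-1,1\}$), let $D=\{(x_i,y_i)\}_{i=1}^n$ be fixed training data, and let the loss be $l(f(x),y)=\ell(f(x)-y)$, with $\ell'$ its derivative (with any convention where $\ell$ is not differentiable). Write $\mathcal L(f)=\mathbb E\,\ell(f(x)-y)$, and $\mathcal L^S_{emp}(f)$ for the mean loss over a sample $S$. Gradient descent from a fixed $\theta_0$ with learning rates $\eta:\mathbb N\to\mathbb R^+$ is $\theta_T=\theta_{T-1}-\eta(T)\nabla_\theta\mathcal L^D_{emp}(f(\theta_{T-1},\cdot))$. Fix a set $E$ of admissible learning rate functions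 (possibly all of them); let $Traj(\theta_0)$ be the set of all $\theta_T$ with $T\ge 0$ and $\eta\in E$, put $U=Traj(\theta_0)\cap B_\varepsilon(\theta_0)$ for an $\varepsilon>0$, and $$\mathcal F_{\theta_0,C,\varepsilon}=\{f(\theta,\cdot):\theta\in U,\ \max_i\|S(\theta,x_i)\|_F\le C\}.$$ **Assumptions.** (1) $\ell$ is $K_{\mathcal L}$-Lipschitz. (2) $\|S(\theta,x_i)\|_F\le C_{TS}$ for all $\theta\in U$ and all training inputs $x_i$, where $C_{TS}>0$. (3) $|f(\theta_0,x)|\le K_{\theta_0}$, $\|\nabla_\theta f(\theta_0,x)\|\le K_{\nabla_0}$ and $\|x\|\le K_x$ for almost every $x$, and $\|x_i\|\le K_x$ for the training inputs. (4) For some $C_{GD}>0$, every $\eta\in E$ and every $T$, along the trajectory $(\theta_t)$ of $\eta$, $$\sum_{t=1}^{T-1}\eta(t)\,\frac1n\sum_{i=1}^n\Big|\frac{\partial l}{\partial f}(\theta_{t-1},x_i)\Big|\le C_{GD}.$$ (5) $|l(f(x),y)|\le B$ almost surely for every $f\in\mathcal F_{\theta_0,C_{TS},\varepsilon}$. Let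 $h(\theta,x)=f(\theta,x)-f(\theta_0,x)-\langle\nabla_\theta f(\theta_0,x),\theta-\theta_0\rangle$ be the Taylor remainder, and let $R(\theta_0)$ be the expectation, over an i.i.d. sample $S=(z_1,\dots,z_N)$ from $P_{x,y}$, $N\ge1$, of the Rademacher complexity of $\{(h(\theta,z_1),\dots,h(\theta,z_N))\}$, where $h$ is evaluated at the inputs of the $z_j$ and $\theta$ runs over the parameters that define $\mathcal F_{\theta_0,C_{TS},\varepsilon}$. **Theorem.** (a) Let $H\ge 2R(\theta_0)$ and $\delta\in(0,1)$. With probability at least $1-\delta$ over an i.i.d. sample $S$ of size $N$ from $P_{x,y}$, every $f\in\mathcal F_{\theta_0,C_{TS},\varepsilon}$ satisfies $$\mathcal L(f)-\mathcal L^S_{emp}(f)\le K_{\mathcal L}K_{\theta_0}+\frac{2K_{\mathcal L}K_xK_{\nabla_0}C_{TS}C_{GD}}{\sqrt N}+K_{\mathcal L}H+B\sqrt{\frac{2\log(4/\delta)}{N}}.$$ (b) Fix the input dimension, the number of hidden layers, $\varepsilon$, $N$ and a $P_{x,y}$ with $\|x\|\le K_x$ almost surely. For the networks whose hidden layers all have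 width $m$, with the scaled activation $u\mapsto\max(u,0)/\sqrt m$, one can choose error terms $H_m(\theta_0)$ with $H_m(\theta_0)\ge 2R(\theta_0)$ for all $\theta_0$, all training data, all choices of $\ell'$, all $E$ and all $C_{TS}$, such that $H_m(\theta_0)\to0$ in probability as $m\to\infty$ when the entries of $\theta_0$ are independent standard Gaussians. -/

import Mathlib

open MeasureTheory ProbabilityTheory Filter Topology

noncomputable section

/-- A bias-free fully connected feedforward network architecture with scalar output.
`inDim` is the input dimension, `depth` the number of hidden layers, `hidden l` the width of the
`(l+1)`-st hidden layer, and the activation of the `(l+1)`-st hidden layer is the scaled ReLU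
`u ↦ scale l * max u 0` (`scale = 1` is the plain ReLU).
Only the values of `hidden` and `scale` at `l < depth` matter. -/
structure Arch where
  inDim : ℕ
  depth : ℕ
  hidden : ℕ → ℕ
  scale : ℕ → ℝ

namespace Arch

/-- The number of units in layer `l`; layer `0` is the input. -/
def width (A : Arch) : ℕ → ℕ
  | 0 => A.inDim
  | l + 1 => A.hidden l

/-- The input space, with the Euclidean norm. -/
abbrev Input (A : Arch) : Type := EuclideanSpace ℝ (Fin A.inDim)

/-- The indices of the parameters: the entries of the hidden weight matrices and the entries of the
output weight vector. -/
abbrev Idx (A : Arch) : Type :=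
  (Σ l : Fin A.depth, Fin (A.width (l + 1)) × Fin (A.width l)) ⊕ Fin (A.width A.depth)

/-- The parameter space `ℝ^P`, with the Euclidean norm. -/
abbrev Param (A : Arch) : Type := EuclideanSpace ℝ A.Idx

/-- The weight from unit `k` of layer `l` to unit `j` of layer `l + 1`. -/
def weight (A : Arch) (θ : A.Param) (l : ℕ) (j : Fin (A.width (l + 1))) (k : Fin (A.width l)) : ℝ :=
  if h : l < A.depth then θ (Sum.inl ⟨⟨l, h⟩, j, k⟩) else 0

/-- The vector of activations of layer `l`. -/
def act (A : Arch) (θ : A.Param) (x : A.Input) : (l : ℕ) → Fin (A.width l) → ℝ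
  | 0 => fun j => x j
  | l + 1 => fun j => A.scale l * max (∑ k, A.weight θ l j k * A.act θ x l k) 0

/-- The network function `f(θ, x)`. -/
def net (A : Arch) (θ : A.Param) (x : A.Input) : ℝ :=
  ∑ k, θ (Sum.inr k) * A.act θ x A.depth k

/-- The derivative of the activation function at the preactivation of unit `j` of layer `l + 1`,
with the convention `ReLU'(0) = 0`. -/
def gate (A : Arch) (θ : A.Param) (x : A.Input) (l : ℕ) (j : Fin (A.width (l + 1))) : ℝ :=
  if 0 < ∑ k, A.weight θ l j k * A.act θ x l k then A.scale l else 0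

/-- The activations of the network in which every activation function is replaced by the
multiplication with a constant `g l j`. -/
def gatedAct (A : Arch) (g : (l : ℕ) → Fin (A.width (l + 1)) → ℝ) (θ : A.Param) (x : A.Input) :
    (l : ℕ) → Fin (A.width l) → ℝ
  | 0 => fun j => x j
  | l + 1 => fun j => g l j * ∑ k, A.weight θ l j k * A.gatedAct g θ x l k

/-- The output of the network with constant gates `g`: the sum over all paths of the product of the
input, the weights and the gates on the path. It is polynomial in `θ` and linear in `x`. -/
def gatedNet (A : Arch) (g : (l : ℕ) → Fin (A.width (l + 1)) → ℝ) (θ : A.Param) (x : A.Input) : ℝ :=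
  ∑ k, θ (Sum.inr k) * A.gatedAct g θ x A.depth k

/-- The network agrees at `(θ, x)` with the gated network whose gates are those of `(θ, x)`. -/
theorem gatedNet_gate (A : Arch) (θ : A.Param) (x : A.Input) :
    A.gatedNet (A.gate θ x) θ x = A.net θ x := by
  have h : ∀ l, A.gatedAct (A.gate θ x) θ x l = A.act θ x l := by
    intro l
    induction l with
    | zero => rfl
    | succ l ih =>
      funext j
      simp only [gatedAct, act, ih, gate]
      split_ifs with hpos
      · rw [max_eq_left hpos.le]
      · rw [max_eq_right (not_lt.mp hpos)]; simp
  simp [gatedNet, net, h]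

/-- `∇_θ f(θ, x)`, computed by the chain rule (backpropagation) with the convention
`ReLU'(0) = 0`: every activation contributes the constant factor `gate θ x`. -/
def paramGrad (A : Arch) (θ : A.Param) (x : A.Input) : A.Param :=
  gradient (fun θ' => A.gatedNet (A.gate θ x) θ' x) θ

/-- The tangent (sample) sensitivity `S(θ, x) = ∂(∇_θ f)/∂x (θ, x)`, a `P × n_in` matrix, with the
same convention at the kinks of ReLU. -/
def tangentSens (A : Arch) (θ : A.Param) (x : A.Input) : Matrix A.Idx (Fin A.inDim) ℝ :=
  Matrix.of fun i j =>
    (fderiv ℝ (fun x' : A.Input => gradient (fun θ' => A.gatedNet (A.gate θ x) θ' x') θ) x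
      (EuclideanSpace.single j 1)) i

/-- The Frobenius norm of a matrix. -/
def frobNorm {ι κ : Type*} [Fintype ι] [Fintype κ] (M : Matrix ι κ ℝ) : ℝ :=
  Real.sqrt (∑ i, ∑ j, M i j ^ 2)

/-- The gradient of the empirical loss `(1/n) ∑ i, ℓ (f(θ, xᵢ) - yᵢ)` on the training data `D`,
where `dℓ` is the derivative of `ℓ`. -/
def lossGrad (A : Arch) (dℓ : ℝ → ℝ) {n : ℕ} (D : Fin n → A.Input × ℝ) (θ : A.Param) : A.Param :=
  (1 / (n : ℝ)) • ∑ i, dℓ (A.net θ (D i).1 - (D i).2) • A.paramGrad θ (D i).1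

/-- `GD(θ₀, η, T)`: gradient descent after `T` steps with learning rates `η 1, η 2, …`. -/
def gd (A : Arch) (dℓ : ℝ → ℝ) {n : ℕ} (D : Fin n → A.Input × ℝ) (η : ℕ → ℝ) (θ₀ : A.Param) :
    ℕ → A.Param
  | 0 => θ₀
  | T + 1 => A.gd dℓ D η θ₀ T - η (T + 1) • A.lossGrad dℓ D (A.gd dℓ D η θ₀ T)

/-- `Traj(θ₀)`: the parameters reachable from `θ₀` by gradient descent with a learning rate
function in the set `E`. -/
def traj (A : Arch) (dℓ : ℝ → ℝ) {n : ℕ} (D : Fin n → A.Input × ℝ) (E : Set (ℕ → ℝ))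
    (θ₀ : A.Param) : Set A.Param :=
  {θ | ∃ η ∈ E, ∃ T, θ = A.gd dℓ D η θ₀ T}

/-- `U = Traj(θ₀) ∩ B_ε(θ₀)`. -/
def reach (A : Arch) (dℓ : ℝ → ℝ) {n : ℕ} (D : Fin n → A.Input × ℝ) (E : Set (ℕ → ℝ))
    (θ₀ : A.Param) (ε : ℝ) : Set A.Param :=
  A.traj dℓ D E θ₀ ∩ Metric.ball θ₀ ε

/-- The parameters of the models in the family `F_{θ₀, C, ε}`: those in `U` whose tangent
sensitivity on the training inputs is at most `C` in Frobenius norm. -/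
def familyParam (A : Arch) (dℓ : ℝ → ℝ) {n : ℕ} (D : Fin n → A.Input × ℝ) (E : Set (ℕ → ℝ))
    (θ₀ : A.Param) (C ε : ℝ) : Set A.Param :=
  {θ ∈ A.reach dℓ D E θ₀ ε | ∀ i, frobNorm (A.tangentSens θ (D i).1) ≤ C}

/-- The family of models `F_{θ₀, C, ε}`. -/
def family (A : Arch) (dℓ : ℝ → ℝ) {n : ℕ} (D : Fin n → A.Input × ℝ) (E : Set (ℕ → ℝ))
    (θ₀ : A.Param) (C ε : ℝ) : Set (A.Input → ℝ) :=
  A.net '' A.familyParam dℓ D E θ₀ C ε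

/-- The remainder `h(θ, x)` of the first-order Taylor approximation of `f(·, x)` at `θ₀`. -/
def remainder (A : Arch) (θ₀ θ : A.Param) (x : A.Input) : ℝ :=
  A.net θ x - (A.net θ₀ x + inner ℝ (A.paramGrad θ₀ x) (θ - θ₀))

end Arch

/-- The Rademacher complexity of a bounded set of vectors in `ℝ^m`: the mean over all `2^m` sign
vectors `σ` of the supremum over `a` of `(1/m) ∑ i, σ i * a i`. -/
def rademacher {m : ℕ} (V : Set (Fin m → ℝ)) : ℝ :=
  (∑ σ : Fin m → ℤˣ, sSup ((fun a : Fin m → ℝ => (1 / (m : ℝ)) * ∑ i, ((σ i : ℤ) : ℝ) * a i) '' V))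
    / 2 ^ m

/-- The true error `E[ℓ(f(x) - y)]`. -/
def risk {X : Type*} [MeasurableSpace X] (ℓ : ℝ → ℝ) (P : Measure (X × ℝ)) (f : X → ℝ) : ℝ :=
  ∫ z, ℓ (f z.1 - z.2) ∂P

/-- The empirical loss on a sample. -/
def empRisk {X : Type*} {N : ℕ} (ℓ : ℝ → ℝ) (s : Fin N → X × ℝ) (f : X → ℝ) : ℝ :=
  (1 / (N : ℝ)) * ∑ i, ℓ (f (s i).1 - (s i).2)

namespace Arch

/-- The Rademacher complexity `R_S` of the Taylor remainders `h(θ, ·)` of the models in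
`F_{θ₀, C, ε}`, in expectation over an i.i.d. sample `S` of size `N` from `P`. -/
def remainderComplexity (A : Arch) (P : Measure (A.Input × ℝ)) (N : ℕ) (dℓ : ℝ → ℝ) {n : ℕ}
    (D : Fin n → A.Input × ℝ) (E : Set (ℕ → ℝ)) (θ₀ : A.Param) (C ε : ℝ) : ℝ :=
  ∫ s : Fin N → A.Input × ℝ,
    rademacher ((fun θ i => A.remainder θ₀ θ (s i).1) '' A.familyParam dℓ D E θ₀ C ε)
    ∂(Measure.pi fun _ => P)

/-- The network with input dimension `d`, `L` hidden layers of width `m` and the scaled ReLU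
activation `u ↦ max u 0 / √m`. -/
abbrev wide (d L m : ℕ) : Arch where
  inDim := d
  depth := L
  hidden := fun _ => m
  scale := fun _ => 1 / Real.sqrt m

end Arch

end

/-! ### McDiarmid's inequality. -/

section BoundedDifferences

variable {Z : Type*} [MeasurableSpace Z]

/-! Generalization bound. Once the ReLU gates are frozen, the network is linear in the input, so the
parameter gradient at `x` is the tangent sensitivity applied to `x` (`norm_paramGrad_le`). Each
gradient step taken inside the ball is therefore at most `Kx * CTS` times the learning signal of
that step, and every admissible parameter lies within `Kx * CTS * CGD` of `θ₀`
(`norm_sub_le_of_mem_reach`). The models are then a fixed function, plus a linear functional of a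
displacement of bounded length, plus the Taylor remainder. Contraction strips off the Lipschitz loss
(`rademacher_contraction`), the fixed function contributes nothing to a Rademacher complexity, the
linear part contributes radius times gradient bound over `√N` (`rademacher_linear_le`), and `H` pays
for the remainder. Symmetrization and McDiarmid's inequality turn this into a bound with high
probability (`measure_uniform_deviation_le`).

Infinite width. The error term is `remainderBound`, twice the mean over the input of the largest
remainder on the whole ball; it dominates the complexity of every subfamily. By `remainder_add_eq`
the remainder is a sum over layers of two kinds of terms. Products of two increments are of order `1
/ √m` when the weight matrices have operator norm of order `√m`. The other terms come from units
whose preactivation crosses the kink, each weighted by the backpropagated derivative at that unit.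
Preactivation increments have bounded Euclidean length, so a crossing unit either starts close to
zero or moves far, and few units do either. That few units cross helps only if the derivatives do
not concentrate on them, which a bound on their fourth moments guarantees
(`lintegral_back_pow_four_le`).

The fourth moment is the delicate point, because the gates depend on the same weights that carry the
derivative backwards. They do so only through the product of the weight matrix with the incoming
activations. The part of each row orthogonal to these activations can thus be resampled without
moving any gate, and it contributes a Gaussian of bounded variance; the rest of the derivative is
proportional to the network output, by homogeneity (`sum_back_mul_act`).

Exceptional events are weight matrices of large norm (`measure_weight_opNorm_gt_le`), layers whose
activations collapse (`measure_collapsed_le`) and a large output (`measure_net_gt_le`). Balancing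
all the terms gives a rate of order `m ^ (-1/24)` at each nonzero input, with the weights restricted
to bounded norms. Dominated convergence over the input and Markov's inequality finish the proof. -/

theorem integrable_of_abs_le {Ω : Type*} [MeasurableSpace Ω] {μ : Measure Ω} [IsFiniteMeasure μ]
    {F : Ω → ℝ} (hF : Measurable F) {M : ℝ} (hM : ∀ s, |F s| ≤ M) : Integrable F μ :=
  Integrable.of_bound hF.aestronglyMeasurable M (ae_of_all _ hM)

theorem measurable_fin_cons {N : ℕ} :
    Measurable fun q : Z × (Fin N → Z) => (Fin.cons q.1 q.2 : Fin (N + 1) → Z) := by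
  refine measurable_pi_iff.2 fun i => ?_
  refine Fin.cases ?_ (fun i => ?_) i
  · simpa using measurable_fst
  · simp only [Fin.cons_succ]
    fun_prop

theorem integral_pi_succ (P : Measure Z) [IsProbabilityMeasure P] {N : ℕ}
    {F : (Fin (N + 1) → Z) → ℝ} (hF : Measurable F) {M : ℝ} (hM : ∀ s, |F s| ≤ M) :
    ∫ s, F s ∂(Measure.pi fun _ => P)
      = ∫ z, ∫ s, F (Fin.cons z s) ∂(Measure.pi fun _ : Fin N => P) ∂P := by
  have h := (measurePreserving_piFinSuccAbove (fun _ : Fin (N + 1) => P) 0).symm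
  rw [← h.integral_comp']
  rw [integral_prod]
  · have h0 : ∀ (z : Z) (s : Fin N → Z),
        (MeasurableEquiv.piFinSuccAbove (fun _ => Z) 0).symm (z, s) = Fin.cons z s := fun z s =>
      Fin.insertNth_zero' z s
    simp_rw [h0]
  · exact integrable_of_abs_le (hF.comp (MeasurableEquiv.measurable _)) fun s => hM _

theorem abs_integral_le_of_abs_le {Ω : Type*} [MeasurableSpace Ω] {μ : Measure Ω}
    [IsProbabilityMeasure μ] {F : Ω → ℝ} {M : ℝ} (hM : ∀ s, |F s| ≤ M) : |∫ s, F s ∂μ| ≤ M := by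
  have := norm_integral_le_of_norm_le_const (μ := μ) (f := F) (C := M) (ae_of_all _ hM)
  simpa using this

/-- The exponential moment bound behind McDiarmid's inequality. -/
theorem integral_exp_le_of_boundedDifferences (P : Measure Z) [IsProbabilityMeasure P]
    {c : ℝ} (hc : 0 ≤ c) (t : ℝ) :
    ∀ (N : ℕ) (G : (Fin N → Z) → ℝ), Measurable G → (∃ M, ∀ s, |G s| ≤ M) →
      (∀ s i z, |G (Function.update s i z) - G s| ≤ c) →
      ∫ s, Real.exp (t * (G s - ∫ s', G s' ∂(Measure.pi fun _ => P))) ∂(Measure.pi fun _ => P)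
        ≤ Real.exp (t ^ 2 * N * c ^ 2 / 8) := by
  intro N
  induction N with
  | zero =>
    intro G _ _ _
    have hG : ∀ s, G s = G default := fun s => congrArg G (Subsingleton.elim _ _)
    simp [hG]
  | succ N ih =>
    rintro G hG ⟨M, hM⟩ hd
    set E := ∫ s', G s' ∂(Measure.pi fun _ => P) with hE
    set Gb : Z → ℝ := fun z => ∫ s, G (Fin.cons z s) ∂(Measure.pi fun _ : Fin N => P) with hGb
    have hcons : ∀ z, Measurable fun s : Fin N → Z => G (Fin.cons z s) := fun z =>
      hG.comp (measurable_fin_cons.comp measurable_prodMk_left)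
    have hint : ∀ z, Integrable (fun s : Fin N → Z => G (Fin.cons z s))
        (Measure.pi fun _ : Fin N => P) := fun z => integrable_of_abs_le (hcons z) fun s => hM _
    have hGbm : Measurable Gb :=
      ((hG.comp measurable_fin_cons).stronglyMeasurable.integral_prod_right').measurable
    have hGbM : ∀ z, |Gb z| ≤ M := fun z => abs_integral_le_of_abs_le fun s => hM _
    have hEGb : E = ∫ z, Gb z ∂P := integral_pi_succ P hG hM
    have hEM : |E| ≤ M := abs_integral_le_of_abs_le hM
    have hbd : ∀ x y : ℝ, |x| ≤ M → |y| ≤ M →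
        |Real.exp (t * (x - y))| ≤ Real.exp (|t| * (2 * M)) := by
      intro x y hx hy
      rw [abs_of_pos (Real.exp_pos _)]
      apply Real.exp_le_exp.2
      refine (le_abs_self _).trans ?_
      rw [abs_mul]
      refine mul_le_mul_of_nonneg_left ?_ (abs_nonneg _)
      refine (abs_sub _ _).trans ?_
      linarith
    rw [integral_pi_succ P (M := Real.exp (|t| * (2 * M))) (by fun_prop) fun s => hbd _ _ (hM _) hEM]
    have hinner : ∀ z, ∫ s, Real.exp (t * (G (Fin.cons z s) - E)) ∂(Measure.pi fun _ : Fin N => P)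
        ≤ Real.exp (t * (Gb z - E)) * Real.exp (t ^ 2 * N * c ^ 2 / 8) := by
      intro z
      -- The exponent splits into the deviation of `Gb z`, constant in `s`, and the deviation of the
      -- section at `z` from its own mean, to which the induction hypothesis applies.
      have h1 : ∀ s : Fin N → Z, Real.exp (t * (G (Fin.cons z s) - E))
          = Real.exp (t * (Gb z - E)) * Real.exp (t * (G (Fin.cons z s) - Gb z)) := by
        intro s
        rw [← Real.exp_add]; ring_nf
      simp_rw [h1]
      rw [integral_const_mul]
      refine mul_le_mul_of_nonneg_left ?_ (Real.exp_pos _).le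
      refine ih (fun s => G (Fin.cons z s)) (hcons z) ⟨M, fun s => hM _⟩ fun s i z' => ?_
      have := hd (Fin.cons z s) i.succ z'
      rwa [← Fin.cons_update] at this
    obtain ⟨z₀⟩ : Nonempty Z := nonempty_of_isProbabilityMeasure P
    -- Sections at `z` and `z'` differ pointwise by at most `c`, so `Gb` takes values in an interval
    -- of length `c`, as Hoeffding's lemma requires.
    have hdiff : ∀ z z', Gb z ≤ Gb z' + c := by
      intro z z'
      have : Gb z' + c = ∫ s, (G (Fin.cons z' s) + c) ∂(Measure.pi fun _ : Fin N => P) := by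
        rw [integral_add (hint z') (integrable_const c)]; simp [hGb]
      rw [this]
      refine integral_mono (hint z) ((hint z').add (integrable_const c)) fun s => ?_
      have := hd (Fin.cons z' s) 0 z
      rw [Fin.update_cons_zero] at this
      have := (abs_le.1 this).2
      simp only
      linarith
    have hbelow : BddBelow (Set.range Gb) :=
      ⟨-M, by rintro _ ⟨z, rfl⟩; exact (abs_le.1 (hGbM z)).1⟩
    have : Nonempty Z := ⟨z₀⟩
    have hoef := (hasSubgaussianMGF_of_mem_Icc (μ := P) (X := Gb) (a := ⨅ z, Gb z)
      (b := (⨅ z, Gb z) + c) hGbm.aemeasurable (ae_of_all _ fun z =>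
        ⟨ciInf_le hbelow z, by
          have := le_ciInf (fun z' => (sub_le_iff_le_add.2 (hdiff z z')))
          linarith⟩)).mgf_le t
    rw [mgf, ← hEGb] at hoef
    calc ∫ z, ∫ s, Real.exp (t * (G (Fin.cons z s) - E)) ∂(Measure.pi fun _ : Fin N => P) ∂P
        ≤ ∫ z, Real.exp (t * (Gb z - E)) * Real.exp (t ^ 2 * N * c ^ 2 / 8) ∂P := by
          refine integral_mono_of_nonneg (ae_of_all _ fun z => integral_nonneg fun s =>
            (Real.exp_pos _).le) ?_ (ae_of_all _ hinner)
          refine Integrable.mul_const ?_ _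
          exact integrable_of_abs_le (by fun_prop) fun z => hbd _ _ (hGbM z) hEM
      _ = (∫ z, Real.exp (t * (Gb z - E)) ∂P) * Real.exp (t ^ 2 * N * c ^ 2 / 8) := by
          rw [integral_mul_const]
      _ ≤ Real.exp (c ^ 2 * t ^ 2 / 8) * Real.exp (t ^ 2 * N * c ^ 2 / 8) := by
          refine mul_le_mul_of_nonneg_right (hoef.trans ?_) (Real.exp_pos _).le
          apply Real.exp_le_exp.2
          apply le_of_eq
          simp [abs_of_nonneg hc]
          ring
      _ = Real.exp (t ^ 2 * (N + 1 : ℕ) * c ^ 2 / 8) := by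
          rw [← Real.exp_add]; push_cast; ring_nf

/-- McDiarmid's bounded differences inequality, for equal increments. -/
theorem measure_boundedDifferences_ge_le (P : Measure Z) [IsProbabilityMeasure P]
    {c : ℝ} (hc : 0 < c) {N : ℕ} (hN : 0 < N) {G : (Fin N → Z) → ℝ} (hG : Measurable G)
    (hM : ∃ M, ∀ s, |G s| ≤ M) (hd : ∀ s i z, |G (Function.update s i z) - G s| ≤ c)
    {u : ℝ} (hu : 0 ≤ u) :
    (Measure.pi fun _ => P).real {s | u ≤ G s - ∫ s', G s' ∂(Measure.pi fun _ => P)}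
      ≤ Real.exp (-(2 * u ^ 2 / (N * c ^ 2))) := by
  -- The minimizer of `-t * u + t ^ 2 * N * c ^ 2 / 8`.
  set t : ℝ := 4 * u / (N * c ^ 2) with ht
  have hN' : (0 : ℝ) < N := by exact_mod_cast hN
  have h0 : 0 ≤ t := by positivity
  obtain ⟨M, hM'⟩ := hM
  have h1 := measure_ge_le_exp_mul_mgf (μ := Measure.pi fun _ : Fin N => P)
    (X := fun s => G s - ∫ s', G s' ∂(Measure.pi fun _ => P)) u h0 (by
      refine integrable_of_abs_le (M := Real.exp (|t| * (M + M))) (by fun_prop) fun s => ?_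
      rw [abs_of_pos (Real.exp_pos _)]
      apply Real.exp_le_exp.2
      refine (le_abs_self _).trans ?_
      rw [abs_mul]
      exact mul_le_mul_of_nonneg_left ((abs_sub _ _).trans
        (add_le_add (hM' _) (abs_integral_le_of_abs_le hM'))) (abs_nonneg _))
  refine h1.trans ?_
  have h2 := integral_exp_le_of_boundedDifferences P hc.le t N G hG ⟨M, hM'⟩ hd
  refine (mul_le_mul_of_nonneg_left h2 (Real.exp_pos _).le).trans ?_
  rw [← Real.exp_add]
  apply Real.exp_le_exp.2
  apply le_of_eq
  rw [ht]
  field_simp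
  ring

end BoundedDifferences

/-! ### Rademacher complexity: calculus, contraction, linear classes. -/

section Rademacher

theorem abs_units_int_cast (u : ℤˣ) : |((u : ℤ) : ℝ)| = 1 := by
  rcases Int.units_eq_one_or u with h | h <;> simp [h]

/-- The sign average of a vector. -/
noncomputable def signMean {N : ℕ} (σ : Fin N → ℤˣ) (a : Fin N → ℝ) : ℝ :=
  (1 / (N : ℝ)) * ∑ i, ((σ i : ℤ) : ℝ) * a i

theorem signMean_add {N : ℕ} (σ : Fin N → ℤˣ) (a b : Fin N → ℝ) :
    signMean σ (fun i => a i + b i) = signMean σ a + signMean σ b := by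
  simp [signMean, mul_add, Finset.sum_add_distrib]

theorem signMean_smul {N : ℕ} (σ : Fin N → ℤˣ) (c : ℝ) (a : Fin N → ℝ) :
    signMean σ (fun i => c * a i) = c * signMean σ a := by
  simp only [signMean, Finset.mul_sum]
  exact Finset.sum_congr rfl fun i _ => by ring

theorem signMean_neg {N : ℕ} (σ : Fin N → ℤˣ) (a : Fin N → ℝ) :
    signMean (-σ) a = -signMean σ a := by
  simp [signMean]

theorem abs_signMean_le {N : ℕ} (σ : Fin N → ℤˣ) (a : Fin N → ℝ) {M : ℝ} (hM0 : 0 ≤ M)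
    (hM : ∀ i, |a i| ≤ M) : |signMean σ a| ≤ M := by
  rw [signMean, abs_mul, abs_of_nonneg (by positivity)]
  have h : |∑ i, ((σ i : ℤ) : ℝ) * a i| ≤ N * M := by
    refine (Finset.abs_sum_le_sum_abs _ _).trans ?_
    refine (Finset.sum_le_sum fun i _ => ?_).trans_eq (b := ∑ _i : Fin N, M) (by simp)
    rw [abs_mul, abs_units_int_cast, one_mul]
    exact hM i
  rcases Nat.eq_zero_or_pos N with h0 | h0
  · subst h0; simpa using hM0
  · have : (0 : ℝ) < N := by exact_mod_cast h0
    calc 1 / (N : ℝ) * |∑ i, ((σ i : ℤ) : ℝ) * a i| ≤ 1 / (N : ℝ) * (N * M) := by gcongr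
      _ = M := by field_simp

theorem sum_signMean {N : ℕ} (a : Fin N → ℝ) : ∑ σ : Fin N → ℤˣ, signMean σ a = 0 := by
  have h : ∑ σ : Fin N → ℤˣ, signMean σ a = ∑ σ : Fin N → ℤˣ, signMean (-σ) a :=
    (Equiv.sum_comp (Equiv.neg (Fin N → ℤˣ)) fun σ => signMean σ a).symm
  simp only [signMean_neg, Finset.sum_neg_distrib] at h
  linarith

theorem rademacher_eq_sum_iSup {N : ℕ} {ι : Type*} (w : ι → Fin N → ℝ) :
    rademacher (Set.range w) = (∑ σ : Fin N → ℤˣ, ⨆ k, signMean σ (w k)) / 2 ^ N := by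
  simp only [rademacher, ← Set.range_comp]
  rfl

theorem bddAbove_signMean {N : ℕ} {ι : Type*} {w : ι → Fin N → ℝ} {M : ℝ} (hM0 : 0 ≤ M)
    (hM : ∀ k i, |w k i| ≤ M) (σ : Fin N → ℤˣ) : BddAbove (Set.range fun k => signMean σ (w k)) :=
  ⟨M, by rintro _ ⟨k, rfl⟩; exact (abs_le.1 (abs_signMean_le σ _ hM0 (hM k))).2⟩

theorem abs_ciSup_le {ι : Type*} [Nonempty ι] {g : ι → ℝ} {M : ℝ} (h : ∀ k, |g k| ≤ M) :
    |⨆ k, g k| ≤ M := by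
  obtain ⟨k⟩ := ‹Nonempty ι›
  have : Nonempty ι := ⟨k⟩
  refine abs_le.2 ⟨?_, ciSup_le fun k => (abs_le.1 (h k)).2⟩
  exact (abs_le.1 (h k)).1.trans
    (le_ciSup (f := g) ⟨M, by rintro _ ⟨k, rfl⟩; exact (abs_le.1 (h k)).2⟩ k)

theorem abs_ciSup_sub_ciSup_le {ι : Type*} [Nonempty ι] {g h : ι → ℝ} {c : ℝ}
    (hg : BddAbove (Set.range g)) (hh : BddAbove (Set.range h)) (hc : ∀ k, |g k - h k| ≤ c) :
    |(⨆ k, g k) - ⨆ k, h k| ≤ c := by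
  rw [abs_sub_le_iff]
  constructor
  · rw [sub_le_iff_le_add]
    refine ciSup_le fun k => ?_
    have := (abs_le.1 (hc k)).2
    have := le_ciSup hh k
    linarith
  · rw [sub_le_iff_le_add]
    refine ciSup_le fun k => ?_
    have := (abs_le.1 (hc k)).1
    have := le_ciSup hg k
    linarith

theorem card_signs (N : ℕ) : Fintype.card (Fin N → ℤˣ) = 2 ^ N := by simp

theorem abs_rademacher_range_le {N : ℕ} {ι : Type*} [Nonempty ι] {w : ι → Fin N → ℝ} {M : ℝ}
    (hM0 : 0 ≤ M) (hM : ∀ k i, |w k i| ≤ M) : |rademacher (Set.range w)| ≤ M := by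
  rw [rademacher_eq_sum_iSup, abs_div, abs_of_pos (by positivity : (0 : ℝ) < 2 ^ N),
    div_le_iff₀ (by positivity)]
  refine (Finset.abs_sum_le_sum_abs _ _).trans ?_
  refine (Finset.sum_le_sum fun σ _ => abs_ciSup_le fun k =>
    abs_signMean_le σ (w k) hM0 (hM k)).trans_eq ?_
  rw [Finset.sum_const, Finset.card_univ, card_signs, nsmul_eq_mul]
  push_cast
  ring

theorem rademacher_range_add_le {N : ℕ} {ι : Type*} [Nonempty ι] {v w : ι → Fin N → ℝ} {M : ℝ}
    (hM0 : 0 ≤ M) (hv : ∀ k i, |v k i| ≤ M) (hw : ∀ k i, |w k i| ≤ M) :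
    rademacher (Set.range fun k i => v k i + w k i)
      ≤ rademacher (Set.range v) + rademacher (Set.range w) := by
  simp only [rademacher_eq_sum_iSup, ← add_div, ← Finset.sum_add_distrib]
  refine div_le_div_of_nonneg_right (Finset.sum_le_sum fun σ _ => ciSup_le fun k => ?_)
    (by positivity)
  rw [signMean_add]
  exact add_le_add (le_ciSup (bddAbove_signMean hM0 hv σ) k)
    (le_ciSup (bddAbove_signMean hM0 hw σ) k)

/-- For each `σ` the fixed vector only adds `signMean σ v` to the supremum, and these terms cancel
in the sum over `σ`. This is how the initial network function disappears from the bound. -/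
theorem rademacher_range_const_add {N : ℕ} {ι : Type*} [Nonempty ι] (v : Fin N → ℝ)
    {w : ι → Fin N → ℝ} {M : ℝ} (hM0 : 0 ≤ M) (hw : ∀ k i, |w k i| ≤ M) :
    rademacher (Set.range fun k i => v i + w k i) = rademacher (Set.range w) := by
  simp only [rademacher_eq_sum_iSup]
  congr 1
  have h : ∀ σ : Fin N → ℤˣ, ⨆ k, signMean σ (fun i => v i + w k i)
      = signMean σ v + ⨆ k, signMean σ (w k) := by
    intro σ
    simp_rw [signMean_add]
    rw [add_ciSup (bddAbove_signMean hM0 hw σ)]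
  simp_rw [h, Finset.sum_add_distrib, sum_signMean, zero_add]

theorem rademacher_range_const_mul {N : ℕ} {ι : Type*} {c : ℝ} (hc : 0 ≤ c)
    (w : ι → Fin N → ℝ) :
    rademacher (Set.range fun k i => c * w k i) = c * rademacher (Set.range w) := by
  simp only [rademacher_eq_sum_iSup, signMean_smul, ← Real.mul_iSup_of_nonneg hc,
    ← Finset.mul_sum]
  ring

/-- Flipping the sign of one coordinate. -/
noncomputable def flipSign {N : ℕ} (j : Fin N) : (Fin N → ℤˣ) ≃ (Fin N → ℤˣ) :=
  Function.Involutive.toPerm (fun σ => Function.update σ j (-σ j)) fun σ => by simp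

theorem flipSign_apply {N : ℕ} (j : Fin N) (σ : Fin N → ℤˣ) :
    flipSign j σ = Function.update σ j (-σ j) := rfl

/-- The core of the contraction principle. For indices `k, k'` the left side is at most `u k + u k'
+ |v k - v k'|`; the sign of `v k - v k'` decides which of the two indices is used in the supremum
with the plus sign. -/
theorem iSup_add_add_iSup_sub_le {ι : Type*} [Nonempty ι] {u w v : ι → ℝ} {M : ℝ}
    (hu : ∀ k, |u k| ≤ M) (hv : ∀ k, |v k| ≤ M)
    (hwv : ∀ k k', |w k - w k'| ≤ |v k - v k'|) :
    (⨆ k, (u k + w k)) + ⨆ k, (u k - w k) ≤ (⨆ k, (u k + v k)) + ⨆ k, (u k - v k) := by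
  have b1 : BddAbove (Set.range fun k => u k + v k) := ⟨M + M, by
    rintro _ ⟨k, rfl⟩; exact add_le_add (abs_le.1 (hu k)).2 (abs_le.1 (hv k)).2⟩
  have b2 : BddAbove (Set.range fun k => u k - v k) := ⟨M + M, by
    rintro _ ⟨k, rfl⟩
    have := (abs_le.1 (hu k)).2
    have := (abs_le.1 (hv k)).1
    simp only
    linarith⟩
  refine ciSup_add_ciSup_le fun k k' => ?_
  have h1 := (le_abs_self _).trans (hwv k k')
  rcases abs_cases (v k - v k') with ⟨h, _⟩ | ⟨h, _⟩
  · have := le_ciSup b1 k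
    have := le_ciSup b2 k'
    linarith
  · have := le_ciSup b1 k'
    have := le_ciSup b2 k
    linarith

/-- The contraction principle for Rademacher complexities. -/
theorem rademacher_contraction {N : ℕ} {ι : Type*} [Nonempty ι] {v w : ι → Fin N → ℝ} {M : ℝ}
    (hM0 : 0 ≤ M) (hv : ∀ k i, |v k i| ≤ M) (hw : ∀ k i, |w k i| ≤ M)
    (hwv : ∀ i k k', |w k i - w k' i| ≤ |v k i - v k' i|) :
    rademacher (Set.range w) ≤ rademacher (Set.range v) := by
  classical
  -- Coordinates are exchanged one at a time: `y S` interpolates between `v` at `∅` and `w` at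
  -- `Finset.univ`.
  set y : Finset (Fin N) → ι → Fin N → ℝ := fun S k i => if i ∈ S then w k i else v k i with hy
  have hyM : ∀ S k i, |y S k i| ≤ M := by
    intro S k i
    simp only [hy]
    split_ifs
    exacts [hw k i, hv k i]
  have key : ∀ S, rademacher (Set.range (y S)) ≤ rademacher (Set.range v) := by
    intro S
    induction S using Finset.induction_on with
    | empty => simp [hy]
    | insert j S hj ih =>
      refine le_trans ?_ ih
      simp only [rademacher_eq_sum_iSup]
      refine div_le_div_of_nonneg_right ?_ (by positivity)
      -- Pairing each sign vector with its flip at `j` isolates that coordinate: both members of the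
      -- pair share the contribution `u` of the other coordinates and carry coordinate `j` with
      -- opposite signs.
      have hflip : ∀ T : Finset (Fin N), 2 * ∑ σ : Fin N → ℤˣ, ⨆ k, signMean σ (y T k)
          = ∑ σ : Fin N → ℤˣ, ((⨆ k, signMean σ (y T k))
            + ⨆ k, signMean (flipSign j σ) (y T k)) := by
        intro T
        rw [Finset.sum_add_distrib,
          Equiv.sum_comp (flipSign j) fun σ => ⨆ k, signMean σ (y T k)]
        ring
      suffices h : 2 * ∑ σ : Fin N → ℤˣ, ⨆ k, signMean σ (y (insert j S) k)
          ≤ 2 * ∑ σ : Fin N → ℤˣ, ⨆ k, signMean σ (y S k) by linarith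
      rw [hflip, hflip]
      refine Finset.sum_le_sum fun σ _ => ?_
      set u : ι → ℝ := fun k => (1 / (N : ℝ)) * ∑ i ∈ Finset.univ.erase j, ((σ i : ℤ) : ℝ) * y S k i
        with hu
      set s : ℝ := (1 / (N : ℝ)) * ((σ j : ℤ) : ℝ) with hs
      have e1 : ∀ k, signMean σ (y (insert j S) k) = u k + s * w k j := by
        intro k
        rw [signMean, ← Finset.add_sum_erase _ _ (Finset.mem_univ j), hu, hs]
        have : ∑ i ∈ Finset.univ.erase j, ((σ i : ℤ) : ℝ) * y (insert j S) k i
            = ∑ i ∈ Finset.univ.erase j, ((σ i : ℤ) : ℝ) * y S k i :=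
          Finset.sum_congr rfl fun i hi => by
            simp [hy, Finset.mem_insert, Finset.ne_of_mem_erase hi]
        rw [this]
        simp [hy]
        ring
      have e2 : ∀ k, signMean (flipSign j σ) (y (insert j S) k) = u k - s * w k j := by
        intro k
        rw [signMean, ← Finset.add_sum_erase _ _ (Finset.mem_univ j), hu, hs]
        have : ∑ i ∈ Finset.univ.erase j, ((flipSign j σ i : ℤ) : ℝ) * y (insert j S) k i
            = ∑ i ∈ Finset.univ.erase j, ((σ i : ℤ) : ℝ) * y S k i :=
          Finset.sum_congr rfl fun i hi => by
            simp [hy, Finset.mem_insert, Finset.ne_of_mem_erase hi, flipSign_apply]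
        rw [this]
        simp [hy, flipSign_apply]
        ring
      have e3 : ∀ k, signMean σ (y S k) = u k + s * v k j := by
        intro k
        rw [signMean, ← Finset.add_sum_erase _ _ (Finset.mem_univ j), hu, hs]
        simp [hy, hj]
        ring
      have e4 : ∀ k, signMean (flipSign j σ) (y S k) = u k - s * v k j := by
        intro k
        rw [signMean, ← Finset.add_sum_erase _ _ (Finset.mem_univ j), hu, hs]
        have : ∑ i ∈ Finset.univ.erase j, ((flipSign j σ i : ℤ) : ℝ) * y S k i
            = ∑ i ∈ Finset.univ.erase j, ((σ i : ℤ) : ℝ) * y S k i :=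
          Finset.sum_congr rfl fun i hi => by
            simp [Finset.ne_of_mem_erase hi, flipSign_apply]
        rw [this]
        simp [hy, hj, flipSign_apply]
        ring
      simp_rw [e1, e2, e3, e4]
      have hsv : ∀ k, |s * v k j| ≤ |s| * M := fun k => by
        rw [abs_mul]; exact mul_le_mul_of_nonneg_left (hv k j) (abs_nonneg _)
      have hu' : ∀ k, |u k| ≤ M + |s| * M := by
        intro k
        have h1 := abs_signMean_le σ (y S k) hM0 (hyM S k)
        have h2 : u k = signMean σ (y S k) - s * v k j := by rw [e3]; ring
        rw [h2]
        exact (abs_sub _ _).trans (add_le_add h1 (hsv k))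
      refine iSup_add_add_iSup_sub_le (M := M + |s| * M) hu' (fun k => (hsv k).trans (by linarith))
        fun k k' => ?_
      rw [← mul_sub, ← mul_sub, abs_mul s, abs_mul s]
      exact mul_le_mul_of_nonneg_left (hwv j k k') (abs_nonneg _)
  have := key Finset.univ
  simpa [hy] using this

/-- The Rademacher complexity of a bounded set of linear functionals. -/
theorem rademacher_linear_le {N : ℕ} (hN : 0 < N) {ι E : Type*} [Nonempty ι]
    [NormedAddCommGroup E] [InnerProductSpace ℝ E] (g : Fin N → E) (e : ι → E) {r K : ℝ}
    (hr : ∀ k, ‖e k‖ ≤ r) (hK0 : 0 ≤ K) (hK : ∀ i, ‖g i‖ ≤ K) :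
    rademacher (Set.range fun k i => (inner ℝ (g i) (e k) : ℝ)) ≤ r * K / Real.sqrt N := by
  have hN' : (0 : ℝ) < N := by exact_mod_cast hN
  have hr0 : 0 ≤ r := by
    obtain ⟨k⟩ := ‹Nonempty ι›
    exact (norm_nonneg _).trans (hr k)
  rw [rademacher_eq_sum_iSup]
  set G : (Fin N → ℤˣ) → E := fun σ => ∑ i, ((σ i : ℤ) : ℝ) • g i with hG
  have h1 : ∀ σ : Fin N → ℤˣ, ⨆ k, signMean σ (fun i => (inner ℝ (g i) (e k) : ℝ))
      ≤ r / N * ‖G σ‖ := by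
    intro σ
    refine ciSup_le fun k => ?_
    have : signMean σ (fun i => (inner ℝ (g i) (e k) : ℝ)) = 1 / N * inner ℝ (G σ) (e k) := by
      simp [signMean, hG, sum_inner, real_inner_smul_left]
    rw [this]
    have h2 := (real_inner_le_norm (G σ) (e k)).trans
      (mul_le_mul_of_nonneg_left (hr k) (norm_nonneg _))
    calc 1 / (N : ℝ) * inner ℝ (G σ) (e k) ≤ 1 / N * (‖G σ‖ * r) := by gcongr
      _ = r / N * ‖G σ‖ := by ring
  -- Distinct signs are orthogonal under averaging, so only the diagonal survives.
  have hsq : ∑ σ : Fin N → ℤˣ, ‖G σ‖ ^ 2 = 2 ^ N * ∑ i, ‖g i‖ ^ 2 := by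
    have h3 : ∀ σ : Fin N → ℤˣ, ‖G σ‖ ^ 2
        = ∑ i, ∑ j, ((σ i : ℤ) : ℝ) * ((σ j : ℤ) : ℝ) * inner ℝ (g i) (g j) := by
      intro σ
      rw [← real_inner_self_eq_norm_sq]
      simp only [hG, sum_inner, inner_sum, real_inner_smul_left, real_inner_smul_right]
      exact Finset.sum_congr rfl fun i _ => Finset.sum_congr rfl fun j _ => by
        rw [real_inner_comm]; ring
    have h4 : ∀ i j : Fin N, ∑ σ : Fin N → ℤˣ, ((σ i : ℤ) : ℝ) * ((σ j : ℤ) : ℝ)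
        = if i = j then 2 ^ N else 0 := by
      intro i j
      split_ifs with h
      · subst h
        have : ∀ σ : Fin N → ℤˣ, ((σ i : ℤ) : ℝ) * ((σ i : ℤ) : ℝ) = 1 := fun σ => by
          rcases Int.units_eq_one_or (σ i) with h | h <;> simp [h]
        simp only [this, Finset.sum_const, Finset.card_univ, card_signs, nsmul_eq_mul]
        simp
      · have h5 := Equiv.sum_comp (flipSign i) fun σ : Fin N → ℤˣ => ((σ i : ℤ) : ℝ) * ((σ j : ℤ) : ℝ)
        simp [flipSign_apply, Function.update_of_ne (Ne.symm h)] at h5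
        linarith
    simp_rw [h3]
    rw [Finset.sum_comm]
    rw [Finset.mul_sum]
    refine Finset.sum_congr rfl fun i _ => ?_
    rw [Finset.sum_comm]
    simp_rw [← Finset.sum_mul, h4]
    simp
  -- Cauchy–Schwarz over the sign vectors passes from the second moment to the first; this is where
  -- the factor `√N` instead of `N` appears.
  have hle : ∑ σ : Fin N → ℤˣ, ‖G σ‖ ≤ 2 ^ N * (Real.sqrt N * K) := by
    have h6 := sq_sum_le_card_mul_sum_sq (s := (Finset.univ : Finset (Fin N → ℤˣ)))
      (f := fun σ => ‖G σ‖)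
    rw [Finset.card_univ, card_signs, hsq] at h6
    have h7 : ∑ i, ‖g i‖ ^ 2 ≤ N * K ^ 2 := by
      refine (Finset.sum_le_sum fun i _ => pow_le_pow_left₀ (norm_nonneg _) (hK i) 2).trans_eq ?_
      simp
    refine le_of_sq_le_sq ?_ (by positivity)
    refine h6.trans ?_
    push_cast
    calc (2 : ℝ) ^ N * (2 ^ N * ∑ i, ‖g i‖ ^ 2) ≤ 2 ^ N * (2 ^ N * (N * K ^ 2)) := by gcongr
      _ = (2 ^ N * (Real.sqrt N * K)) ^ 2 := by
        rw [mul_pow, mul_pow, Real.sq_sqrt hN'.le]; ring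
  rw [div_le_iff₀ (by positivity)]
  calc _ ≤ ∑ σ : Fin N → ℤˣ, r / N * ‖G σ‖ := Finset.sum_le_sum fun σ _ => h1 σ
    _ = r / N * ∑ σ : Fin N → ℤˣ, ‖G σ‖ := by rw [Finset.mul_sum]
    _ ≤ r / N * (2 ^ N * (Real.sqrt N * K)) := by gcongr
    _ = r * K / Real.sqrt N * 2 ^ N := by
      have : (N : ℝ) = Real.sqrt N * Real.sqrt N := (Real.mul_self_sqrt hN'.le).symm
      have h8 : Real.sqrt N ≠ 0 := (Real.sqrt_pos.2 hN').ne'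
      rw [this]
      field_simp
      simp

end Rademacher

/-! ### Symmetrization and uniform deviations. -/

section UniformDeviation

theorem measurable_signMean {Ω : Type*} [MeasurableSpace Ω] {N : ℕ} (σ : Fin N → ℤˣ)
    {a : Ω → Fin N → ℝ} (ha : ∀ i, Measurable fun s => a s i) :
    Measurable fun s => signMean σ (a s) := by
  unfold signMean
  fun_prop

theorem measurable_rademacher_range {Ω : Type*} [MeasurableSpace Ω] {N : ℕ}
    {ι : Type*} [Countable ι]
    {w : Ω → ι → Fin N → ℝ} (hw : ∀ k i, Measurable fun s => w s k i) :
    Measurable fun s => rademacher (Set.range (w s)) := by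
  simp_rw [rademacher_eq_sum_iSup]
  refine Measurable.div_const (Finset.measurable_sum _ fun σ _ => ?_) _
  exact Measurable.iSup fun k => measurable_signMean σ fun i => hw k i

variable {Z : Type*} [MeasurableSpace Z] {ι : Type*} [Countable ι] [Nonempty ι]

theorem integral_comp_pi_fst (P : Measure Z) [IsProbabilityMeasure P] {N : ℕ}
    (F : (Fin N → Z) → ℝ) (hF : Measurable F) :
    ∫ w, F (fun i => (w i).1) ∂(Measure.pi fun _ : Fin N => P.prod P)
      = ∫ s, F s ∂(Measure.pi fun _ => P) := by
  have h : MeasurePreserving (fun (w : Fin N → Z × Z) i => (w i).1)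
      (Measure.pi fun _ => P.prod P) (Measure.pi fun _ => P) :=
    measurePreserving_pi (fun _ => P.prod P) (fun _ => P) fun _ => measurePreserving_fst
  rw [← h.map_eq, integral_map h.measurable.aemeasurable hF.aestronglyMeasurable]

theorem integral_comp_pi_snd (P : Measure Z) [IsProbabilityMeasure P] {N : ℕ}
    (F : (Fin N → Z) → ℝ) (hF : Measurable F) :
    ∫ w, F (fun i => (w i).2) ∂(Measure.pi fun _ : Fin N => P.prod P)
      = ∫ s, F s ∂(Measure.pi fun _ => P) := by
  have h : MeasurePreserving (fun (w : Fin N → Z × Z) i => (w i).2)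
      (Measure.pi fun _ => P.prod P) (Measure.pi fun _ => P) :=
    measurePreserving_pi (fun _ => P.prod P) (fun _ => P) fun _ => measurePreserving_snd
  rw [← h.map_eq, integral_map h.measurable.aemeasurable hF.aestronglyMeasurable]

/-- The two members of each pair are exchangeable, independently over the pairs. Random signs enter
symmetrization through these swaps. -/
theorem integral_comp_pi_swap (P : Measure Z) [IsProbabilityMeasure P] {N : ℕ}
    (σ : Fin N → ℤˣ) (F : (Fin N → Z × Z) → ℝ) (hF : Measurable F) :
    ∫ w, F (fun i => if σ i = 1 then w i else (w i).swap) ∂(Measure.pi fun _ => P.prod P)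
      = ∫ w, F w ∂(Measure.pi fun _ => P.prod P) := by
  have h : MeasurePreserving (fun (w : Fin N → Z × Z) i => if σ i = 1 then w i else (w i).swap)
      (Measure.pi fun _ => P.prod P) (Measure.pi fun _ => P.prod P) := by
    refine measurePreserving_pi (fun _ => P.prod P) (fun _ => P.prod P)
      (f := fun i p => if σ i = 1 then p else p.swap) fun i => ?_
    by_cases hi : σ i = 1
    · simp only [hi, if_true]
      exact MeasurePreserving.id _
    · simp only [hi, if_false]
      exact Measure.measurePreserving_swap
  conv_rhs => rw [← h.map_eq, integral_map h.measurable.aemeasurable hF.aestronglyMeasurable]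

theorem mean_integral_pi (P : Measure Z) [IsProbabilityMeasure P] {N : ℕ} (hN : 0 < N)
    {g : Z → ℝ} (hg : Integrable g P) :
    ∫ s : Fin N → Z, (1 / (N : ℝ)) * ∑ i, g (s i) ∂(Measure.pi fun _ => P) = ∫ z, g z ∂P := by
  have hN' : (N : ℝ) ≠ 0 := by exact_mod_cast hN.ne'
  have h : ∀ i : Fin N, MeasurePreserving (Function.eval i) (Measure.pi fun _ : Fin N => P) P :=
    fun i => measurePreserving_eval (fun _ : Fin N => P) i
  rw [integral_const_mul, integral_finsetSum]
  · have h2 : ∀ i : Fin N, ∫ s : Fin N → Z, g (s i) ∂(Measure.pi fun _ => P) = ∫ z, g z ∂P := by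
      intro i
      have h3 := integral_map (μ := Measure.pi fun _ : Fin N => P) (φ := Function.eval i) (f := g)
        (h i).measurable.aemeasurable (by rw [(h i).map_eq]; exact hg.aestronglyMeasurable)
      rw [(h i).map_eq] at h3
      exact h3.symm
    simp only [h2, Finset.sum_const, Finset.card_univ, Fintype.card_fin, nsmul_eq_mul]
    field_simp
  · intro i _
    exact (h i).integrable_comp_of_integrable hg

/-- Symmetrization: the expected uniform deviation is at most twice the expected Rademacher
complexity. -/
theorem integral_iSup_deviation_le (P : Measure Z) [IsProbabilityMeasure P] {N : ℕ} (hN : 0 < N)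
    {f : ι → Z → ℝ} (hf : ∀ k, Measurable (f k)) {B : ℝ} (hB : ∀ k z, |f k z| ≤ B) :
    ∫ s : Fin N → Z, ⨆ k, (∫ z, f k z ∂P - (1 / (N : ℝ)) * ∑ i, f k (s i)) ∂(Measure.pi fun _ => P)
      ≤ 2 * ∫ s : Fin N → Z, rademacher (Set.range fun k i => f k (s i))
        ∂(Measure.pi fun _ => P) := by
  obtain ⟨z₀⟩ : Nonempty Z := nonempty_of_isProbabilityMeasure P
  obtain ⟨k₀⟩ := ‹Nonempty ι›
  have : Nonempty ι := ⟨k₀⟩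
  have hB0 : 0 ≤ B := (abs_nonneg _).trans (hB k₀ z₀)
  have hint : ∀ k, Integrable (f k) P := fun k => integrable_of_abs_le (hf k) (hB k)
  set one : Fin N → ℤˣ := fun _ => 1
  have hone : ∀ a : Fin N → ℝ, signMean one a = (1 / (N : ℝ)) * ∑ i, a i := fun a => by
    simp [signMean, one]
  set μ := Measure.pi fun _ : Fin N => P with hμ
  set Φ : (Fin N → ℤˣ) → (Fin N → Z × Z) → ℝ := fun σ w =>
    ⨆ k, signMean σ (fun i => f k (w i).1 - f k (w i).2) with hΦ
  have hdB : ∀ (k : ι) (p : Z × Z), |f k p.1 - f k p.2| ≤ 2 * B := fun k p =>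
    (abs_sub _ _).trans (by linarith [hB k p.1, hB k p.2])
  have hΦm : ∀ σ, Measurable (Φ σ) := fun σ => Measurable.iSup fun k =>
    measurable_signMean σ fun i => by
      have := hf k
      fun_prop
  have hΦB : ∀ σ w, |Φ σ w| ≤ 2 * B := fun σ w => abs_ciSup_le fun k =>
    abs_signMean_le σ _ (by linarith) fun i => hdB k (w i)
  -- ghost sample
  have step1 : ∫ s : Fin N → Z, ⨆ k, (∫ z, f k z ∂P - (1 / (N : ℝ)) * ∑ i, f k (s i)) ∂μ
      ≤ ∫ w, Φ one w ∂(Measure.pi fun _ => P.prod P) := by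
    have e := measurePreserving_arrowProdEquivProdArrow Z Z (Fin N) (fun _ => P) (fun _ => P)
    have h1 : ∫ w, Φ one w ∂(Measure.pi fun _ => P.prod P)
        = ∫ q : (Fin N → Z) × (Fin N → Z), Φ one (fun i => (q.1 i, q.2 i)) ∂(μ.prod μ) := by
      rw [← e.integral_comp']
      rfl
    have hmq : Measurable fun q : (Fin N → Z) × (Fin N → Z) => Φ one (fun i => (q.1 i, q.2 i)) :=
      (hΦm one).comp (by fun_prop)
    rw [h1, integral_prod_symm]
    · refine integral_mono ?_ (integrable_of_abs_le hmq fun q => hΦB _ _).integral_prod_right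
        fun s => ?_
      · refine integrable_of_abs_le (M := B + B) (Measurable.iSup fun k => ?_) fun s =>
          abs_ciSup_le fun k => ?_
        · have := hf k
          fun_prop
        · refine (abs_sub _ _).trans (add_le_add (abs_integral_le_of_abs_le (hB k)) ?_)
          rw [← hone]
          exact abs_signMean_le one _ hB0 fun i => hB k _
      · refine ciSup_le fun k => ?_
        have i3 : Integrable (fun x : Fin N → Z => 1 / (N : ℝ) * ∑ i, f k (x i)) μ := by
          refine integrable_of_abs_le (M := B) ?_ fun x => ?_
          · have := hf k
            fun_prop
          · rw [← hone]
            exact abs_signMean_le one _ hB0 fun i => hB k _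
        rw [← mean_integral_pi P hN (hint k)]
        have : ∫ x : Fin N → Z, 1 / (N : ℝ) * ∑ i, f k (x i) ∂μ - 1 / (N : ℝ) * ∑ i, f k (s i)
            = ∫ x : Fin N → Z, (1 / (N : ℝ) * ∑ i, f k (x i) - 1 / (N : ℝ) * ∑ i, f k (s i)) ∂μ := by
          rw [integral_sub i3 (integrable_const _)]
          simp
        rw [this]
        refine integral_mono (i3.sub (integrable_const _)) ?_ fun x => ?_
        · exact integrable_of_abs_le (hmq.comp measurable_prodMk_right) fun _ => hΦB _ _
        · have e1 : 1 / (N : ℝ) * ∑ i, f k (x i) - 1 / (N : ℝ) * ∑ i, f k (s i)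
              = signMean one fun i => f k (x i) - f k (s i) := by
            rw [hone, Finset.sum_sub_distrib, mul_sub]
          simp only
          rw [e1]
          exact le_ciSup (bddAbove_signMean (w := fun k i => f k (x i) - f k (s i))
            (by linarith : 0 ≤ 2 * B) (fun k i => hdB k (x i, s i)) one) k
    · exact integrable_of_abs_le hmq fun q => hΦB _ _
  -- Swapping pair `i` negates the `i`-th difference, so all sign patterns give the same
  -- expectation.
  have step2 : ∀ σ, ∫ w, Φ one w ∂(Measure.pi fun _ => P.prod P)
      = ∫ w, Φ σ w ∂(Measure.pi fun _ => P.prod P) := by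
    intro σ
    rw [← integral_comp_pi_swap P σ (Φ one) (hΦm one)]
    refine integral_congr_ae (ae_of_all _ fun w => ?_)
    simp only [hΦ]
    refine iSup_congr fun k => ?_
    simp only [signMean, one]
    congr 1
    refine Finset.sum_congr rfl fun i _ => ?_
    rcases Int.units_eq_one_or (σ i) with h | h <;> simp [h]
  set ρ : (Fin N → ℤˣ) → (Fin N → Z) → ℝ := fun σ s => ⨆ k, signMean σ (fun i => f k (s i)) with hρ
  have hρm : ∀ σ, Measurable (ρ σ) := fun σ => Measurable.iSup fun k =>
    measurable_signMean σ fun i => by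
      have := hf k
      fun_prop
  have hρB : ∀ σ w, |ρ σ w| ≤ B := fun σ w => abs_ciSup_le fun k =>
    abs_signMean_le σ _ hB0 fun i => hB k (w i)
  have hρi : ∀ σ, Integrable (ρ σ) μ := fun σ => integrable_of_abs_le (hρm σ) (hρB σ)
  -- The second members of the pairs carry the opposite signs, hence `-σ`; the sum over all sign
  -- vectors does not notice.
  have step3 : ∀ σ, ∫ w, Φ σ w ∂(Measure.pi fun _ => P.prod P)
      ≤ ∫ s, ρ σ s ∂μ + ∫ s, ρ (-σ) s ∂μ := by
    intro σ
    rw [← integral_comp_pi_fst P (ρ σ) (hρm σ), ← integral_comp_pi_snd P (ρ (-σ)) (hρm _)]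
    have m1 : Measurable fun w : Fin N → Z × Z => ρ σ (fun i => (w i).1) :=
      (hρm σ).comp (by fun_prop)
    have m2 : Measurable fun w : Fin N → Z × Z => ρ (-σ) (fun i => (w i).2) :=
      (hρm _).comp (by fun_prop)
    have i1 : Integrable (fun w : Fin N → Z × Z => ρ σ (fun i => (w i).1))
      (Measure.pi fun _ => P.prod P) := integrable_of_abs_le m1 fun _ => hρB _ _
    have i2 : Integrable (fun w : Fin N → Z × Z => ρ (-σ) (fun i => (w i).2))
      (Measure.pi fun _ => P.prod P) := integrable_of_abs_le m2 fun _ => hρB _ _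
    rw [← integral_add i1 i2]
    refine integral_mono (integrable_of_abs_le (hΦm σ) (hΦB σ)) (i1.add i2) fun w => ?_
    refine ciSup_le fun k => ?_
    have : signMean σ (fun i => f k (w i).1 - f k (w i).2)
        = signMean σ (fun i => f k (w i).1) + signMean (-σ) (fun i => f k (w i).2) := by
      rw [signMean_neg]
      simp only [signMean, mul_sub, Finset.sum_sub_distrib]
      ring
    rw [this]
    exact add_le_add
      (le_ciSup (bddAbove_signMean (w := fun k i => f k (w i).1) hB0 (fun k i => hB k _) σ) k)
      (le_ciSup (bddAbove_signMean (w := fun k i => f k (w i).2) hB0 (fun k i => hB k _) (-σ)) k)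
  have hrad : ∫ s : Fin N → Z, rademacher (Set.range fun k i => f k (s i)) ∂μ
      = (∑ σ, ∫ s, ρ σ s ∂μ) / 2 ^ N := by
    simp_rw [rademacher_eq_sum_iSup]
    rw [integral_div, integral_finsetSum _ fun σ _ => hρi σ]
  refine step1.trans ?_
  have hsum : (2 : ℝ) ^ N * ∫ w, Φ one w ∂(Measure.pi fun _ => P.prod P)
      ≤ 2 * ∑ σ, ∫ s, ρ σ s ∂μ := by
    calc (2 : ℝ) ^ N * ∫ w, Φ one w ∂(Measure.pi fun _ => P.prod P)
        = ∑ _σ : Fin N → ℤˣ, ∫ w, Φ one w ∂(Measure.pi fun _ => P.prod P) := by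
          rw [Finset.sum_const, Finset.card_univ, card_signs, nsmul_eq_mul]
          push_cast
          rfl
      _ ≤ ∑ σ : Fin N → ℤˣ, (∫ s, ρ σ s ∂μ + ∫ s, ρ (-σ) s ∂μ) :=
          Finset.sum_le_sum fun σ _ => (step2 σ).trans_le (step3 σ)
      _ = 2 * ∑ σ, ∫ s, ρ σ s ∂μ := by
          rw [Finset.sum_add_distrib]
          have := Equiv.sum_comp (Equiv.neg (Fin N → ℤˣ)) fun σ => ∫ s, ρ σ s ∂μ
          simp only [Equiv.neg_apply] at this
          rw [this]
          ring
  rw [hrad]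
  have h2 : (0 : ℝ) < 2 ^ N := by positivity
  rw [← mul_div_assoc, le_div_iff₀ h2]
  linarith

/-- Uniform deviation bound with the expected Rademacher complexity. -/
theorem measure_uniform_deviation_le (P : Measure Z) [IsProbabilityMeasure P] {N : ℕ}
    (hN : 0 < N) {f : ι → Z → ℝ} (hf : ∀ k, Measurable (f k)) {B : ℝ} (hB : ∀ k z, |f k z| ≤ B)
    {δ : ℝ} (hδ : 0 < δ) (hδ1 : δ < 1) :
    (Measure.pi fun _ : Fin N => P) {s | ∃ k,
      2 * (∫ s : Fin N → Z, rademacher (Set.range fun k i => f k (s i)) ∂(Measure.pi fun _ => P))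
        + B * Real.sqrt (2 * Real.log (1 / δ) / N)
        < ∫ z, f k z ∂P - (1 / (N : ℝ)) * ∑ i, f k (s i)} ≤ ENNReal.ofReal δ := by
  obtain ⟨z₀⟩ : Nonempty Z := nonempty_of_isProbabilityMeasure P
  obtain ⟨k₀⟩ := ‹Nonempty ι›
  have : Nonempty ι := ⟨k₀⟩
  have hN' : (0 : ℝ) < N := by exact_mod_cast hN
  have hB0 : 0 ≤ B := (abs_nonneg _).trans (hB k₀ z₀)
  set μ := Measure.pi fun _ : Fin N => P with hμ
  have hlog : 0 < Real.log (1 / δ) := Real.log_pos (by rw [lt_div_iff₀ hδ]; linarith)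
  set u := B * Real.sqrt (2 * Real.log (1 / δ) / N) with hu
  have hdev : ∀ (k : ι) (s : Fin N → Z), |∫ z, f k z ∂P - (1 / (N : ℝ)) * ∑ i, f k (s i)| ≤ B + B := by
    intro k s
    refine (abs_sub _ _).trans (add_le_add (abs_integral_le_of_abs_le (hB k)) ?_)
    have := abs_signMean_le (fun _ => 1) (fun i => f k (s i)) hB0 fun i => hB k _
    simpa [signMean] using this
  set G : (Fin N → Z) → ℝ := fun s => ⨆ k, (∫ z, f k z ∂P - (1 / (N : ℝ)) * ∑ i, f k (s i)) with hG
  have hGm : Measurable G := Measurable.iSup fun k => by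
    have := hf k
    fun_prop
  have hbdd : ∀ s : Fin N → Z,
      BddAbove (Set.range fun k => ∫ z, f k z ∂P - (1 / (N : ℝ)) * ∑ i, f k (s i)) := fun s =>
    ⟨B + B, by rintro _ ⟨k, rfl⟩; exact (abs_le.1 (hdev k s)).2⟩
  have hEG := integral_iSup_deviation_le P hN hf hB
  -- The bounded differences inequality needs a positive increment. If `B = 0`, all functions vanish
  -- and the exceptional set is empty.
  rcases hB0.eq_or_lt with h0 | hBpos
  · have hf0 : ∀ k z, f k z = 0 := fun k z => by
      have := hB k z
      rw [← h0] at this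
      exact abs_nonpos_iff.1 this
    have hr0 : ∀ s : Fin N → Z, rademacher (Set.range fun (k : ι) i => f k (s i)) = 0 := by
      intro s
      rw [rademacher_eq_sum_iSup]
      simp [hf0, signMean]
    have : {s : Fin N → Z | ∃ k, 2 * (∫ s : Fin N → Z, rademacher (Set.range fun k i => f k (s i)) ∂μ) + u
        < ∫ z, f k z ∂P - (1 / (N : ℝ)) * ∑ i, f k (s i)} = ∅ := by
      ext s
      simp only [hr0, hu, ← h0]
      simp [hf0]
    rw [this]
    simp
  -- Replacing one sample point moves the empirical mean by at most `2 * B / N`; `u` is chosen so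
  -- that the exponent becomes `-log (1 / δ)`.
  · have hmc := measure_boundedDifferences_ge_le P (c := 2 * B / N) (by positivity) hN hGm
      ⟨B + B, fun s => abs_ciSup_le fun k => hdev k s⟩ (by
        intro s i z
        refine abs_ciSup_sub_ciSup_le (hbdd _) (hbdd _) fun k => ?_
        have h1 : ∑ j, f k (Function.update s i z j) = f k z + ∑ j ∈ Finset.univ.erase i, f k (s j) := by
          rw [← Finset.add_sum_erase _ _ (Finset.mem_univ i)]
          congr 1
          · simp
          · exact Finset.sum_congr rfl fun j hj => by simp [Finset.ne_of_mem_erase hj]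
        have h2 : ∑ j, f k (s j) = f k (s i) + ∑ j ∈ Finset.univ.erase i, f k (s j) := by
          rw [← Finset.add_sum_erase _ _ (Finset.mem_univ i)]
        rw [h1, h2]
        have h3 : ∫ z, f k z ∂P - 1 / (N : ℝ) * (f k z + ∑ j ∈ Finset.univ.erase i, f k (s j))
            - (∫ z, f k z ∂P - 1 / (N : ℝ) * (f k (s i) + ∑ j ∈ Finset.univ.erase i, f k (s j)))
            = 1 / (N : ℝ) * (f k (s i) - f k z) := by ring
        rw [h3, abs_mul, abs_of_pos (by positivity)]
        calc 1 / (N : ℝ) * |f k (s i) - f k z| ≤ 1 / (N : ℝ) * (B + B) := by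
              gcongr
              exact (abs_sub _ _).trans (add_le_add (hB _ _) (hB _ _))
          _ = 2 * B / N := by ring) (u := u) (by positivity)
    have hexp : Real.exp (-(2 * u ^ 2 / (N * (2 * B / N) ^ 2))) = δ := by
      rw [hu, mul_pow, Real.sq_sqrt (by positivity)]
      have : 2 * (B ^ 2 * (2 * Real.log (1 / δ) / N)) / (N * (2 * B / N) ^ 2)
          = Real.log (1 / δ) := by
        field_simp
      rw [this, Real.log_div one_ne_zero hδ.ne', Real.log_one]
      simp [Real.exp_log hδ]
    rw [hexp] at hmc
    refine (measure_mono ?_).trans (ENNReal.le_ofReal_iff_toReal_le (measure_ne_top _ _) hδ.le |>.2 hmc)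
    rintro s ⟨k, hk⟩
    have := le_ciSup (hbdd s) k
    simp only [Set.mem_ofPred_eq]
    have h4 : ∫ z, f k z ∂P - (1 / (N : ℝ)) * ∑ i, f k (s i) ≤ G s := this
    linarith

end UniformDeviation

/-! ### Gated networks: derivatives, linearity in the input, measurability and local bounds. -/

noncomputable section

namespace Arch

variable (A : Arch)

theorem weight_add (θ Δ : A.Param) (l : ℕ) (j : Fin (A.width (l + 1))) (k : Fin (A.width l)) :
    A.weight (θ + Δ) l j k = A.weight θ l j k + A.weight Δ l j k := by
  unfold weight
  split_ifs <;> simp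

theorem weight_smul (c : ℝ) (θ : A.Param) (l : ℕ) (j : Fin (A.width (l + 1)))
    (k : Fin (A.width l)) : A.weight (c • θ) l j k = c * A.weight θ l j k := by
  unfold weight
  split_ifs <;> simp

@[fun_prop]
theorem continuous_weight (l : ℕ) (j : Fin (A.width (l + 1))) (k : Fin (A.width l)) :
    Continuous fun θ : A.Param => A.weight θ l j k := by
  unfold weight
  split_ifs <;> fun_prop

@[fun_prop]
theorem differentiable_weight (l : ℕ) (j : Fin (A.width (l + 1))) (k : Fin (A.width l)) :
    Differentiable ℝ fun θ : A.Param => A.weight θ l j k := by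
  unfold weight
  split_ifs <;> fun_prop

theorem continuous_act (l : ℕ) (j : Fin (A.width l)) :
    Continuous fun p : A.Param × A.Input => A.act p.1 p.2 l j := by
  induction l with
  | zero => unfold act; fun_prop
  | succ l ih =>
    unfold act
    have : ∀ k, Continuous fun p : A.Param × A.Input => A.weight p.1 l j k := fun k =>
      (A.continuous_weight l j k).comp continuous_fst
    fun_prop

theorem continuous_net : Continuous fun p : A.Param × A.Input => A.net p.1 p.2 := by
  unfold net
  have := A.continuous_act A.depth
  fun_prop

theorem measurable_gate (l : ℕ) (j : Fin (A.width (l + 1))) :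
    Measurable fun p : A.Param × A.Input => A.gate p.1 p.2 l j := by
  unfold gate
  refine Measurable.ite (measurableSet_lt measurable_const ?_) measurable_const measurable_const
  have h1 : ∀ k, Continuous fun p : A.Param × A.Input => A.weight p.1 l j k := fun k =>
    (A.continuous_weight l j k).comp continuous_fst
  have h2 := A.continuous_act l
  exact Continuous.measurable (by fun_prop)

theorem gatedAct_gate (θ : A.Param) (x : A.Input) (l : ℕ) :
    A.gatedAct (A.gate θ x) θ x l = A.act θ x l := by
  induction l with
  | zero => rfl
  | succ l ih =>
    funext j
    simp only [gatedAct, act, ih, gate]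
    split_ifs with hpos
    · rw [max_eq_left hpos.le]
    · rw [max_eq_right (not_lt.mp hpos)]; simp

/-- The directional derivative in the direction `Δ` of the activations of a gated network. -/
def gatedTang (A : Arch) (g : (l : ℕ) → Fin (A.width (l + 1)) → ℝ) (θ Δ : A.Param) (x : A.Input) :
    (l : ℕ) → Fin (A.width l) → ℝ
  | 0 => fun _ => 0
  | l + 1 => fun j => g l j *
      ∑ k, (A.weight Δ l j k * A.gatedAct g θ x l k + A.weight θ l j k * A.gatedTang g θ Δ x l k)

/-- The directional derivative in the direction `Δ` of the output of a gated network. -/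
def gatedDir (g : (l : ℕ) → Fin (A.width (l + 1)) → ℝ) (θ Δ : A.Param) (x : A.Input) : ℝ :=
  ∑ k, (Δ (Sum.inr k) * A.gatedAct g θ x A.depth k
    + θ (Sum.inr k) * A.gatedTang g θ Δ x A.depth k)

theorem differentiable_gatedAct (g : (l : ℕ) → Fin (A.width (l + 1)) → ℝ) (x : A.Input) (l : ℕ)
    (j : Fin (A.width l)) : Differentiable ℝ fun θ => A.gatedAct g θ x l j := by
  induction l with
  | zero => unfold gatedAct; fun_prop
  | succ l ih => unfold gatedAct; fun_prop

theorem differentiable_gatedNet (g : (l : ℕ) → Fin (A.width (l + 1)) → ℝ) (x : A.Input) :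
    Differentiable ℝ fun θ => A.gatedNet g θ x := by
  have := A.differentiable_gatedAct g x A.depth
  unfold gatedNet
  fun_prop

theorem hasDerivAt_gatedAct (g : (l : ℕ) → Fin (A.width (l + 1)) → ℝ) (θ Δ : A.Param)
    (x : A.Input) (l : ℕ) (j : Fin (A.width l)) :
    HasDerivAt (fun t : ℝ => A.gatedAct g (θ + t • Δ) x l j) (A.gatedTang g θ Δ x l j) 0 := by
  induction l with
  | zero => exact hasDerivAt_const _ _
  | succ l ih =>
    unfold gatedAct gatedTang
    refine HasDerivAt.const_mul _ (HasDerivAt.fun_sum fun k _ => ?_)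
    have hw : HasDerivAt (fun t : ℝ => A.weight (θ + t • Δ) l j k) (A.weight Δ l j k) 0 := by
      simp only [weight_add, weight_smul]
      simpa using ((hasDerivAt_id (0 : ℝ)).mul_const (A.weight Δ l j k)).const_add
        (A.weight θ l j k)
    have := hw.mul (ih k)
    rw [zero_smul, add_zero] at this
    exact this

theorem hasDerivAt_gatedNet (g : (l : ℕ) → Fin (A.width (l + 1)) → ℝ) (θ Δ : A.Param)
    (x : A.Input) :
    HasDerivAt (fun t : ℝ => A.gatedNet g (θ + t • Δ) x) (A.gatedDir g θ Δ x) 0 := by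
  unfold gatedNet gatedDir
  refine HasDerivAt.fun_sum fun k _ => ?_
  have hw : HasDerivAt (fun t : ℝ => (θ + t • Δ) (Sum.inr k)) (Δ (Sum.inr k)) 0 := by
    simpa using ((hasDerivAt_id (0 : ℝ)).mul_const (Δ (Sum.inr k))).const_add (θ (Sum.inr k))
  have := hw.mul (A.hasDerivAt_gatedAct g θ Δ x A.depth k)
  rw [zero_smul, add_zero] at this
  exact this

/-- Later arguments reach the gradient only through this explicit recursion; linearity in the input,
measurability and the expansion of the remainder by layers are all read off from it. -/
theorem inner_gradient_gatedNet (g : (l : ℕ) → Fin (A.width (l + 1)) → ℝ) (θ Δ : A.Param)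
    (x : A.Input) :
    inner ℝ (gradient (fun θ' => A.gatedNet g θ' x) θ) Δ = A.gatedDir g θ Δ x := by
  rw [gradient, InnerProductSpace.toDual_symm_apply]
  have h1 := (A.differentiable_gatedNet g x θ).lineDeriv_eq_fderiv (v := Δ)
  rw [← h1]
  exact (A.hasDerivAt_gatedNet g θ Δ x).deriv

theorem inner_paramGrad (θ Δ : A.Param) (x : A.Input) :
    inner ℝ (A.paramGrad θ x) Δ = A.gatedDir (A.gate θ x) θ Δ x :=
  A.inner_gradient_gatedNet _ θ Δ x

theorem gatedAct_add (g : (l : ℕ) → Fin (A.width (l + 1)) → ℝ) (θ : A.Param) (x y : A.Input)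
    (l : ℕ) (j : Fin (A.width l)) :
    A.gatedAct g θ (x + y) l j = A.gatedAct g θ x l j + A.gatedAct g θ y l j := by
  induction l with
  | zero => rfl
  | succ l ih => simp only [gatedAct, ih, mul_add, Finset.sum_add_distrib]

theorem gatedAct_smul (g : (l : ℕ) → Fin (A.width (l + 1)) → ℝ) (θ : A.Param) (c : ℝ)
    (x : A.Input) (l : ℕ) (j : Fin (A.width l)) :
    A.gatedAct g θ (c • x) l j = c * A.gatedAct g θ x l j := by
  induction l with
  | zero => rfl
  | succ l ih =>
    simp only [gatedAct, ih, Finset.mul_sum]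
    exact Finset.sum_congr rfl fun k _ => by ring

theorem gatedTang_add (g : (l : ℕ) → Fin (A.width (l + 1)) → ℝ) (θ Δ : A.Param) (x y : A.Input)
    (l : ℕ) (j : Fin (A.width l)) :
    A.gatedTang g θ Δ (x + y) l j = A.gatedTang g θ Δ x l j + A.gatedTang g θ Δ y l j := by
  induction l with
  | zero => simp [gatedTang]
  | succ l ih =>
    simp only [gatedTang, ih, gatedAct_add, ← mul_add, ← Finset.sum_add_distrib]
    congr 1
    exact Finset.sum_congr rfl fun k _ => by ring

theorem gatedTang_smul (g : (l : ℕ) → Fin (A.width (l + 1)) → ℝ) (θ Δ : A.Param) (c : ℝ)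
    (x : A.Input) (l : ℕ) (j : Fin (A.width l)) :
    A.gatedTang g θ Δ (c • x) l j = c * A.gatedTang g θ Δ x l j := by
  induction l with
  | zero => simp [gatedTang]
  | succ l ih =>
    simp only [gatedTang, ih, gatedAct_smul, Finset.mul_sum]
    exact Finset.sum_congr rfl fun k _ => by ring

theorem gatedDir_add (g : (l : ℕ) → Fin (A.width (l + 1)) → ℝ) (θ Δ : A.Param) (x y : A.Input) :
    A.gatedDir g θ Δ (x + y) = A.gatedDir g θ Δ x + A.gatedDir g θ Δ y := by
  simp only [gatedDir, gatedAct_add, gatedTang_add, ← Finset.sum_add_distrib]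
  exact Finset.sum_congr rfl fun k _ => by ring

theorem gatedDir_smul (g : (l : ℕ) → Fin (A.width (l + 1)) → ℝ) (θ Δ : A.Param) (c : ℝ)
    (x : A.Input) : A.gatedDir g θ Δ (c • x) = c * A.gatedDir g θ Δ x := by
  simp only [gatedDir, gatedAct_smul, gatedTang_smul, Finset.mul_sum]
  exact Finset.sum_congr rfl fun k _ => by ring

/-- The parameter gradient of a gated network, as a linear function of the input. -/
def gatedGrad (g : (l : ℕ) → Fin (A.width (l + 1)) → ℝ) (θ : A.Param) : A.Input →ₗ[ℝ] A.Param where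
  toFun x := gradient (fun θ' => A.gatedNet g θ' x) θ
  map_add' x y := by
    refine ext_inner_right ℝ fun Δ => ?_
    rw [inner_add_left]
    simp only [inner_gradient_gatedNet, gatedDir_add]
  map_smul' c x := by
    refine ext_inner_right ℝ fun Δ => ?_
    rw [RingHom.id_apply, real_inner_smul_left]
    simp only [inner_gradient_gatedNet, gatedDir_smul]

/-- With frozen gates the parameter gradient is linear in the input and hence equal to its own
derivative, so the tangent sensitivity is its matrix. -/
theorem tangentSens_apply (θ : A.Param) (x : A.Input) (i : A.Idx) (j : Fin A.inDim) :
    A.tangentSens θ x i j = A.gatedGrad (A.gate θ x) θ (EuclideanSpace.single j 1) i := by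
  have h : (fun x' : A.Input => gradient (fun θ' => A.gatedNet (A.gate θ x) θ' x') θ)
      = LinearMap.toContinuousLinearMap (A.gatedGrad (A.gate θ x) θ) := rfl
  simp only [tangentSens, Matrix.of_apply]
  rw [h, ContinuousLinearMap.fderiv]
  rfl

/-- By linearity the gradient is the tangent sensitivity applied to `x`, and the Frobenius norm
dominates the operator norm. -/
theorem norm_paramGrad_le (θ : A.Param) (x : A.Input) :
    ‖A.paramGrad θ x‖ ≤ frobNorm (A.tangentSens θ x) * ‖x‖ := by
  have hx : A.paramGrad θ x = ∑ j, x j • A.gatedGrad (A.gate θ x) θ (EuclideanSpace.single j 1) := by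
    have h1 : A.paramGrad θ x = A.gatedGrad (A.gate θ x) θ x := rfl
    have h2 : x = ∑ j, x j • (EuclideanSpace.single j 1 : A.Input) := by
      ext i
      simp [Finset.sum_apply, Pi.single_apply]
    rw [h1]
    refine (congrArg (A.gatedGrad (A.gate θ x) θ) h2).trans ?_
    rw [map_sum]
    simp only [map_smul]
  have hi : ∀ i, A.paramGrad θ x i = ∑ j, A.tangentSens θ x i j * x j := by
    intro i
    rw [hx]
    simp only [WithLp.ofLp_sum, Finset.sum_apply, PiLp.smul_apply, smul_eq_mul, tangentSens_apply]
    exact Finset.sum_congr rfl fun j _ => mul_comm _ _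
  rw [EuclideanSpace.norm_eq, EuclideanSpace.norm_eq x, frobNorm, ← Real.sqrt_mul (by positivity)]
  refine Real.sqrt_le_sqrt ?_
  rw [Finset.sum_mul]
  refine Finset.sum_le_sum fun i _ => ?_
  simp only [Real.norm_eq_abs, sq_abs]
  rw [hi]
  exact Finset.sum_mul_sq_le_sq_mul_sq _ _ _

theorem measurable_gatedDir (Δ : A.Param) :
    Measurable fun p : A.Param × A.Input => A.gatedDir (A.gate p.1 p.2) p.1 Δ p.2 := by
  have hact : ∀ l j, Measurable fun p : A.Param × A.Input => A.act p.1 p.2 l j := fun l j =>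
    (A.continuous_act l j).measurable
  have hw : ∀ l j k, Measurable fun p : A.Param × A.Input => A.weight p.1 l j k := fun l j k =>
    ((A.continuous_weight l j k).comp continuous_fst).measurable
  have htang : ∀ l j, Measurable fun p : A.Param × A.Input =>
      A.gatedTang (A.gate p.1 p.2) p.1 Δ p.2 l j := by
    intro l
    induction l with
    | zero => intro j; unfold gatedTang; fun_prop
    | succ l ih =>
      intro j
      have hg := A.measurable_gate l j
      simp only [gatedTang, gatedAct_gate]
      have := hw l j
      have := hact l
      fun_prop
  have := hact A.depth
  have := htang A.depth
  simp only [gatedDir, gatedAct_gate]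
  fun_prop

theorem remainder_eq (θ₀ θ : A.Param) (x : A.Input) :
    A.remainder θ₀ θ x
      = A.net θ x - (A.net θ₀ x + A.gatedDir (A.gate θ₀ x) θ₀ (θ - θ₀) x) := by
  rw [remainder, inner_paramGrad]

theorem measurable_remainder_add (Δ : A.Param) :
    Measurable fun p : A.Param × A.Input => A.remainder p.1 (p.1 + Δ) p.2 := by
  simp only [remainder_eq, add_sub_cancel_left]
  refine Measurable.sub ?_ (Measurable.add ?_ (A.measurable_gatedDir Δ))
  · have : Continuous fun p : A.Param × A.Input => A.net (p.1 + Δ) p.2 :=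
      A.continuous_net.comp (by fun_prop : Continuous fun p : A.Param × A.Input => (p.1 + Δ, p.2))
    exact this.measurable
  · exact A.continuous_net.measurable

theorem measurable_remainder (θ₀ θ : A.Param) : Measurable (A.remainder θ₀ θ) := by
  have h := (A.measurable_remainder_add (θ - θ₀)).comp
    (measurable_prodMk_left (x := θ₀) : Measurable fun x : A.Input => (θ₀, x))
  simpa [Function.comp_def] using h

theorem continuous_net_left (x : A.Input) : Continuous fun θ => A.net θ x :=
  A.continuous_net.comp (by fun_prop : Continuous fun θ : A.Param => (θ, x))

theorem measurable_net (θ : A.Param) : Measurable (A.net θ) :=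
  (A.continuous_net.comp (by fun_prop : Continuous fun x : A.Input => (θ, x))).measurable

theorem continuous_remainder (θ₀ : A.Param) (x : A.Input) :
    Continuous fun θ => A.remainder θ₀ θ x := by
  have := A.continuous_net_left x
  unfold remainder
  fun_prop

theorem abs_gate_le (θ : A.Param) (x : A.Input) (l : ℕ) (j : Fin (A.width (l + 1))) :
    |A.gate θ x l j| ≤ |A.scale l| := by
  unfold gate
  split_ifs <;> simp

theorem exists_abs_net_le (θ₀ : A.Param) (ε Kx : ℝ) :
    ∃ M, ∀ θ ∈ Metric.closedBall θ₀ ε, ∀ x : A.Input, ‖x‖ ≤ Kx → |A.net θ x| ≤ M := by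
  have hK := (isCompact_closedBall θ₀ ε).prod (isCompact_closedBall (0 : A.Input) Kx)
  obtain ⟨M, hM⟩ := hK.exists_bound_of_continuousOn A.continuous_net.continuousOn
  exact ⟨M, fun θ hθ x hx => hM (θ, x) ⟨hθ, by simpa using hx⟩⟩

theorem exists_abs_gatedDir_le (θ₀ : A.Param) (ε Kx : ℝ) :
    ∃ M, ∀ Δ : A.Param, ‖Δ‖ ≤ ε → ∀ x : A.Input, ‖x‖ ≤ Kx →
      |A.gatedDir (A.gate θ₀ x) θ₀ Δ x| ≤ M := by
  -- The gates are discontinuous in `x`, so they are treated as free variables ranging over a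
  -- compact box; jointly in gates, direction and input the derivative is continuous, hence bounded
  -- on compacta.
  have hG : IsCompact (Set.pi Set.univ fun l : ℕ => Set.pi Set.univ fun _ : Fin (A.width (l + 1)) =>
      Set.Icc (-|A.scale l|) |A.scale l|) :=
    isCompact_univ_pi fun l => isCompact_univ_pi fun j => isCompact_Icc
  have hK := hG.prod ((isCompact_closedBall (0 : A.Param) ε).prod
    (isCompact_closedBall (0 : A.Input) Kx))
  have hact : ∀ l j, Continuous fun p : ((l : ℕ) → Fin (A.width (l + 1)) → ℝ) × A.Param × A.Input =>
      A.gatedAct p.1 θ₀ p.2.2 l j := by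
    intro l
    induction l with
    | zero => intro j; unfold gatedAct; fun_prop
    | succ l ih => intro j; unfold gatedAct; fun_prop
  have htang : ∀ l j, Continuous fun p : ((l : ℕ) → Fin (A.width (l + 1)) → ℝ) × A.Param × A.Input =>
      A.gatedTang p.1 θ₀ p.2.1 p.2.2 l j := by
    intro l
    induction l with
    | zero => intro j; unfold gatedTang; fun_prop
    | succ l ih =>
      intro j
      unfold gatedTang
      have := hact l
      have : ∀ k, Continuous fun p : ((l : ℕ) → Fin (A.width (l + 1)) → ℝ) × A.Param × A.Input =>
        A.weight p.2.1 l j k := fun k =>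
          (A.continuous_weight l j k).comp (continuous_fst.comp continuous_snd)
      fun_prop
  have hc : Continuous fun p : ((l : ℕ) → Fin (A.width (l + 1)) → ℝ) × A.Param × A.Input =>
      A.gatedDir p.1 θ₀ p.2.1 p.2.2 := by
    have := hact A.depth
    have := htang A.depth
    unfold gatedDir
    fun_prop
  obtain ⟨M, hM⟩ := hK.exists_bound_of_continuousOn hc.continuousOn
  refine ⟨M, fun Δ hΔ x hx => hM (A.gate θ₀ x, Δ, x) ⟨?_, ?_, ?_⟩⟩
  · intro l _ j _
    exact abs_le.1 (A.abs_gate_le θ₀ x l j)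
  · simpa using hΔ
  · simpa using hx

theorem exists_abs_remainder_le (θ₀ : A.Param) (ε Kx : ℝ) :
    ∃ M, ∀ θ ∈ Metric.closedBall θ₀ ε, ∀ x : A.Input, ‖x‖ ≤ Kx → |A.remainder θ₀ θ x| ≤ M := by
  obtain ⟨M₁, h₁⟩ := A.exists_abs_net_le θ₀ ε Kx
  obtain ⟨M₂, h₂⟩ := A.exists_abs_gatedDir_le θ₀ ε Kx
  refine ⟨M₁ + (M₁ + M₂), fun θ hθ x hx => ?_⟩
  have hε : 0 ≤ ε := dist_nonneg.trans (Metric.mem_closedBall.1 hθ)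
  rw [remainder_eq]
  refine (abs_sub _ _).trans (add_le_add (h₁ θ hθ x hx) ((abs_add_le _ _).trans (add_le_add
    (h₁ θ₀ (Metric.mem_closedBall_self hε) x hx) (h₂ _ ?_ x hx))))
  rwa [← dist_eq_norm]

end Arch

end

/-! ### Distance travelled by gradient descent and the generalization bound. -/

noncomputable section

theorem ae_forall_pi {Z : Type*} [MeasurableSpace Z] (P : Measure Z) [IsProbabilityMeasure P]
    {N : ℕ} {p : Z → Prop} (hp : ∀ᵐ z ∂P, p z) :
    ∀ᵐ s ∂(Measure.pi fun _ : Fin N => P), ∀ i, p (s i) :=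
  ae_all_iff.2 fun i =>
    (measurePreserving_eval (fun _ : Fin N => P) i).quasiMeasurePreserving.ae hp

namespace Arch

variable (A : Arch)

theorem norm_lossGrad_le (dℓ : ℝ → ℝ) {n : ℕ} (D : Fin n → A.Input × ℝ) (θ : A.Param)
    {C Kx : ℝ} (hC : ∀ i, frobNorm (A.tangentSens θ (D i).1) ≤ C)
    (hx : ∀ i, ‖(D i).1‖ ≤ Kx) :
    ‖A.lossGrad dℓ D θ‖
      ≤ Kx * C * ((1 / (n : ℝ)) * ∑ i, |dℓ (A.net θ (D i).1 - (D i).2)|) := by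
  rw [lossGrad, norm_smul, Real.norm_of_nonneg (by positivity)]
  have h : ‖∑ i, dℓ (A.net θ (D i).1 - (D i).2) • A.paramGrad θ (D i).1‖
      ≤ Kx * C * ∑ i, |dℓ (A.net θ (D i).1 - (D i).2)| := by
    rw [Finset.mul_sum]
    refine (norm_sum_le _ _).trans (Finset.sum_le_sum fun i _ => ?_)
    rw [norm_smul, Real.norm_eq_abs, mul_comm]
    refine mul_le_mul_of_nonneg_right ?_ (abs_nonneg _)
    refine (A.norm_paramGrad_le θ (D i).1).trans ?_
    rw [mul_comm]
    exact mul_le_mul (hx i) (hC i) (Real.sqrt_nonneg _) ((norm_nonneg _).trans (hx i))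
  calc _ ≤ 1 / (n : ℝ) * (Kx * C * ∑ i, |dℓ (A.net θ (D i).1 - (D i).2)|) := by gcongr
    _ = _ := by ring

/-- Bounded tangent sensitivity and a bounded learning signal bound the distance travelled inside
the ball. A trajectory that leaves the ball and returns forces `ε` below the bound. -/
theorem norm_sub_le_of_mem_reach {dℓ : ℝ → ℝ} {n : ℕ} {D : Fin n → A.Input × ℝ}
    {E : Set (ℕ → ℝ)} {θ₀ : A.Param} {ε Kx C CGD : ℝ} (hC0 : 0 ≤ C) (hKx : 0 ≤ Kx)
    (hpos : ∀ η ∈ E, ∀ t, 0 < η t)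
    (hC : ∀ θ ∈ A.reach dℓ D E θ₀ ε, ∀ i, frobNorm (A.tangentSens θ (D i).1) ≤ C)
    (hx : ∀ i, ‖(D i).1‖ ≤ Kx)
    (hGD : ∀ η ∈ E, ∀ T : ℕ, ∑ t ∈ Finset.range T, η (t + 1) *
        ((1 / (n : ℝ)) * ∑ i, |dℓ (A.net (A.gd dℓ D η θ₀ t) (D i).1 - (D i).2)|) ≤ CGD)
    {θ : A.Param} (hθ : θ ∈ A.reach dℓ D E θ₀ ε) : ‖θ - θ₀‖ ≤ Kx * C * CGD := by
  obtain ⟨⟨η, hη, T, rfl⟩, hball⟩ := hθ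
  have key : ∀ T, (∀ t < T, A.gd dℓ D η θ₀ t ∈ Metric.ball θ₀ ε) →
      ‖A.gd dℓ D η θ₀ T - θ₀‖ ≤ Kx * C * ∑ t ∈ Finset.range T, η (t + 1) *
        ((1 / (n : ℝ)) * ∑ i, |dℓ (A.net (A.gd dℓ D η θ₀ t) (D i).1 - (D i).2)|) := by
    intro T
    induction T with
    | zero => intro _; simp [gd]
    | succ T ih =>
      intro h
      have h1 := ih fun t ht => h t (ht.trans (Nat.lt_succ_self T))
      have h2 := A.norm_lossGrad_le dℓ D (A.gd dℓ D η θ₀ T)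
        (hC _ ⟨⟨η, hη, T, rfl⟩, h T (Nat.lt_succ_self T)⟩) hx
      have h3 : A.gd dℓ D η θ₀ (T + 1) - θ₀ = (A.gd dℓ D η θ₀ T - θ₀)
          - η (T + 1) • A.lossGrad dℓ D (A.gd dℓ D η θ₀ T) := by
        rw [gd]; abel
      rw [h3, Finset.sum_range_succ, mul_add]
      refine (norm_sub_le _ _).trans (add_le_add h1 ?_)
      rw [norm_smul, Real.norm_of_nonneg (hpos η hη _).le]
      refine (mul_le_mul_of_nonneg_left h2 (hpos η hη _).le).trans_eq ?_
      ring
  -- Only the iterates strictly before `T` must lie in the ball, so the bound still holds at the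
  -- first exit time.
  have key2 : ∀ T, (∀ t < T, A.gd dℓ D η θ₀ t ∈ Metric.ball θ₀ ε) →
      ‖A.gd dℓ D η θ₀ T - θ₀‖ ≤ Kx * C * CGD := fun T hT =>
    (key T hT).trans (mul_le_mul_of_nonneg_left (hGD η hη T) (by positivity))
  by_cases hall : ∀ t < T, A.gd dℓ D η θ₀ t ∈ Metric.ball θ₀ ε
  · exact key2 T hall
  · push Not at hall
    have hex : ∃ t, A.gd dℓ D η θ₀ t ∉ Metric.ball θ₀ ε := by
      obtain ⟨t, _, ht⟩ := hall
      exact ⟨t, ht⟩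
    classical
    -- The first iterate outside the ball is at distance at least `ε` and obeys the bound, while the
    -- iterate in question is closer than `ε`.
    have h4 := key2 (Nat.find hex) fun t ht => not_not.1 (Nat.find_min hex ht)
    have h5 := Nat.find_spec hex
    rw [Metric.mem_ball, dist_eq_norm, not_lt] at h5
    rw [Metric.mem_ball, dist_eq_norm] at hball
    linarith

end Arch

/-- The upper bound by the countable supremum is a closed condition, so it extends from the dense
sequence to `U`. Uncountable suprema become measurable this way. -/
theorem csSup_image_eq_ciSup_of_denseRange {X : Type*} [TopologicalSpace X] {U : Set X} {F : X → ℝ}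
    (hF : Continuous F) (hb : BddAbove (F '' U)) {u : ℕ → U} (hu : DenseRange u) :
    sSup (F '' U) = ⨆ k, F (u k) := by
  have hbu : BddAbove (Set.range fun k => F (u k)) := hb.mono (by
    rintro _ ⟨k, rfl⟩
    exact ⟨u k, (u k).2, rfl⟩)
  apply le_antisymm
  · refine csSup_le ⟨F (u 0), u 0, (u 0).2, rfl⟩ ?_
    rintro _ ⟨x, hx, rfl⟩
    refine hu.induction_on (p := fun y : U => F y ≤ ⨆ k, F (u k)) ⟨x, hx⟩ ?_ fun k => ?_
    · exact isClosed_le (hF.comp continuous_subtype_val) continuous_const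
    · exact le_ciSup hbu k
  · exact ciSup_le fun k => le_csSup hb ⟨u k, (u k).2, rfl⟩

/-- The Rademacher complexity of a continuous family is that of a dense sequence. -/
theorem rademacher_image_eq_of_denseRange {X : Type*} [TopologicalSpace X] {U : Set X} {N : ℕ}
    {w : X → Fin N → ℝ} (hw : ∀ i, Continuous fun x => w x i) {M : ℝ} (hM0 : 0 ≤ M)
    (hM : ∀ x ∈ U, ∀ i, |w x i| ≤ M) {u : ℕ → U} (hu : DenseRange u) :
    rademacher (w '' U) = rademacher (Set.range fun k => w (u k)) := by
  rw [rademacher_eq_sum_iSup, rademacher]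
  congr 1
  refine Finset.sum_congr rfl fun σ _ => ?_
  rw [Set.image_image]
  refine csSup_image_eq_ciSup_of_denseRange (F := fun x => signMean σ (w x)) ?_ ?_ hu
  · unfold signMean
    fun_prop
  · refine ⟨M, ?_⟩
    rintro _ ⟨x, hx, rfl⟩
    exact (abs_le.1 (abs_signMean_le σ (w x) hM0 (hM x hx))).2

/-- Truncation to `[-B, B]`. -/
def clip (B v : ℝ) : ℝ := max (-B) (min B v)

theorem continuous_clip (B : ℝ) : Continuous (clip B) := by unfold clip; fun_prop

theorem clip_eq_self {B v : ℝ} (h : |v| ≤ B) : clip B v = v := by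
  rw [clip, min_eq_right (abs_le.1 h).2, max_eq_right (abs_le.1 h).1]

theorem abs_clip_le {B : ℝ} (hB : 0 ≤ B) (v : ℝ) : |clip B v| ≤ B :=
  abs_le.2 ⟨le_max_left _ _, max_le (by linarith) (min_le_left _ _)⟩

theorem abs_clip_sub_clip_le (B v w : ℝ) : |clip B v - clip B w| ≤ |v - w| := by
  unfold clip
  refine (abs_max_sub_max_le_max _ _ _ _).trans ?_
  refine max_le (by simp) ((abs_min_sub_min_le_max _ _ _ _).trans (by simp))

namespace Arch

variable (A : Arch)

theorem familyParam_subset_closedBall (dℓ : ℝ → ℝ) {n : ℕ} (D : Fin n → A.Input × ℝ)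
    (E : Set (ℕ → ℝ)) (θ₀ : A.Param) (C ε : ℝ) :
    A.familyParam dℓ D E θ₀ C ε ⊆ Metric.closedBall θ₀ ε :=
  fun _ hθ => Metric.ball_subset_closedBall hθ.1.2

theorem rademacher_remainder_eq {N : ℕ} {θ₀ : A.Param} {ε : ℝ} {U : Set A.Param}
    (hU : U ⊆ Metric.closedBall θ₀ ε) {u : ℕ → U} (hu : DenseRange u) (s : Fin N → A.Input × ℝ) :
    rademacher ((fun θ i => A.remainder θ₀ θ (s i).1) '' U)
      = rademacher (Set.range fun k i => A.remainder θ₀ (u k) (s i).1) := by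
  -- Any bound on the inputs of this one sample suffices, so the equality holds for every `s` and
  -- not just almost surely.
  obtain ⟨M, hM⟩ := A.exists_abs_remainder_le θ₀ ε (∑ i, ‖(s i).1‖)
  refine rademacher_image_eq_of_denseRange (M := |M|) (fun i => A.continuous_remainder θ₀ _)
    (abs_nonneg _) (fun θ hθ i => (hM θ (hU hθ) _ ?_).trans (le_abs_self _)) hu
  exact Finset.single_le_sum (f := fun i => ‖(s i).1‖) (fun i _ => norm_nonneg _)
    (Finset.mem_univ i)

theorem integrable_rademacher_remainder (P : Measure (A.Input × ℝ)) [IsProbabilityMeasure P]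
    {N : ℕ} {θ₀ : A.Param} {ε Kx : ℝ} {U : Set A.Param} (hU : U ⊆ Metric.closedBall θ₀ ε)
    (hne : U.Nonempty) (hx : ∀ᵐ z ∂P, ‖z.1‖ ≤ Kx) :
    Integrable (fun s : Fin N → A.Input × ℝ =>
      rademacher ((fun θ i => A.remainder θ₀ θ (s i).1) '' U)) (Measure.pi fun _ => P) := by
  have := hne.to_subtype
  obtain ⟨u, hu⟩ := TopologicalSpace.exists_dense_seq U
  simp_rw [A.rademacher_remainder_eq hU hu]
  obtain ⟨M, hM⟩ := A.exists_abs_remainder_le θ₀ ε Kx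
  refine Integrable.of_bound (C := |M|) ?_ ?_
  · refine (measurable_rademacher_range fun k i => ?_).aestronglyMeasurable
    have := A.measurable_remainder θ₀ (u k)
    fun_prop
  · filter_upwards [ae_forall_pi P hx] with s hs
    exact abs_rademacher_range_le (abs_nonneg M) fun k i =>
      (hM _ (hU (u k).2) _ (hs i)).trans (le_abs_self _)

end Arch

/-- Only two facts about the parameter set enter: it lies in a ball, and its points are within `r`
of `θ₀`. Where gradient descent goes is irrelevant here. -/
theorem generalization_bound (A : Arch) (P : Measure (A.Input × ℝ)) [IsProbabilityMeasure P]
    (N : ℕ) (ℓ : ℝ → ℝ) (U : Set A.Param)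
    (θ₀ : A.Param) (ε : ℝ) (KL : NNReal) (Kg Kx r B H δ : ℝ) (hN : 0 < N)
    (hδ : 0 < δ) (hδ1 : δ < 1) (hKg : 0 ≤ Kg)
    (hU : U ⊆ Metric.closedBall θ₀ ε) (hr : ∀ θ ∈ U, ‖θ - θ₀‖ ≤ r)
    (hℓ : LipschitzWith KL ℓ)
    (hgrad : ∀ᵐ z ∂P, ‖A.paramGrad θ₀ z.1‖ ≤ Kg) (hx : ∀ᵐ z ∂P, ‖z.1‖ ≤ Kx)
    (hB : ∀ θ ∈ U, ∀ᵐ z ∂P, |ℓ (A.net θ z.1 - z.2)| ≤ B)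
    (hH : 2 * ∫ s : Fin N → A.Input × ℝ,
      rademacher ((fun θ i => A.remainder θ₀ θ (s i).1) '' U) ∂(Measure.pi fun _ => P) ≤ H) :
    ENNReal.ofReal (1 - δ) ≤ (Measure.pi fun _ : Fin N => P)
      {s | ∀ θ ∈ U, risk ℓ P (A.net θ) - empRisk ℓ s (A.net θ)
        ≤ 2 * KL * r * Kg / Real.sqrt N + KL * H + B * Real.sqrt (2 * Real.log (1 / δ) / N)} := by
  rcases U.eq_empty_or_nonempty with rfl | hne
  · simp [hδ.le]
  have := hne.to_subtype
  obtain ⟨u, hu⟩ := TopologicalSpace.exists_dense_seq U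
  have hNr : (0 : ℝ) < N := by exact_mod_cast hN
  set μ := Measure.pi fun _ : Fin N => P with hμ
  have hB0 : 0 ≤ B := by
    obtain ⟨θ, hθ⟩ := hne
    obtain ⟨z, hz⟩ := (hB θ hθ).exists
    exact (abs_nonneg _).trans hz
  have hr0 : 0 ≤ r := by
    obtain ⟨θ, hθ⟩ := hne
    exact (norm_nonneg _).trans (hr θ hθ)
  -- The loss is bounded by `B` only almost surely, while the deviation bound wants it everywhere.
  -- Truncation repairs this: it does not increase Lipschitz constants, and almost surely it changes
  -- nothing along the countable sequence `u`.
  set f : ℕ → A.Input × ℝ → ℝ := fun k z => clip B (ℓ (A.net (u k) z.1 - z.2)) with hf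
  have hloss : ∀ θ, Measurable fun z : A.Input × ℝ => ℓ (A.net θ z.1 - z.2) := fun θ => by
    have := A.measurable_net θ
    exact hℓ.continuous.measurable.comp (by fun_prop)
  have hfm : ∀ k, Measurable (f k) := fun k => (continuous_clip B).measurable.comp (hloss _)
  have hfB : ∀ k z, |f k z| ≤ B := fun k z => abs_clip_le hB0 _
  set ρ : (Fin N → A.Input × ℝ) → ℝ := fun s =>
    rademacher ((fun θ i => A.remainder θ₀ θ (s i).1) '' U) with hρ
  have hρi : Integrable ρ μ := A.integrable_rademacher_remainder P hU hne hx
  obtain ⟨M₁, hM₁⟩ := A.exists_abs_net_le θ₀ ε Kx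
  obtain ⟨M₂, hM₂⟩ := A.exists_abs_remainder_le θ₀ ε Kx
  have hrad : ∀ᵐ s ∂μ, rademacher (Set.range fun k i => f k (s i))
      ≤ KL * (r * Kg / Real.sqrt N + ρ s) := by
    filter_upwards [ae_forall_pi P hx, ae_forall_pi P hgrad] with s hsx hsg
    have hnet : ∀ k i, |A.net (u k) (s i).1| ≤ |M₁| := fun k i =>
      (hM₁ _ (hU (u k).2) _ (hsx i)).trans (le_abs_self _)
    have hrem : ∀ k i, |A.remainder θ₀ (u k) (s i).1| ≤ |M₂| := fun k i =>
      (hM₂ _ (hU (u k).2) _ (hsx i)).trans (le_abs_self _)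
    have hlin : ∀ (k : ℕ) i, |(inner ℝ (A.paramGrad θ₀ (s i).1) ((u k : A.Param) - θ₀) : ℝ)|
        ≤ Kg * r := fun k i => (abs_real_inner_le_norm _ _).trans
      (mul_le_mul (hsg i) (hr _ (u k).2) (norm_nonneg _) hKg)
    -- Strip off the loss by contraction (the label is fixed in each coordinate), pull out `KL`,
    -- expand around `θ₀`, drop the fixed function, and split the linear part from the remainder.
    calc rademacher (Set.range fun k i => f k (s i))
        ≤ rademacher (Set.range fun (k : ℕ) i => (KL : ℝ) * A.net (u k) (s i).1) := by
          refine rademacher_contraction (M := max B (KL * |M₁|)) (le_max_of_le_left hB0)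
            (fun k i => ?_) (fun k i => (hfB k _).trans (le_max_left _ _)) fun i k k' => ?_
          · rw [abs_mul, abs_of_nonneg KL.coe_nonneg]
            exact (mul_le_mul_of_nonneg_left (hnet k i) KL.coe_nonneg).trans (le_max_right _ _)
          · refine (abs_clip_sub_clip_le B _ _).trans ?_
            have := hℓ.dist_le_mul (A.net (u k) (s i).1 - (s i).2) (A.net (u k') (s i).1 - (s i).2)
            rw [Real.dist_eq, Real.dist_eq, sub_sub_sub_cancel_right] at this
            rwa [← mul_sub, abs_mul, abs_of_nonneg KL.coe_nonneg]
      _ = KL * rademacher (Set.range fun (k : ℕ) i => A.net (u k) (s i).1) :=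
          rademacher_range_const_mul KL.coe_nonneg _
      _ = KL * rademacher (Set.range fun (k : ℕ) i => A.net θ₀ (s i).1
            + (inner ℝ (A.paramGrad θ₀ (s i).1) ((u k : A.Param) - θ₀)
              + A.remainder θ₀ (u k) (s i).1)) := by
          congr 3
          funext k i
          rw [Arch.remainder]
          ring
      _ = KL * rademacher (Set.range fun (k : ℕ) i =>
            inner ℝ (A.paramGrad θ₀ (s i).1) ((u k : A.Param) - θ₀)
              + A.remainder θ₀ (u k) (s i).1) := by
          rw [rademacher_range_const_add (fun i => A.net θ₀ (s i).1) (M := Kg * r + |M₂|)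
            (by positivity) fun k i => (abs_add_le _ _).trans (add_le_add (hlin k i) (hrem k i))]
      _ ≤ KL * (r * Kg / Real.sqrt N + ρ s) := by
          refine mul_le_mul_of_nonneg_left ?_ KL.coe_nonneg
          refine (rademacher_range_add_le (M := max (Kg * r) |M₂|) (by positivity)
            (fun k i => (hlin k i).trans (le_max_left _ _))
            (fun k i => (hrem k i).trans (le_max_right _ _))).trans (add_le_add ?_ ?_)
          · exact rademacher_linear_le hN _ _ (fun k => hr _ (u k).2) hKg hsg
          · exact (A.rademacher_remainder_eq hU hu s).ge
  have hint : ∫ s, rademacher (Set.range fun k i => f k (s i)) ∂μ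
      ≤ KL * (r * Kg / Real.sqrt N) + KL * ∫ s, ρ s ∂μ := by
    have h1 : ∫ s, (KL : ℝ) * (r * Kg / Real.sqrt N + ρ s) ∂μ
        = KL * (r * Kg / Real.sqrt N) + KL * ∫ s, ρ s ∂μ := by
      rw [integral_const_mul, integral_add (integrable_const _) hρi]
      simp [mul_add]
    rw [← h1]
    refine integral_mono_ae ?_ (((integrable_const _).add hρi).const_mul _) hrad
    refine integrable_of_abs_le (M := B) (measurable_rademacher_range fun k i => ?_) fun s =>
      abs_rademacher_range_le hB0 fun k i => hfB k _
    have := hfm k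
    fun_prop
  have hdev := measure_uniform_deviation_le P hN hfm hfB hδ hδ1
  set S := {s : Fin N → A.Input × ℝ | ∀ θ ∈ U, risk ℓ P (A.net θ) - empRisk ℓ s (A.net θ)
        ≤ 2 * KL * r * Kg / Real.sqrt N + KL * H + B * Real.sqrt (2 * Real.log (1 / δ) / N)} with hS
  have hgood : ∀ᵐ s ∂μ, ∀ i k, |ℓ (A.net (u k) (s i).1 - (s i).2)| ≤ B :=
    ae_forall_pi P (ae_all_iff.2 fun k => hB _ (u k).2)
  have hcompl : μ Sᶜ ≤ ENNReal.ofReal δ := by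
    refine (measure_mono_ae ?_).trans hdev
    filter_upwards [hgood] with s hs hsS
    by_contra hcon
    refine hsS ?_
    have hcon' : ∀ k, ¬ _ := not_exists.1 hcon
    have hcount : ∀ k, risk ℓ P (A.net (u k)) - empRisk ℓ s (A.net (u k))
        ≤ 2 * KL * r * Kg / Real.sqrt N + KL * H + B * Real.sqrt (2 * Real.log (1 / δ) / N) := by
      intro k
      have h2 := not_lt.1 (hcon' k)
      have h3 : risk ℓ P (A.net (u k)) = ∫ z, f k z ∂P := by
        refine integral_congr_ae ?_
        filter_upwards [hB _ (u k).2] with z hz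
        exact (clip_eq_self hz).symm
      have h4 : empRisk ℓ s (A.net (u k)) = 1 / (N : ℝ) * ∑ i, f k (s i) := by
        rw [empRisk]
        congr 1
        exact Finset.sum_congr rfl fun i _ => (clip_eq_self (hs i k)).symm
      rw [h3, h4]
      refine h2.trans ?_
      have h5 : (KL : ℝ) * (2 * ∫ s, ρ s ∂μ) ≤ KL * H := mul_le_mul_of_nonneg_left hH KL.coe_nonneg
      have h6 : 2 * (KL : ℝ) * r * Kg / Real.sqrt N = 2 * (KL * (r * Kg / Real.sqrt N)) := by ring
      rw [h6]
      linarith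
    intro θ hθ
    -- The inequality is closed in the parameter: the risk is continuous by dominated convergence
    -- with the constant bound `B`, the empirical risk by inspection. It therefore extends from the
    -- dense sequence to `U`.
    refine hu.induction_on (p := fun y : U => risk ℓ P (A.net y) - empRisk ℓ s (A.net y)
        ≤ 2 * KL * r * Kg / Real.sqrt N + KL * H + B * Real.sqrt (2 * Real.log (1 / δ) / N))
      ⟨θ, hθ⟩ ?_ hcount
    refine isClosed_le (Continuous.sub ?_ ?_) continuous_const
    · refine continuous_of_dominated (bound := fun _ => B) (fun y => (hloss _).aestronglyMeasurable)
        (fun y => hB _ y.2) (integrable_const _) (ae_of_all _ fun z => ?_)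
      have h7 := (A.continuous_net_left z.1).comp (continuous_subtype_val (p := fun θ => θ ∈ U))
      exact hℓ.continuous.comp (h7.sub continuous_const)
    · unfold empRisk
      refine continuous_const.mul (continuous_finsetSum _ fun i _ => ?_)
      have h7 := (A.continuous_net_left (s i).1).comp
        (continuous_subtype_val (p := fun θ => θ ∈ U))
      exact hℓ.continuous.comp (h7.sub continuous_const)
  -- Subadditivity replaces the complement rule, so the measurability of `S`, an intersection over
  -- possibly uncountably many parameters, is not needed.
  have huniv : (1 : ENNReal) ≤ μ S + μ Sᶜ := by
    rw [← measure_univ (μ := μ), ← Set.union_compl_self S]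
    exact measure_union_le _ _
  rw [ENNReal.ofReal_sub _ hδ.le, ENNReal.ofReal_one]
  exact tsub_le_iff_right.2 (huniv.trans (add_le_add le_rfl hcompl))

/-- The class radius is `Kx * CTS * CGD`. What the argument yields is stronger than the conclusion:
the term `KL * K₀` does not arise, and `log (1 / δ)` appears in place of `log (4 / δ)`. The last
lines only weaken it. -/
theorem generalization_bound_of_reach (A : Arch) (P : Measure (A.Input × ℝ))
    [IsProbabilityMeasure P]
    (n : ℕ) (D : Fin n → A.Input × ℝ) (N : ℕ) (ℓ dℓ : ℝ → ℝ) (E : Set (ℕ → ℝ))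
    (θ₀ : A.Param) (ε : ℝ) (KL : NNReal) (K₀ Kg Kx CTS CGD B H δ : ℝ)
    (hN : 0 < N) (hCTS : 0 < CTS) (hδ : 0 < δ) (hδ1 : δ < 1)
    (hη : ∀ η ∈ E, ∀ t, 0 < η t) (hℓ : LipschitzWith KL ℓ)
    (hTS : ∀ θ ∈ A.reach dℓ D E θ₀ ε, ∀ i, Arch.frobNorm (A.tangentSens θ (D i).1) ≤ CTS)
    (h₀ : ∀ᵐ z ∂P, |A.net θ₀ z.1| ≤ K₀)
    (hgrad : ∀ᵐ z ∂P, ‖A.paramGrad θ₀ z.1‖ ≤ Kg)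
    (hx : ∀ᵐ z ∂P, ‖z.1‖ ≤ Kx) (hxD : ∀ i, ‖(D i).1‖ ≤ Kx)
    (hGD : ∀ η ∈ E, ∀ T : ℕ, ∑ t ∈ Finset.range T, η (t + 1) *
        ((1 / (n : ℝ)) * ∑ i, |dℓ (A.net (A.gd dℓ D η θ₀ t) (D i).1 - (D i).2)|) ≤ CGD)
    (hB : ∀ f ∈ A.family dℓ D E θ₀ CTS ε, ∀ᵐ z ∂P, |ℓ (f z.1 - z.2)| ≤ B)
    (hH : 2 * A.remainderComplexity P N dℓ D E θ₀ CTS ε ≤ H) :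
    ENNReal.ofReal (1 - δ) ≤ (Measure.pi fun _ : Fin N => P)
      {s | ∀ f ∈ A.family dℓ D E θ₀ CTS ε,
        risk ℓ P f - empRisk ℓ s f ≤
          KL * K₀ + 2 * KL * Kx * Kg * CTS * CGD / Real.sqrt N + KL * H
            + B * Real.sqrt (2 * Real.log (4 / δ) / N)} := by
  -- A probability measure has a point where all the almost sure bounds hold, which makes the
  -- constants nonnegative.
  obtain ⟨z, hz⟩ := (h₀.and (hgrad.and hx)).exists
  have hK₀ : 0 ≤ K₀ := (abs_nonneg _).trans hz.1
  have hKg : 0 ≤ Kg := (norm_nonneg _).trans hz.2.1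
  have hKx : 0 ≤ Kx := (norm_nonneg _).trans hz.2.2
  have hmain := generalization_bound A P N ℓ (A.familyParam dℓ D E θ₀ CTS ε) θ₀ ε KL Kg Kx
    (Kx * CTS * CGD) B H δ hN hδ hδ1 hKg (A.familyParam_subset_closedBall dℓ D E θ₀ CTS ε)
    (fun θ hθ => A.norm_sub_le_of_mem_reach hCTS.le hKx hη hTS hxD hGD hθ.1) hℓ hgrad hx
    (fun θ hθ => hB _ ⟨θ, hθ, rfl⟩) hH
  refine hmain.trans (measure_mono ?_)
  rintro s hs _ ⟨θ, hθ, rfl⟩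
  refine (hs θ hθ).trans ?_
  have hB0 : 0 ≤ B := by
    obtain ⟨z, hz⟩ := (hB _ ⟨θ, hθ, rfl⟩).exists
    exact (abs_nonneg _).trans hz
  have h1 : B * Real.sqrt (2 * Real.log (1 / δ) / N) ≤ B * Real.sqrt (2 * Real.log (4 / δ) / N) := by
    have : Real.log (1 / δ) ≤ Real.log (4 / δ) := Real.log_le_log (by positivity) (by gcongr; norm_num)
    gcongr
  have h2 : 2 * (KL : ℝ) * (Kx * CTS * CGD) * Kg / Real.sqrt N
      = 2 * KL * Kx * Kg * CTS * CGD / Real.sqrt N := by ring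
  have h3 : 0 ≤ (KL : ℝ) * K₀ := mul_nonneg KL.coe_nonneg hK₀
  rw [h2]
  linarith

end

/-! ### Deterministic bounds for the Taylor remainder. -/

noncomputable section

section EuclideanLength

variable {ι κ : Type*} [Fintype ι] [Fintype κ]

/-- The Euclidean length of a vector. -/
def l2 (v : ι → ℝ) : ℝ := ‖(WithLp.toLp 2 v : EuclideanSpace ℝ ι)‖

theorem l2_nonneg (v : ι → ℝ) : 0 ≤ l2 v := norm_nonneg _

theorem l2_sq (v : ι → ℝ) : l2 v ^ 2 = ∑ i, v i ^ 2 := by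
  rw [l2, EuclideanSpace.norm_sq_eq]
  simp

theorem l2_add_le (v w : ι → ℝ) : l2 (fun i => v i + w i) ≤ l2 v + l2 w := by
  exact norm_add_le (WithLp.toLp 2 v : EuclideanSpace ℝ ι) (WithLp.toLp 2 w)

theorem l2_mul (c : ℝ) (v : ι → ℝ) : l2 (fun i => c * v i) = |c| * l2 v := by
  exact norm_smul c (WithLp.toLp 2 v : EuclideanSpace ℝ ι)

theorem l2_le_of_sum_sq_le {v : ι → ℝ} {c : ℝ} (hc : 0 ≤ c) (h : ∑ i, v i ^ 2 ≤ c ^ 2) :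
    l2 v ≤ c :=
  le_of_sq_le_sq (by rwa [l2_sq]) hc

theorem l2_mono {v w : ι → ℝ} (h : ∀ i, |v i| ≤ |w i|) : l2 v ≤ l2 w :=
  l2_le_of_sum_sq_le (l2_nonneg _) (by
    rw [l2_sq]
    exact Finset.sum_le_sum fun i _ => sq_le_sq.2 (h i))

theorem l2_zero : l2 (fun _ : ι => (0 : ℝ)) = 0 := by
  have := l2_sq (fun _ : ι => (0 : ℝ))
  simpa using this

theorem abs_sum_mul_le_l2 (v w : ι → ℝ) : |∑ i, v i * w i| ≤ l2 v * l2 w := by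
  refine abs_le_of_sq_le_sq ?_ (mul_nonneg (l2_nonneg _) (l2_nonneg _))
  rw [mul_pow, l2_sq, l2_sq]
  exact Finset.sum_mul_sq_le_sq_mul_sq _ _ _

/-- With `v` the transposed product, `‖v‖² = ⟨u, W v⟩ ≤ C ‖u‖ ‖v‖`. It transfers weight bounds
stated for the forward action to backpropagation. -/
theorem l2_transpose_le {W : ι → κ → ℝ} {C : ℝ}
    (hW : ∀ v : κ → ℝ, l2 (fun j => ∑ k, W j k * v k) ≤ C * l2 v) (hC : 0 ≤ C) (u : ι → ℝ) :
    l2 (fun k => ∑ j, W j k * u j) ≤ C * l2 u := by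
  set v : κ → ℝ := fun k => ∑ j, W j k * u j with hv
  have h1 : l2 v ^ 2 = ∑ j, u j * ∑ k, W j k * v k := by
    rw [l2_sq]
    have : ∀ k, v k ^ 2 = ∑ j, u j * (W j k * v k) := by
      intro k
      rw [sq]
      nth_rewrite 1 [hv]
      simp only [Finset.sum_mul]
      exact Finset.sum_congr rfl fun j _ => by ring
    simp_rw [this]
    rw [Finset.sum_comm]
    simp_rw [Finset.mul_sum]
  have h2 : l2 v ^ 2 ≤ l2 u * (C * l2 v) := by
    rw [h1]
    exact (le_abs_self _).trans ((abs_sum_mul_le_l2 _ _).trans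
      (mul_le_mul_of_nonneg_left (hW v) (l2_nonneg _)))
  rcases (l2_nonneg v).eq_or_lt with h | h
  · rw [← h]
    exact mul_nonneg hC (l2_nonneg _)
  · have h3 : l2 v * l2 v ≤ C * l2 u * l2 v := by nlinarith
    exact le_of_mul_le_mul_right h3 h

theorem l2_mulVec_le_of_sum_sq_le {W : ι → κ → ℝ} {C : ℝ} (hC : 0 ≤ C)
    (hW : ∑ j, ∑ k, W j k ^ 2 ≤ C ^ 2) (v : κ → ℝ) :
    l2 (fun j => ∑ k, W j k * v k) ≤ C * l2 v := by
  refine l2_le_of_sum_sq_le (mul_nonneg hC (l2_nonneg _)) ?_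
  rw [mul_pow, l2_sq]
  calc ∑ j, (∑ k, W j k * v k) ^ 2 ≤ ∑ j, (∑ k, W j k ^ 2) * ∑ k, v k ^ 2 :=
        Finset.sum_le_sum fun j _ => Finset.sum_mul_sq_le_sq_mul_sq _ _ _
    _ = (∑ j, ∑ k, W j k ^ 2) * ∑ k, v k ^ 2 := by rw [Finset.sum_mul]
    _ ≤ C ^ 2 * ∑ k, v k ^ 2 := by gcongr

end EuclideanLength

theorem abs_relu_sub_relu_le (p q : ℝ) : |max q 0 - max p 0| ≤ |q - p| := by
  refine (abs_max_sub_max_le_max _ _ _ _).trans ?_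
  simp

/-- The linearization error of ReLU at `p` vanishes unless the increment reaches the kink. -/
theorem abs_relu_linearization_le (p q : ℝ) :
    |max q 0 - max p 0 - (if 0 < p then q - p else 0)| ≤ if |p| ≤ |q - p| then |q - p| else 0 := by
  rcases lt_or_ge 0 p with hp | hp
  · rw [if_pos hp, max_eq_left hp.le]
    rcases lt_or_ge q 0 with hq | hq
    · rw [max_eq_right hq.le, abs_of_pos hp, abs_of_neg (by linarith : q - p < 0),
        if_pos (by linarith)]
      rw [abs_le]
      constructor <;> linarith
    · rw [max_eq_left hq]
      simp only [sub_self, abs_zero]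
      split_ifs <;> positivity
  · rw [if_neg (not_lt.2 hp), max_eq_right hp]
    rcases lt_or_ge 0 q with hq | hq
    · rw [max_eq_left hq.le, abs_of_nonpos hp, abs_of_pos (by linarith : 0 < q - p),
        if_pos (by linarith), sub_zero, sub_zero, abs_of_pos hq]
      linarith
    · rw [max_eq_right hq]
      simp only [sub_self, abs_zero]
      split_ifs <;> positivity

/-- Young's inequality for the error on the units whose gate may flip. -/
theorem sum_flips_le {ι : Type*} [Fintype ι] (b p δ : ι → ℝ) {C s τ κ lam : ℝ} (hs : 0 ≤ s)
    (hτ : 0 < τ) (hκ : 0 < κ) (hl : 0 < lam) (hC : l2 δ ≤ C) :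
    s * ∑ j, |b j| * (if |p j| ≤ |δ j| then |δ j| else 0) ≤
      C * (κ + s ^ 2 / κ * (lam * ∑ j, b j ^ 4
        + ((∑ j, if |p j| ≤ τ then (1 : ℝ) else 0) + C ^ 2 / τ ^ 2) / lam)) := by
  have hC0 : 0 ≤ C := (l2_nonneg _).trans hC
  set F : Finset ι := Finset.univ.filter fun j => |p j| ≤ |δ j| with hF
  -- A unit that flips either starts within `τ` of the kink or moves by at least `τ`; the latter are
  -- counted by Chebyshev's inequality.
  have hcard : (F.card : ℝ) ≤ (∑ j, if |p j| ≤ τ then (1 : ℝ) else 0) + C ^ 2 / τ ^ 2 := by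
    have h1 : ∑ j, δ j ^ 2 / τ ^ 2 ≤ C ^ 2 / τ ^ 2 := by
      rw [← Finset.sum_div, ← l2_sq]
      have := l2_nonneg δ
      gcongr
    have h2 : (F.card : ℝ) = ∑ j, if |p j| ≤ |δ j| then (1 : ℝ) else 0 := by
      rw [hF, Finset.sum_boole]
    rw [h2]
    refine le_trans ?_ (add_le_add_right h1 _)
    rw [← Finset.sum_add_distrib]
    refine Finset.sum_le_sum fun j _ => ?_
    have h3 : 0 ≤ δ j ^ 2 / τ ^ 2 := by positivity
    by_cases h4 : |p j| ≤ τ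
    · rw [if_pos h4]
      split_ifs <;> linarith
    · rw [if_neg h4]
      split_ifs with h5
      · have h6 : τ ≤ |δ j| := (not_le.1 h4).le.trans h5
        have : 1 ≤ δ j ^ 2 / τ ^ 2 := by
          rw [one_le_div (by positivity), ← sq_abs (δ j)]
          gcongr
        linarith
      · linarith
  have hsum : ∑ j, |b j| * (if |p j| ≤ |δ j| then |δ j| else 0)
      ≤ Real.sqrt (∑ j ∈ F, b j ^ 2) * C := by
    have h1 : ∑ j, |b j| * (if |p j| ≤ |δ j| then |δ j| else 0) = ∑ j ∈ F, |b j| * |δ j| := by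
      rw [hF, Finset.sum_filter]
      exact Finset.sum_congr rfl fun j _ => by split_ifs <;> simp
    rw [h1]
    refine (Real.sum_mul_le_sqrt_mul_sqrt _ _ _).trans ?_
    simp only [sq_abs]
    refine mul_le_mul_of_nonneg_left ?_ (Real.sqrt_nonneg _)
    refine (Real.sqrt_le_sqrt (Finset.sum_le_univ_sum_of_nonneg fun j => sq_nonneg _)).trans ?_
    rw [← l2_sq, Real.sqrt_sq (l2_nonneg _)]
    exact hC
  -- Fourth powers prevent the squares of `b` from concentrating on the few indices in `F`: `b² ≤
  -- lam * b⁴ + 1 / lam`. Young's inequality instead of Cauchy–Schwarz keeps the bound linear in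
  -- quantities whose expectations are known.
  have hb : ∑ j ∈ F, b j ^ 2 ≤ lam * ∑ j, b j ^ 4 + F.card / lam := by
    have h1 : ∀ j, b j ^ 2 ≤ lam * b j ^ 4 + 1 / lam := by
      intro j
      have h2 : 0 ≤ lam * (b j ^ 2 - 1 / lam / 2) ^ 2 := by positivity
      have h3 : lam * (b j ^ 2 - 1 / lam / 2) ^ 2 = lam * b j ^ 4 - b j ^ 2 + 1 / lam / 4 := by
        field_simp
        ring
      have h4 : 0 < 1 / lam := by positivity
      linarith
    calc ∑ j ∈ F, b j ^ 2 ≤ ∑ j ∈ F, (lam * b j ^ 4 + 1 / lam) := Finset.sum_le_sum fun j _ => h1 j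
      _ = lam * ∑ j ∈ F, b j ^ 4 + F.card / lam := by
          rw [Finset.sum_add_distrib, ← Finset.mul_sum, Finset.sum_const, nsmul_eq_mul]
          ring
      _ ≤ _ := by
          have h5 : ∑ j ∈ F, b j ^ 4 ≤ ∑ j, b j ^ 4 :=
            Finset.sum_le_univ_sum_of_nonneg fun j => by positivity
          exact add_le_add (mul_le_mul_of_nonneg_left h5 hl.le) le_rfl
  set Y := ∑ j ∈ F, b j ^ 2 with hY
  have hY0 : 0 ≤ Y := Finset.sum_nonneg fun j _ => sq_nonneg _
  have hyoung : s * Real.sqrt Y ≤ κ + s ^ 2 / κ * Y := by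
    have h1 : 0 ≤ (s * Real.sqrt Y - κ) ^ 2 / κ := by positivity
    have h2 : (s * Real.sqrt Y - κ) ^ 2 / κ = s ^ 2 / κ * Y - 2 * (s * Real.sqrt Y) + κ := by
      have := Real.sq_sqrt hY0
      field_simp
      linear_combination s ^ 2 * this
    have h3 : 0 ≤ s * Real.sqrt Y := by positivity
    linarith
  calc s * ∑ j, |b j| * (if |p j| ≤ |δ j| then |δ j| else 0)
      ≤ s * (Real.sqrt Y * C) := by gcongr
    _ = C * (s * Real.sqrt Y) := by ring
    _ ≤ C * (κ + s ^ 2 / κ * Y) := by gcongr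
    _ ≤ _ := by
        gcongr
        refine hb.trans ?_
        gcongr

namespace Arch

variable (A : Arch)

/-- The preactivation of unit `j` of layer `l + 1`. -/
def preact (θ : A.Param) (x : A.Input) (l : ℕ) (j : Fin (A.width (l + 1))) : ℝ :=
  ∑ k, A.weight θ l j k * A.act θ x l k

theorem act_succ (θ : A.Param) (x : A.Input) (l : ℕ) (j : Fin (A.width (l + 1))) :
    A.act θ x (l + 1) j = A.scale l * max (A.preact θ x l j) 0 := rfl

theorem gate_eq (θ : A.Param) (x : A.Input) (l : ℕ) (j : Fin (A.width (l + 1))) :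
    A.gate θ x l j = if 0 < A.preact θ x l j then A.scale l else 0 := rfl

/-- Backpropagation through the last `n` layers of a gated network, from the output to layer `l`. -/
def backFrom (A : Arch) (g : (l : ℕ) → Fin (A.width (l + 1)) → ℝ) (θ : A.Param) :
    (n l : ℕ) → Fin (A.width l) → ℝ
  | 0, l => fun k => if h : l = A.depth then θ (Sum.inr (Fin.cast (congrArg A.width h) k)) else 0
  | n + 1, l => fun k => ∑ j, A.weight θ l j k * (g l j * A.backFrom g θ n (l + 1) j)

/-- The derivative of the output with respect to the activations of layer `l`. -/
def back (θ : A.Param) (x : A.Input) (l : ℕ) (k : Fin (A.width l)) : ℝ :=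
  A.backFrom (A.gate θ x) θ (A.depth - l) l k

theorem back_depth (θ : A.Param) (x : A.Input) (k : Fin (A.width A.depth)) :
    A.back θ x A.depth k = θ (Sum.inr k) := by
  rw [back, Nat.sub_self]
  simp [backFrom]

theorem back_of_lt (θ : A.Param) (x : A.Input) {l : ℕ} (hl : l < A.depth) (k : Fin (A.width l)) :
    A.back θ x l k
      = ∑ j, A.weight θ l j k * (A.gate θ x l j * A.back θ x (l + 1) j) := by
  have h : A.depth - l = (A.depth - (l + 1)) + 1 := by omega
  rw [back, h]
  rfl

theorem sum_weight_sq_le (Δ : A.Param) (l : ℕ) :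
    ∑ j, ∑ k, A.weight Δ l j k ^ 2 ≤ ‖Δ‖ ^ 2 := by
  rw [EuclideanSpace.norm_sq_eq]
  simp only [Real.norm_eq_abs, sq_abs]
  rw [Fintype.sum_sum_type]
  have h0 : 0 ≤ ∑ k, Δ (Sum.inr k) ^ 2 := Finset.sum_nonneg fun _ _ => sq_nonneg _
  by_cases hl : l < A.depth
  · have h1 : ∑ j, ∑ k, A.weight Δ l j k ^ 2
        = ∑ q : Fin (A.width (l + 1)) × Fin (A.width l), Δ (Sum.inl ⟨⟨l, hl⟩, q⟩) ^ 2 := by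
      rw [Fintype.sum_prod_type]
      simp [weight, hl]
    rw [h1, Fintype.sum_sigma]
    have h2 := Finset.single_le_sum
      (f := fun l' : Fin A.depth => ∑ q : Fin (A.width (l'.1 + 1)) × Fin (A.width l'.1),
        Δ (Sum.inl ⟨l', q⟩) ^ 2) (fun l' _ => Finset.sum_nonneg fun _ _ => sq_nonneg _)
      (Finset.mem_univ ⟨l, hl⟩)
    simp only at h2
    linarith
  · have : ∀ j k, A.weight Δ l j k = 0 := fun j k => by simp [weight, hl]
    simp only [this]
    have h3 : 0 ≤ ∑ i, Δ (Sum.inl i) ^ 2 := Finset.sum_nonneg fun _ _ => sq_nonneg _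
    simp
    linarith

theorem l2_weight_mulVec_le (Δ : A.Param) (l : ℕ) (v : Fin (A.width l) → ℝ) :
    l2 (fun j => ∑ k, A.weight Δ l j k * v k) ≤ ‖Δ‖ * l2 v :=
  l2_mulVec_le_of_sum_sq_le (norm_nonneg _) (A.sum_weight_sq_le Δ l) v

theorem l2_output_le (Δ : A.Param) : l2 (fun k => Δ (Sum.inr k)) ≤ ‖Δ‖ := by
  refine l2_le_of_sum_sq_le (norm_nonneg _) ?_
  rw [EuclideanSpace.norm_sq_eq]
  simp only [Real.norm_eq_abs, sq_abs]
  rw [Fintype.sum_sum_type]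
  have h3 : 0 ≤ ∑ i, Δ (Sum.inl i) ^ 2 := Finset.sum_nonneg fun _ _ => sq_nonneg _
  linarith

/-- The weights have operator norms at most `C`. -/
def WeightsBounded (θ : A.Param) (C : ℝ) : Prop :=
  (∀ l < A.depth, ∀ v, l2 (fun j => ∑ k, A.weight θ l j k * v k) ≤ C * l2 v) ∧
    l2 (fun k => θ (Sum.inr k)) ≤ C

/-- The increment of the activations. -/
def actDiff (θ Δ : A.Param) (x : A.Input) (l : ℕ) (j : Fin (A.width l)) : ℝ :=
  A.act (θ + Δ) x l j - A.act θ x l j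

/-- The increment of the preactivations. -/
def preDiff (θ Δ : A.Param) (x : A.Input) (l : ℕ) (j : Fin (A.width (l + 1))) : ℝ :=
  A.preact (θ + Δ) x l j - A.preact θ x l j

/-- The linearization error of the activation function. -/
def kinkError (θ Δ : A.Param) (x : A.Input) (l : ℕ) (j : Fin (A.width (l + 1))) : ℝ :=
  A.actDiff θ Δ x (l + 1) j - A.gate θ x l j * A.preDiff θ Δ x l j

theorem preDiff_eq (θ Δ : A.Param) (x : A.Input) (l : ℕ) (j : Fin (A.width (l + 1))) :
    A.preDiff θ Δ x l j = ∑ k, A.weight θ l j k * A.actDiff θ Δ x l k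
      + (∑ k, A.weight Δ l j k * A.act θ x l k + ∑ k, A.weight Δ l j k * A.actDiff θ Δ x l k) := by
  simp only [preDiff, preact, actDiff, weight_add, ← Finset.sum_add_distrib,
    ← Finset.sum_sub_distrib]
  exact Finset.sum_congr rfl fun k _ => by ring

theorem kinkError_eq (θ Δ : A.Param) (x : A.Input) (l : ℕ) (j : Fin (A.width (l + 1))) :
    A.kinkError θ Δ x l j = A.scale l * (max (A.preact (θ + Δ) x l j) 0 - max (A.preact θ x l j) 0
      - (if 0 < A.preact θ x l j then A.preact (θ + Δ) x l j - A.preact θ x l j else 0)) := by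
  simp only [kinkError, actDiff, act_succ, gate_eq, preDiff]
  split_ifs <;> ring

theorem abs_kinkError_le (θ Δ : A.Param) (x : A.Input) (l : ℕ) (j : Fin (A.width (l + 1))) :
    |A.kinkError θ Δ x l j| ≤ |A.scale l| *
      if |A.preact θ x l j| ≤ |A.preDiff θ Δ x l j| then |A.preDiff θ Δ x l j| else 0 := by
  rw [kinkError_eq, abs_mul]
  exact mul_le_mul_of_nonneg_left (abs_relu_linearization_le _ _) (abs_nonneg _)

/-- The Taylor remainder as a sum of contributions of the layers. -/
theorem remainder_add_eq (θ Δ : A.Param) (x : A.Input) :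
    A.remainder θ (θ + Δ) x
      = ∑ k, Δ (Sum.inr k) * A.actDiff θ Δ x A.depth k
        + ∑ l ∈ Finset.range A.depth, ∑ j, A.back θ x (l + 1) j *
          (A.gate θ x l j * ∑ k, A.weight Δ l j k * A.actDiff θ Δ x l k
            + A.kinkError θ Δ x l j) := by
  -- The difference between the true increment and its linearization is propagated by the gated
  -- weights, with a new source term at each layer. `back` obeys the adjoint recursion, so pairing
  -- with it leaves just the accumulated sources.
  set t := A.gatedTang (A.gate θ x) θ Δ x with ht
  have hstep : ∀ n ≤ A.depth, ∑ k, A.back θ x n k * (A.actDiff θ Δ x n k - t n k)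
      = ∑ l ∈ Finset.range n, ∑ j, A.back θ x (l + 1) j *
          (A.gate θ x l j * ∑ k, A.weight Δ l j k * A.actDiff θ Δ x l k
            + A.kinkError θ Δ x l j) := by
    intro n
    induction n with
    | zero =>
      intro _
      simp only [Finset.range_zero, Finset.sum_empty]
      refine Finset.sum_eq_zero fun k _ => ?_
      simp [actDiff, act, ht, gatedTang]
    | succ n ih =>
      intro hn
      rw [Finset.sum_range_succ, ← ih (by omega)]
      have h1 : ∀ j, A.actDiff θ Δ x (n + 1) j - t (n + 1) j
          = A.gate θ x n j * ∑ k, A.weight θ n j k * (A.actDiff θ Δ x n k - t n k)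
            + (A.gate θ x n j * ∑ k, A.weight Δ n j k * A.actDiff θ Δ x n k
              + A.kinkError θ Δ x n j) := by
        intro j
        rw [kinkError, preDiff_eq, ht]
        simp only [gatedTang, gatedAct_gate, Finset.sum_add_distrib, mul_sub,
          Finset.sum_sub_distrib]
        ring
      simp_rw [h1, mul_add, Finset.sum_add_distrib]
      congr 1
      simp_rw [A.back_of_lt θ x (Nat.lt_of_succ_le hn), Finset.mul_sum, Finset.sum_mul]
      rw [Finset.sum_comm]
      exact Finset.sum_congr rfl fun k _ => Finset.sum_congr rfl fun j _ => by ring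
  rw [← hstep A.depth le_rfl, remainder_eq]
  simp only [back_depth, net, gatedDir, gatedAct_gate, actDiff, add_sub_cancel_left,
    ← Finset.sum_add_distrib, ← Finset.sum_sub_distrib, PiLp.add_apply]
  exact Finset.sum_congr rfl fun k _ => by ring

section Bounds

variable {A} {θ Δ : A.Param} {x : A.Input} {s M K ε X : ℝ}

/-- A layer amplifies by at most `s * (K * M) ≤ K`. In the application `s = 1 / √m` and `M = √m`, so
nothing depends on the width. -/
theorem l2_act_le (hs : ∀ l, A.scale l = s) (hs0 : 0 ≤ s) (hsM : s * M ≤ 1) (hK : 1 ≤ K)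
    (hθ : A.WeightsBounded θ (K * M)) (hX : ‖x‖ ≤ X) :
    ∀ l ≤ A.depth, l2 (A.act θ x l) ≤ K ^ l * X := by
  have hX0 : 0 ≤ X := (norm_nonneg _).trans hX
  intro l
  induction l with
  | zero =>
    intro _
    rw [pow_zero, one_mul]
    exact hX
  | succ l ih =>
    intro hl
    have h1 : l2 (A.act θ x (l + 1)) ≤ l2 (fun j => s * A.preact θ x l j) := by
      refine l2_mono fun j => ?_
      rw [act_succ, hs, abs_mul, abs_mul]
      refine mul_le_mul_of_nonneg_left ?_ (abs_nonneg _)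
      simpa using abs_relu_sub_relu_le 0 (A.preact θ x l j)
    refine h1.trans ?_
    rw [l2_mul, abs_of_nonneg hs0]
    calc s * l2 (A.preact θ x l) ≤ s * (K * M * (K ^ l * X)) := by
          refine mul_le_mul_of_nonneg_left ?_ hs0
          have hKM : 0 ≤ K * M := (l2_nonneg _).trans hθ.2
          exact (hθ.1 l hl _).trans (mul_le_mul_of_nonneg_left (ih (by omega)) hKM)
      _ = s * M * (K ^ (l + 1) * X) := by ring
      _ ≤ 1 * (K ^ (l + 1) * X) := by
          have : 0 ≤ K ^ (l + 1) * X := by positivity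
          gcongr
      _ = _ := one_mul _

/-- Old weights have norm up to `K * M`, but they act on an activation increment that carries the
factor `s`; the new weights have norm only `ε` and act on the full activations. Both contributions
are of order one. -/
theorem l2_preDiff_le_of (hs1 : s ≤ 1) (hsM : s * M ≤ 1) (hK : 1 ≤ K)
    (hε : 0 ≤ ε) (hΔ : ‖Δ‖ ≤ ε) (hθ : A.WeightsBounded θ (K * M)) {l : ℕ} (hl : l < A.depth)
    {a c : ℝ} (ha : l2 (A.act θ x l) ≤ a) (hc0 : 0 ≤ c) (hc : l2 (A.actDiff θ Δ x l) ≤ s * c) :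
    l2 (A.preDiff θ Δ x l) ≤ (K + ε) * c + ε * a := by
  have hKM : 0 ≤ K * M := (l2_nonneg _).trans hθ.2
  have h1 : A.preDiff θ Δ x l = fun j => ∑ k, A.weight θ l j k * A.actDiff θ Δ x l k
      + (∑ k, A.weight Δ l j k * A.act θ x l k + ∑ k, A.weight Δ l j k * A.actDiff θ Δ x l k) :=
    funext fun j => A.preDiff_eq θ Δ x l j
  rw [h1]
  have e1 : l2 (fun j => ∑ k, A.weight θ l j k * A.actDiff θ Δ x l k) ≤ K * M * (s * c) :=
    (hθ.1 l hl _).trans (mul_le_mul_of_nonneg_left hc hKM)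
  have e2 : l2 (fun j => ∑ k, A.weight Δ l j k * A.act θ x l k) ≤ ε * a :=
    (A.l2_weight_mulVec_le Δ l _).trans (mul_le_mul hΔ ha (l2_nonneg _) hε)
  have e3 : l2 (fun j => ∑ k, A.weight Δ l j k * A.actDiff θ Δ x l k) ≤ ε * (s * c) :=
    (A.l2_weight_mulVec_le Δ l _).trans (mul_le_mul hΔ hc (l2_nonneg _) hε)
  refine (l2_add_le _ _).trans ((add_le_add e1 ((l2_add_le _ _).trans (add_le_add e2 e3))).trans ?_)
  have h2 : K * M * (s * c) ≤ K * c := by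
    calc K * M * (s * c) = (s * M) * (K * c) := by ring
      _ ≤ 1 * (K * c) := by gcongr
      _ = K * c := one_mul _
  have h3 : ε * (s * c) ≤ ε * c := by
    refine mul_le_mul_of_nonneg_left ?_ hε
    exact mul_le_of_le_one_left hc0 hs1
  linarith

/-- The previous estimate gives the recursion `c (l + 1) = (K + ε) * c l + ε * K ^ l * X`, solved
here crudely. Activation increments keep a factor `s` that preactivation increments lack. -/
theorem l2_actDiff_le_and (hs : ∀ l, A.scale l = s) (hs0 : 0 ≤ s) (hs1 : s ≤ 1) (hsM : s * M ≤ 1)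
    (hK : 1 ≤ K) (hε : 0 ≤ ε) (hΔ : ‖Δ‖ ≤ ε) (hθ : A.WeightsBounded θ (K * M)) (hX : ‖x‖ ≤ X) :
    ∀ l ≤ A.depth, l2 (A.actDiff θ Δ x l) ≤ s * (X * l * ε * (K + ε) ^ l) := by
  have hX0 : 0 ≤ X := (norm_nonneg _).trans hX
  have hpre : ∀ l < A.depth, l2 (A.actDiff θ Δ x l) ≤ s * (X * l * ε * (K + ε) ^ l) →
      l2 (A.preDiff θ Δ x l) ≤ X * (l + 1 : ℕ) * ε * (K + ε) ^ (l + 1) := by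
    intro l hl h
    refine (l2_preDiff_le_of hs1 hsM hK hε hΔ hθ hl
      (l2_act_le hs hs0 hsM hK hθ hX l hl.le) (by positivity) h).trans ?_
    have h1 : K ^ l ≤ (K + ε) ^ (l + 1) := by
      calc K ^ l ≤ K ^ (l + 1) := pow_le_pow_right₀ hK (Nat.le_succ l)
        _ ≤ (K + ε) ^ (l + 1) := by gcongr; linarith
    calc (K + ε) * (X * l * ε * (K + ε) ^ l) + ε * (K ^ l * X)
        ≤ (K + ε) * (X * l * ε * (K + ε) ^ l) + ε * ((K + ε) ^ (l + 1) * X) := by gcongr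
      _ = X * (l + 1 : ℕ) * ε * (K + ε) ^ (l + 1) := by push_cast; ring
  intro l
  induction l with
  | zero =>
    intro _
    have : A.actDiff θ Δ x 0 = fun _ => 0 := by funext j; simp [actDiff, act]
    rw [this, l2_zero]
    simp
  | succ l ih =>
    intro hl
    have h1 : l2 (A.actDiff θ Δ x (l + 1)) ≤ l2 (fun j => s * A.preDiff θ Δ x l j) := by
      refine l2_mono fun j => ?_
      rw [actDiff, act_succ, act_succ, ← mul_sub, hs, abs_mul, abs_mul]
      exact mul_le_mul_of_nonneg_left (abs_relu_sub_relu_le _ _) (abs_nonneg _)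
    refine h1.trans ?_
    rw [l2_mul, abs_of_nonneg hs0]
    exact mul_le_mul_of_nonneg_left (hpre l hl (ih (by omega))) hs0

/-- The bound for the increments of all layers. -/
def incrementBound (X ε K : ℝ) (L : ℕ) : ℝ := X * (L + 1) * ε * (K + ε) ^ (L + 1)

theorem incrementBound_nonneg (hX : 0 ≤ X) (hε : 0 ≤ ε) (hK : 1 ≤ K) (L : ℕ) :
    0 ≤ incrementBound X ε K L := by
  unfold incrementBound
  positivity

theorem l2_actDiff_le (hs : ∀ l, A.scale l = s) (hs0 : 0 ≤ s) (hs1 : s ≤ 1) (hsM : s * M ≤ 1)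
    (hK : 1 ≤ K) (hε : 0 ≤ ε) (hΔ : ‖Δ‖ ≤ ε) (hθ : A.WeightsBounded θ (K * M)) (hX : ‖x‖ ≤ X)
    {l : ℕ} (hl : l ≤ A.depth) :
    l2 (A.actDiff θ Δ x l) ≤ s * incrementBound X ε K A.depth := by
  have hX0 : 0 ≤ X := (norm_nonneg _).trans hX
  refine (l2_actDiff_le_and hs hs0 hs1 hsM hK hε hΔ hθ hX l hl).trans ?_
  refine mul_le_mul_of_nonneg_left ?_ hs0
  have h1 : (K + ε) ^ l ≤ (K + ε) ^ (A.depth + 1) := pow_le_pow_right₀ (by linarith) (by omega)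
  have h2 : (l : ℝ) ≤ A.depth + 1 := by exact_mod_cast (by omega : l ≤ A.depth + 1)
  unfold incrementBound
  gcongr

theorem l2_preDiff_le (hs : ∀ l, A.scale l = s) (hs0 : 0 ≤ s) (hs1 : s ≤ 1) (hsM : s * M ≤ 1)
    (hK : 1 ≤ K) (hε : 0 ≤ ε) (hΔ : ‖Δ‖ ≤ ε) (hθ : A.WeightsBounded θ (K * M)) (hX : ‖x‖ ≤ X)
    {l : ℕ} (hl : l < A.depth) :
    l2 (A.preDiff θ Δ x l) ≤ incrementBound X ε K A.depth := by
  have hX0 : 0 ≤ X := (norm_nonneg _).trans hX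
  refine (l2_preDiff_le_of hs1 hsM hK hε hΔ hθ hl (l2_act_le hs hs0 hsM hK hθ hX l hl.le)
    (by positivity) (l2_actDiff_le_and hs hs0 hs1 hsM hK hε hΔ hθ hX l hl.le)).trans ?_
  have h1 : K ^ l ≤ (K + ε) ^ (l + 1) := by
    calc K ^ l ≤ K ^ (l + 1) := pow_le_pow_right₀ hK (Nat.le_succ l)
      _ ≤ (K + ε) ^ (l + 1) := by gcongr; linarith
  have h2 : (K + ε) ^ (l + 1) ≤ (K + ε) ^ (A.depth + 1) :=
    pow_le_pow_right₀ (by linarith) (by omega)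
  have h3 : (l : ℝ) + 1 ≤ A.depth + 1 := by exact_mod_cast (by omega : l + 1 ≤ A.depth + 1)
  unfold incrementBound
  calc (K + ε) * (X * l * ε * (K + ε) ^ l) + ε * (K ^ l * X)
      ≤ (K + ε) * (X * l * ε * (K + ε) ^ l) + ε * ((K + ε) ^ (l + 1) * X) := by gcongr
    _ = X * (l + 1) * ε * (K + ε) ^ (l + 1) := by ring
    _ ≤ _ := by gcongr

theorem l2_gate_mul_le (hs : ∀ l, A.scale l = s) (hs0 : 0 ≤ s) (l : ℕ)
    (u : Fin (A.width (l + 1)) → ℝ) : l2 (fun j => A.gate θ x l j * u j) ≤ s * l2 u := by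
  have h1 : l2 (fun j => A.gate θ x l j * u j) ≤ l2 (fun j => s * u j) := by
    refine l2_mono fun j => ?_
    rw [abs_mul, abs_mul, ← hs l]
    exact mul_le_mul_of_nonneg_right (A.abs_gate_le θ x l j) (abs_nonneg _)
  rwa [l2_mul, abs_of_nonneg hs0] at h1

/-- The output weights contribute `K * M` and every layer passed backwards a factor at most `K`. The
remaining `M` is cancelled later by the factor `s` of one gate. -/
theorem l2_back_le (hs : ∀ l, A.scale l = s) (hs0 : 0 ≤ s) (hsM : s * M ≤ 1) (hM : 0 ≤ M)
    (hK : 1 ≤ K) (hθ : A.WeightsBounded θ (K * M)) {l : ℕ} (hl : l ≤ A.depth) :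
    l2 (A.back θ x l) ≤ K ^ (A.depth + 1) * M := by
  have key : ∀ n ≤ A.depth, l2 (A.back θ x (A.depth - n)) ≤ K ^ (n + 1) * M := by
    intro n
    induction n with
    | zero =>
      intro _
      have : A.back θ x A.depth = fun k => θ (Sum.inr k) := funext fun k => A.back_depth θ x k
      rw [Nat.sub_zero, this]
      simpa using hθ.2
    | succ n ih =>
      intro hn
      have hlt : A.depth - (n + 1) < A.depth := by omega
      have hsucc : A.depth - (n + 1) + 1 = A.depth - n := by omega
      have ih' := ih (by omega)
      rw [← hsucc] at ih'
      have h1 : A.back θ x (A.depth - (n + 1)) = fun k => ∑ j, A.weight θ (A.depth - (n + 1)) j k *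
          (A.gate θ x _ j * A.back θ x (A.depth - (n + 1) + 1) j) :=
        funext fun k => A.back_of_lt θ x hlt k
      rw [h1]
      have hKM : 0 ≤ K * M := by positivity
      refine (l2_transpose_le (hθ.1 _ hlt) hKM _).trans ?_
      have h2 := (l2_gate_mul_le (θ := θ) (x := x) hs hs0 _
        (A.back θ x (A.depth - (n + 1) + 1))).trans (mul_le_mul_of_nonneg_left ih' hs0)
      calc _ ≤ K * M * (s * (K ^ (n + 1) * M)) := mul_le_mul_of_nonneg_left h2 hKM
        _ = (s * M) * (K ^ (n + 1 + 1) * M) := by ring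
        _ ≤ 1 * (K ^ (n + 1 + 1) * M) := by gcongr
        _ = _ := one_mul _
  have h := key (A.depth - l) (by omega)
  rw [show A.depth - (A.depth - l) = l by omega] at h
  refine h.trans (mul_le_mul_of_nonneg_right (pow_le_pow_right₀ hK (by omega)) hM)

/-- Terms with two increments inherit a factor `s` and are small by themselves. For the kink terms
the same norms give only a bound of order one, so they are left as a sum over the units that can
flip. -/
theorem abs_remainder_le_sum (hs : ∀ l, A.scale l = s) (hs0 : 0 ≤ s) (hs1 : s ≤ 1)
    (hsM : s * M ≤ 1) (hM : 0 ≤ M) (hK : 1 ≤ K) (hε : 0 ≤ ε) (hΔ : ‖Δ‖ ≤ ε)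
    (hθ : A.WeightsBounded θ (K * M)) (hX : ‖x‖ ≤ X) :
    |A.remainder θ (θ + Δ) x| ≤ ε * (s * incrementBound X ε K A.depth)
      + ∑ l ∈ Finset.range A.depth,
        (K ^ (A.depth + 1) * (ε * (s * incrementBound X ε K A.depth))
          + s * ∑ j, |A.back θ x (l + 1) j| *
            (if |A.preact θ x l j| ≤ |A.preDiff θ Δ x l j| then |A.preDiff θ Δ x l j| else 0)) := by
  have hX0 : 0 ≤ X := (norm_nonneg _).trans hX
  set c := incrementBound X ε K A.depth with hc
  have hc0 : 0 ≤ c := incrementBound_nonneg hX0 hε hK _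
  rw [remainder_add_eq]
  refine (abs_add_le _ _).trans (add_le_add ?_ ((Finset.abs_sum_le_sum_abs _ _).trans
    (Finset.sum_le_sum fun l hl => ?_)))
  · refine (abs_sum_mul_le_l2 _ _).trans ?_
    exact mul_le_mul ((A.l2_output_le Δ).trans hΔ)
      (l2_actDiff_le hs hs0 hs1 hsM hK hε hΔ hθ hX le_rfl) (l2_nonneg _) hε
  · have hl' : l < A.depth := Finset.mem_range.1 hl
    simp_rw [mul_add, Finset.sum_add_distrib]
    refine (abs_add_le _ _).trans (add_le_add ?_ ?_)
    · refine (abs_sum_mul_le_l2 _ _).trans ?_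
      have h1 := l2_gate_mul_le (θ := θ) (x := x) hs hs0 l
        (fun j => ∑ k, A.weight Δ l j k * A.actDiff θ Δ x l k)
      have h2 : l2 (fun j => ∑ k, A.weight Δ l j k * A.actDiff θ Δ x l k) ≤ ε * (s * c) :=
        (A.l2_weight_mulVec_le Δ l _).trans (mul_le_mul hΔ
          (l2_actDiff_le hs hs0 hs1 hsM hK hε hΔ hθ hX hl'.le) (l2_nonneg _) hε)
      have h3 := l2_back_le (x := x) hs hs0 hsM hM hK hθ (Nat.succ_le_of_lt hl')
      calc _ ≤ K ^ (A.depth + 1) * M * (s * (ε * (s * c))) :=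
            mul_le_mul h3 (h1.trans (mul_le_mul_of_nonneg_left h2 hs0)) (l2_nonneg _)
              (by positivity)
        _ = s * M * (K ^ (A.depth + 1) * (ε * (s * c))) := by ring
        _ ≤ 1 * (K ^ (A.depth + 1) * (ε * (s * c))) := by gcongr
        _ = _ := one_mul _
    · rw [Finset.mul_sum]
      refine (Finset.abs_sum_le_sum_abs _ _).trans (Finset.sum_le_sum fun j _ => ?_)
      rw [abs_mul]
      have h1 := A.abs_kinkError_le θ Δ x l j
      rw [hs, abs_of_nonneg hs0] at h1
      calc _ ≤ |A.back θ x (l + 1) j| * _ := mul_le_mul_of_nonneg_left h1 (abs_nonneg _)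
        _ = _ := by ring

/-- A bound for the Taylor remainder that does not depend on the widths. -/
theorem abs_remainder_le_const (hs : ∀ l, A.scale l = s) (hs0 : 0 ≤ s) (hs1 : s ≤ 1)
    (hsM : s * M ≤ 1) (hM : 0 ≤ M) (hK : 1 ≤ K) (hε : 0 ≤ ε) (hΔ : ‖Δ‖ ≤ ε)
    (hθ : A.WeightsBounded θ (K * M)) (hX : ‖x‖ ≤ X) :
    |A.remainder θ (θ + Δ) x| ≤ ε * incrementBound X ε K A.depth
      + A.depth * (K ^ (A.depth + 1) * (ε * incrementBound X ε K A.depth)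
          + K ^ (A.depth + 1) * incrementBound X ε K A.depth) := by
  have hX0 : 0 ≤ X := (norm_nonneg _).trans hX
  refine (abs_remainder_le_sum hs hs0 hs1 hsM hM hK hε hΔ hθ hX).trans ?_
  set c := incrementBound X ε K A.depth with hc
  have hc0 : 0 ≤ c := incrementBound_nonneg hX0 hε hK _
  have hsc : s * c ≤ c := mul_le_of_le_one_left hc0 hs1
  refine add_le_add (by gcongr) ?_
  refine (Finset.sum_le_card_nsmul _ _ (K ^ (A.depth + 1) * (ε * c) + K ^ (A.depth + 1) * c)
    fun l hl => add_le_add (by gcongr) ?_).trans_eq (by simp [mul_add])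
  have hl' : l < A.depth := Finset.mem_range.1 hl
  have h1 : ∑ j, |A.back θ x (l + 1) j| *
      (if |A.preact θ x l j| ≤ |A.preDiff θ Δ x l j| then |A.preDiff θ Δ x l j| else 0)
      ≤ ∑ j, |A.back θ x (l + 1) j| * |A.preDiff θ Δ x l j| := by
    refine Finset.sum_le_sum fun j _ => mul_le_mul_of_nonneg_left ?_ (abs_nonneg _)
    split_ifs
    · exact le_rfl
    · exact abs_nonneg _
  have h2 : ∑ j, |A.back θ x (l + 1) j| * |A.preDiff θ Δ x l j|
      ≤ K ^ (A.depth + 1) * M * c := by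
    refine (le_abs_self _).trans ((abs_sum_mul_le_l2 _ _).trans ?_)
    refine mul_le_mul ?_ ?_ (l2_nonneg _) (by positivity)
    · exact (l2_mono fun j => by simp).trans
        (l2_back_le (x := x) hs hs0 hsM hM hK hθ (Nat.succ_le_of_lt hl'))
    · exact (l2_mono fun j => by simp).trans
        (l2_preDiff_le hs hs0 hs1 hsM hK hε hΔ hθ hX hl')
  calc _ ≤ s * (K ^ (A.depth + 1) * M * c) := mul_le_mul_of_nonneg_left (h1.trans h2) hs0
    _ = s * M * (K ^ (A.depth + 1) * c) := by ring
    _ ≤ 1 * (K ^ (A.depth + 1) * c) := by gcongr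
    _ = _ := one_mul _

/-- A bound for the Taylor remainder in terms of the fourth powers of the backpropagated
derivatives and the number of units close to the kink. -/
theorem abs_remainder_le_flips (hs : ∀ l, A.scale l = s) (hs0 : 0 ≤ s) (hs1 : s ≤ 1)
    (hsM : s * M ≤ 1) (hM : 0 ≤ M) (hK : 1 ≤ K) (hε : 0 ≤ ε) (hΔ : ‖Δ‖ ≤ ε)
    (hθ : A.WeightsBounded θ (K * M)) (hX : ‖x‖ ≤ X) {τ κ lam : ℝ} (hτ : 0 < τ) (hκ : 0 < κ)
    (hl : 0 < lam) :
    |A.remainder θ (θ + Δ) x| ≤ ε * (s * incrementBound X ε K A.depth)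
      + ∑ l ∈ Finset.range A.depth,
        (K ^ (A.depth + 1) * (ε * (s * incrementBound X ε K A.depth))
          + incrementBound X ε K A.depth * (κ + s ^ 2 / κ * (lam * ∑ j, A.back θ x (l + 1) j ^ 4
            + ((∑ j, if |A.preact θ x l j| ≤ τ then (1 : ℝ) else 0)
              + incrementBound X ε K A.depth ^ 2 / τ ^ 2) / lam))) := by
  refine (abs_remainder_le_sum hs hs0 hs1 hsM hM hK hε hΔ hθ hX).trans ?_
  refine add_le_add le_rfl (Finset.sum_le_sum fun l hl' => add_le_add le_rfl ?_)
  exact sum_flips_le _ _ _ hs0 hτ hκ hl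
    (l2_preDiff_le hs hs0 hs1 hsM hK hε hΔ hθ hX (Finset.mem_range.1 hl'))

end Bounds

end Arch

end

/-! ### Standard Gaussian vectors. -/

noncomputable section

section GaussianFacts

theorem charFun_map_of_inner {E F : Type*} [NormedAddCommGroup E] [InnerProductSpace ℝ E]
    [MeasurableSpace E] [BorelSpace E] [NormedAddCommGroup F] [InnerProductSpace ℝ F]
    [MeasurableSpace F] [BorelSpace F] [SecondCountableTopology F] (μ : Measure E) (L : E → F)
    (hL : Measurable L) (ξ : F) (t : E) (h : ∀ x, inner ℝ (L x) ξ = inner ℝ x t) :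
    charFun (μ.map L) ξ = charFun μ t := by
  rw [charFun_apply, charFun_apply, integral_map hL.aemeasurable (by fun_prop)]
  simp_rw [h]

variable {E : Type*} [NormedAddCommGroup E] [InnerProductSpace ℝ E] [FiniteDimensional ℝ E]
  [MeasurableSpace E] [BorelSpace E]

/-- A linear map whose adjoint is isometric maps the standard Gaussian to the standard Gaussian. -/
theorem stdGaussian_map_of_adjoint_isometry {F : Type*} [NormedAddCommGroup F]
    [InnerProductSpace ℝ F] [FiniteDimensional ℝ F] [MeasurableSpace F] [BorelSpace F]
    (L : E → F) (hL : Measurable L) (T : F → E) (h : ∀ x ξ, inner ℝ (L x) ξ = inner ℝ x (T ξ))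
    (hT : ∀ ξ, ‖T ξ‖ ^ 2 = ‖ξ‖ ^ 2) : (stdGaussian E).map L = stdGaussian F := by
  have := Measure.isProbabilityMeasure_map (μ := stdGaussian E) hL.aemeasurable
  refine Measure.ext_of_charFun (funext fun ξ => ?_)
  rw [charFun_map_of_inner _ L hL ξ (T ξ) fun x => h x ξ, charFun_stdGaussian, charFun_stdGaussian]
  have : (‖T ξ‖ : ℂ) ^ 2 = (‖ξ‖ : ℂ) ^ 2 := by exact_mod_cast hT ξ
  rw [this]

/-- Combining two independent standard Gaussian vectors with complementary weights. -/
theorem stdGaussian_prod_map_add (S T : E → E) (hS : Measurable S) (hT : Measurable T)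
    (S' T' : E → E) (hSa : ∀ x ξ, inner ℝ (S x) ξ = inner ℝ x (S' ξ))
    (hTa : ∀ x ξ, inner ℝ (T x) ξ = inner ℝ x (T' ξ))
    (hST : ∀ ξ, ‖S' ξ‖ ^ 2 + ‖T' ξ‖ ^ 2 = ‖ξ‖ ^ 2) :
    ((stdGaussian E).prod (stdGaussian E)).map (fun p => S p.1 + T p.2) = stdGaussian E := by
  have hm : Measurable fun p : E × E => S p.1 + T p.2 := by fun_prop
  have := Measure.isProbabilityMeasure_map (μ := (stdGaussian E).prod (stdGaussian E))
    hm.aemeasurable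
  refine Measure.ext_of_charFun (funext fun ξ => ?_)
  rw [charFun_apply, integral_map hm.aemeasurable (by fun_prop), charFun_stdGaussian]
  have h1 : ∀ p : E × E, Complex.exp (((inner ℝ (S p.1 + T p.2) ξ : ℝ) : ℂ) * Complex.I)
      = Complex.exp (((inner ℝ p.1 (S' ξ) : ℝ) : ℂ) * Complex.I)
        * Complex.exp (((inner ℝ p.2 (T' ξ) : ℝ) : ℂ) * Complex.I) := by
    intro p
    rw [inner_add_left, hSa, hTa, ← Complex.exp_add]
    push_cast
    ring_nf
  simp_rw [h1]
  rw [integral_prod_mul (fun x : E => Complex.exp (((inner ℝ x (S' ξ) : ℝ) : ℂ) * Complex.I))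
    (fun x : E => Complex.exp (((inner ℝ x (T' ξ) : ℝ) : ℂ) * Complex.I)), ← charFun_apply,
    ← charFun_apply, charFun_stdGaussian, charFun_stdGaussian, ← Complex.exp_add]
  congr 1
  have : (‖S' ξ‖ : ℂ) ^ 2 + (‖T' ξ‖ : ℂ) ^ 2 = (‖ξ‖ : ℂ) ^ 2 := by exact_mod_cast hST ξ
  linear_combination (-1 / 2) * this

/-- The common source of both resampling moves: integrating out `y` first is conditioning on the
part of the vector seen by `S`. -/
theorem lintegral_stdGaussian_eq_prod (S T : E → E) (hS : Measurable S) (hT : Measurable T)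
    (S' T' : E → E) (hSa : ∀ x ξ, inner ℝ (S x) ξ = inner ℝ x (S' ξ))
    (hTa : ∀ x ξ, inner ℝ (T x) ξ = inner ℝ x (T' ξ))
    (hST : ∀ ξ, ‖S' ξ‖ ^ 2 + ‖T' ξ‖ ^ 2 = ‖ξ‖ ^ 2) {Φ : E → ENNReal} (hΦ : Measurable Φ) :
    ∫⁻ x, Φ x ∂(stdGaussian E) = ∫⁻ x, ∫⁻ y, Φ (S x + T y) ∂(stdGaussian E) ∂(stdGaussian E) := by
  have hm : Measurable fun p : E × E => S p.1 + T p.2 := by fun_prop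
  conv_lhs => rw [← stdGaussian_prod_map_add S T hS hT S' T' hSa hTa hST]
  rw [lintegral_map hΦ hm, lintegral_prod (fun p : E × E => Φ (S p.1 + T p.2)) (hΦ.comp hm).aemeasurable]

/-- The law of a linear functional of a standard Gaussian vector. -/
theorem lintegral_inner_stdGaussian (ξ : E) {φ : ℝ → ENNReal} (hφ : Measurable φ) :
    ∫⁻ x, φ (inner ℝ ξ x) ∂(stdGaussian E) = ∫⁻ t, φ (‖ξ‖ * t) ∂(gaussianReal 0 1) := by
  have hL : Measurable fun x : E => (inner ℝ ξ x : ℝ) := by fun_prop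
  have hR : Measurable fun t : ℝ => ‖ξ‖ * t := by fun_prop
  have hmap : (stdGaussian E).map (fun x : E => (inner ℝ ξ x : ℝ))
      = (gaussianReal 0 1).map (fun t => ‖ξ‖ * t) := by
    have := Measure.isProbabilityMeasure_map (μ := stdGaussian E) hL.aemeasurable
    have := Measure.isProbabilityMeasure_map (μ := gaussianReal 0 1) hR.aemeasurable
    refine Measure.ext_of_charFun (funext fun a => ?_)
    rw [charFun_map_of_inner _ _ hL a (a • ξ), charFun_map_of_inner _ _ hR a (‖ξ‖ * a),
      charFun_stdGaussian, charFun_gaussianReal]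
    · rw [norm_smul, Real.norm_eq_abs]
      have : ((|a| * ‖ξ‖ : ℝ) : ℂ) ^ 2 = ((‖ξ‖ * a : ℝ) : ℂ) ^ 2 := by
        rw [← Complex.ofReal_pow, ← Complex.ofReal_pow, mul_pow, sq_abs]
        congr 1
        ring
      rw [this]
      congr 1
      push_cast
      ring
    · intro t
      simp
      ring
    · intro x
      rw [real_inner_smul_right, real_inner_comm]
      simp [real_inner_comm, mul_comm]
  rw [← lintegral_map hφ hL, hmap, lintegral_map hφ hR]

theorem lintegral_prod_stdGaussian {ι : Type*} [Fintype ι] {φ : ℝ → ENNReal} (hφ : Measurable φ) :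
    ∫⁻ y, ∏ i, φ (y i) ∂(stdGaussian (EuclideanSpace ℝ ι))
      = (∫⁻ t, φ t ∂(gaussianReal 0 1)) ^ Fintype.card ι := by
  have hm : Measurable fun y : EuclideanSpace ℝ ι => ∏ i, φ (y i) :=
    Finset.measurable_prod _ fun i _ => hφ.comp (by fun_prop)
  rw [← map_pi_eq_stdGaussian, lintegral_map hm (by fun_prop)]
  have hind : iIndepFun (fun i (x : ι → ℝ) => φ (x i)) (Measure.pi fun _ : ι => gaussianReal 0 1) :=
    iIndepFun_pi (X := fun _ : ι => φ) fun i => hφ.aemeasurable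
  rw [lintegral_prod_eq_prod_lintegral_of_indepFun Finset.univ _ hind
    (fun i => hφ.comp (measurable_pi_apply i))]
  have h1 : ∀ i : ι, ∫⁻ x : ι → ℝ, φ (x i) ∂(Measure.pi fun _ => gaussianReal 0 1)
      = ∫⁻ t, φ t ∂(gaussianReal 0 1) := fun i =>
    (measurePreserving_eval (fun _ : ι => gaussianReal 0 1) i).lintegral_comp hφ
  simp [h1]

/-- The density is at most `1 / √(2π) ≤ 1 / 2` and the interval has length `2 * τ`. -/
theorem gaussianReal_abs_le_le (τ : ℝ) :
    gaussianReal 0 1 {t | |t| ≤ τ} ≤ ENNReal.ofReal τ := by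
  rw [gaussianReal_apply 0 one_ne_zero]
  have h1 : ∀ t : ℝ, gaussianPDF 0 1 t ≤ ENNReal.ofReal (1 / 2) := by
    intro t
    rw [gaussianPDF, gaussianPDFReal]
    apply ENNReal.ofReal_le_ofReal
    have h2 : (2 : ℝ) ≤ Real.sqrt (2 * Real.pi * (1 : NNReal)) := by
      apply Real.le_sqrt_of_sq_le
      have := Real.pi_gt_three
      simp
      linarith
    have h3 : (Real.sqrt (2 * Real.pi * (1 : NNReal)))⁻¹ ≤ 1 / 2 := by
      rw [one_div]
      exact inv_anti₀ (by norm_num) h2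
    have h4 : Real.exp (-(t - 0) ^ 2 / (2 * (1 : NNReal))) ≤ 1 := by
      apply Real.exp_le_one_iff.2
      rw [neg_div]
      exact neg_nonpos.2 (by positivity)
    calc _ ≤ (1 / 2 : ℝ) * 1 := mul_le_mul h3 h4 (Real.exp_pos _).le (by norm_num)
      _ = 1 / 2 := by norm_num
  calc ∫⁻ t in {t | |t| ≤ τ}, gaussianPDF 0 1 t
      ≤ ∫⁻ _t in {t : ℝ | |t| ≤ τ}, ENNReal.ofReal (1 / 2) := lintegral_mono fun t => h1 t
    _ = ENNReal.ofReal (1 / 2) * volume (Set.Icc (-τ) τ) := by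
        rw [setLIntegral_const]
        congr 2
        ext t
        simp [abs_le]
    _ = ENNReal.ofReal τ := by
        rw [Real.volume_Icc, ← ENNReal.ofReal_mul (by norm_num)]
        congr 1
        ring

theorem lintegral_pow_four_gaussianReal_lt_top :
    ∫⁻ t, ENNReal.ofReal (t ^ 4) ∂(gaussianReal 0 1) < ⊤ := by
  have h := (memLp_id_gaussianReal (μ := 0) (v := 1) 4).integrable_norm_pow (p := 4) (by norm_num)
  have h2 := h.2
  rw [hasFiniteIntegral_iff_norm] at h2
  refine lt_of_le_of_lt (lintegral_mono fun t => ?_) h2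
  apply ENNReal.ofReal_le_ofReal
  rw [norm_pow, norm_norm, id, ← norm_pow]
  exact Real.le_norm_self _

/-- Fernique's theorem on the line; the exponent feeds the Chernoff bounds for the weight norms. -/
theorem exists_lintegral_exp_sq_lt_top :
    ∃ c > 0, ∫⁻ t, ENNReal.ofReal (Real.exp (c * t ^ 2)) ∂(gaussianReal 0 1) < ⊤ := by
  obtain ⟨c, hc, hi⟩ := IsGaussian.exists_integrable_exp_sq (gaussianReal 0 1)
  refine ⟨c, hc, ?_⟩
  have h2 := hi.2
  rw [hasFiniteIntegral_iff_norm] at h2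
  refine lt_of_le_of_lt (lintegral_mono fun t => ?_) h2
  apply ENNReal.ofReal_le_ofReal
  simp

/-- At `c = 0` the mean is strictly below one because the positive half-line has positive mass; a
small `c` does not spoil this. A base below one makes collapse of a layer exponentially unlikely in
its width. -/
theorem exists_lintegral_exp_sub_relu_sq_lt_one :
    ∃ c > 0, ∫⁻ t, ENNReal.ofReal (Real.exp (c - max t 0 ^ 2)) ∂(gaussianReal 0 1) < 1 := by
  set r := ∫⁻ t, ENNReal.ofReal (Real.exp (-max t 0 ^ 2)) ∂(gaussianReal 0 1) with hr
  have hle : ∀ t : ℝ, ENNReal.ofReal (Real.exp (-max t 0 ^ 2)) ≤ 1 := fun t => by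
    rw [← ENNReal.ofReal_one]
    exact ENNReal.ofReal_le_ofReal (Real.exp_le_one_iff.2 (by have := sq_nonneg (max t 0); linarith))
  have hr1 : r < 1 := by
    have h1 : ∫⁻ _t : ℝ, (1 : ENNReal) ∂(gaussianReal 0 1) = 1 := by simp
    rw [← h1]
    refine lintegral_strict_mono_of_ae_le_of_ae_lt_on (s := Set.Ioi 0) (by fun_prop) ?_
      (ae_of_all _ hle) ?_ (ae_of_all _ fun t ht => ?_)
    · exact ((lintegral_mono hle).trans_lt (by simp)).ne
    · intro h0
      have := gaussianReal_absolutelyContinuous' 0 one_ne_zero h0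
      simp at this
    · rw [← ENNReal.ofReal_one]
      refine (ENNReal.ofReal_lt_ofReal_iff one_pos).2 (Real.exp_lt_one_iff.2 ?_)
      have ht' : (0 : ℝ) < t := ht
      rw [max_eq_left ht'.le]
      have := sq_pos_of_pos ht'
      linarith
  have hrt : r ≠ ⊤ := (hr1.trans ENNReal.one_lt_top).ne
  have hrr : r.toReal < 1 := by
    rw [← ENNReal.toReal_one]
    exact (ENNReal.toReal_lt_toReal hrt ENNReal.one_ne_top).2 hr1
  have hcont : Tendsto (fun c : ℝ => Real.exp c * r.toReal) (𝓝[>] 0) (𝓝 (Real.exp 0 * r.toReal)) :=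
    ((Real.continuous_exp.mul continuous_const).tendsto 0).mono_left nhdsWithin_le_nhds
  rw [Real.exp_zero, one_mul] at hcont
  obtain ⟨c, hc1, hc0⟩ := ((hcont.eventually (gt_mem_nhds hrr)).and self_mem_nhdsWithin).exists
  refine ⟨c, hc0, ?_⟩
  have : ∀ t : ℝ, ENNReal.ofReal (Real.exp (c - max t 0 ^ 2))
      = ENNReal.ofReal (Real.exp c) * ENNReal.ofReal (Real.exp (-max t 0 ^ 2)) := fun t => by
    rw [← ENNReal.ofReal_mul (Real.exp_pos _).le, ← Real.exp_add, sub_eq_add_neg]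
  simp_rw [this]
  rw [lintegral_const_mul _ (by fun_prop), ← hr, ← ENNReal.ofReal_toReal hrt,
    ← ENNReal.ofReal_mul (Real.exp_pos _).le, ← ENNReal.ofReal_one]
  exact (ENNReal.ofReal_lt_ofReal_iff one_pos).2 hc1

end GaussianFacts

end

/-! ### Gaussian weights: laws of rows and resampling of one layer. -/

noncomputable section

section EmbedVec

variable {ι J : Type*} [Fintype ι] [DecidableEq ι] [Fintype J]

/-- The vector with entries `c j` at the positions `f j`. -/
def embedVec (f : J → ι) (c : J → ℝ) : EuclideanSpace ℝ ι :=
  ∑ j, c j • EuclideanSpace.single (f j) (1 : ℝ)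

theorem inner_embedVec (f : J → ι) (c : J → ℝ) (x : EuclideanSpace ℝ ι) :
    inner ℝ x (embedVec f c) = ∑ j, c j * x (f j) := by
  rw [embedVec, inner_sum]
  simp [real_inner_smul_right, EuclideanSpace.inner_single_right]

theorem norm_embedVec_sq {f : J → ι} (hf : Function.Injective f) (c : J → ℝ) :
    ‖embedVec f c‖ ^ 2 = ∑ j, c j ^ 2 := by
  classical
  rw [← real_inner_self_eq_norm_sq, inner_embedVec]
  refine Finset.sum_congr rfl fun j _ => ?_
  have : embedVec f c (f j) = c j := by
    simp [embedVec, Finset.sum_apply, Pi.single_apply, hf.eq_iff]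
  rw [this, sq]

end EmbedVec

namespace Arch

variable (A : Arch)

theorem lintegral_weight_mulVec {l : ℕ} (hl : l < A.depth) (j : Fin (A.width (l + 1)))
    (v : Fin (A.width l) → ℝ) {φ : ℝ → ENNReal} (hφ : Measurable φ) :
    ∫⁻ θ, φ (∑ k, A.weight θ l j k * v k) ∂(stdGaussian A.Param)
      = ∫⁻ t, φ (l2 v * t) ∂(gaussianReal 0 1) := by
  set f : Fin (A.width l) → A.Idx := fun k => Sum.inl ⟨⟨l, hl⟩, j, k⟩ with hf
  have hfi : Function.Injective f := fun k k' h => by simpa [hf] using h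
  have h1 : ∀ θ : A.Param, ∑ k, A.weight θ l j k * v k = inner ℝ (embedVec f v) θ := by
    intro θ
    rw [real_inner_comm, inner_embedVec]
    refine Finset.sum_congr rfl fun k _ => ?_
    rw [weight, dif_pos hl, mul_comm]
  simp_rw [h1]
  rw [lintegral_inner_stdGaussian _ hφ]
  have h2 : ‖embedVec f v‖ = l2 v := by
    refine (sq_eq_sq₀ (norm_nonneg _) (l2_nonneg _)).1 ?_
    rw [norm_embedVec_sq hfi, l2_sq]
  rw [h2]

theorem lintegral_output (k : Fin (A.width A.depth)) {φ : ℝ → ENNReal} (hφ : Measurable φ) :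
    ∫⁻ θ : A.Param, φ (θ (Sum.inr k)) ∂(stdGaussian A.Param) = ∫⁻ t, φ t ∂(gaussianReal 0 1) := by
  have h1 : ∀ θ : A.Param, θ (Sum.inr k)
      = inner ℝ (EuclideanSpace.single (Sum.inr k : A.Idx) (1 : ℝ)) θ := by
    intro θ
    simp [EuclideanSpace.inner_single_left]
  simp_rw [h1]
  rw [lintegral_inner_stdGaussian _ hφ]
  simp

theorem lintegral_output_sum (v : Fin (A.width A.depth) → ℝ) {φ : ℝ → ENNReal}
    (hφ : Measurable φ) :
    ∫⁻ θ : A.Param, φ (∑ k, θ (Sum.inr k) * v k) ∂(stdGaussian A.Param)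
      = ∫⁻ t, φ (l2 v * t) ∂(gaussianReal 0 1) := by
  have h1 : ∀ θ : A.Param, ∑ k, θ (Sum.inr k) * v k
      = inner ℝ (embedVec (Sum.inr : _ → A.Idx) v) θ := by
    intro θ
    rw [real_inner_comm, inner_embedVec]
    exact Finset.sum_congr rfl fun k _ => mul_comm _ _
  simp_rw [h1]
  rw [lintegral_inner_stdGaussian _ hφ]
  have h2 : ‖embedVec (Sum.inr : _ → A.Idx) v‖ = l2 v := by
    refine (sq_eq_sq₀ (norm_nonneg _) (l2_nonneg _)).1 ?_
    rw [norm_embedVec_sq Sum.inr_injective, l2_sq]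
  rw [h2]

theorem lintegral_prod_output {φ : ℝ → ENNReal} (hφ : Measurable φ) :
    ∫⁻ θ : A.Param, ∏ k, φ (θ (Sum.inr k)) ∂(stdGaussian A.Param)
      = (∫⁻ t, φ t ∂(gaussianReal 0 1)) ^ A.width A.depth := by
  have hm : Measurable fun y : EuclideanSpace ℝ (Fin (A.width A.depth)) => ∏ i, φ (y i) :=
    Finset.measurable_prod _ fun i _ => hφ.comp (by fun_prop)
  set L : A.Param → EuclideanSpace ℝ (Fin (A.width A.depth)) :=
    fun θ => WithLp.toLp 2 fun k => θ (Sum.inr k) with hL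
  have hLm : Measurable L := by fun_prop
  have hmap := stdGaussian_map_of_adjoint_isometry L hLm
    (fun ξ => embedVec (Sum.inr : _ → A.Idx) fun k => ξ k) (fun θ ξ => by
      rw [inner_embedVec]
      simp [PiLp.inner_apply, hL]) (fun ξ => by
      rw [norm_embedVec_sq Sum.inr_injective, EuclideanSpace.real_norm_sq_eq])
  have h1 := lintegral_prod_stdGaussian (ι := Fin (A.width A.depth)) hφ
  rw [← hmap, lintegral_map hm hLm, Fintype.card_fin] at h1
  exact h1

/-- Distinct rows are independent, and the product of a row with a unit vector is standard Gaussian.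
Normalization excludes `v = 0`, which is checked by hand. -/
theorem lintegral_prod_weight_mulVec {l : ℕ} (hl : l < A.depth)
    (v : Fin (A.width l) → ℝ) {φ : ℝ → ENNReal} (hφ : Measurable φ) :
    ∫⁻ θ, ∏ j, φ (∑ k, A.weight θ l j k * v k) ∂(stdGaussian A.Param)
      = (∫⁻ t, φ (l2 v * t) ∂(gaussianReal 0 1)) ^ A.width (l + 1) := by
  rcases (l2_nonneg v).eq_or_lt with h0 | h0
  · have hv : ∀ k, v k = 0 := by
      intro k
      have h1 := l2_sq v
      rw [← h0] at h1
      have h2 := (Finset.sum_eq_zero_iff_of_nonneg fun i _ => sq_nonneg (v i)).1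
        (by rw [← h1]; norm_num) k (Finset.mem_univ k)
      exact pow_eq_zero_iff two_ne_zero |>.1 h2
    rw [← h0]
    simp [hv]
  · set n := l2 v with hn
    set L : A.Param → EuclideanSpace ℝ (Fin (A.width (l + 1))) :=
      fun θ => WithLp.toLp 2 fun j => ∑ k, A.weight θ l j k * (n⁻¹ * v k) with hL
    have hLm : Measurable L := by
      have : ∀ j k, Measurable fun θ : A.Param => A.weight θ l j k := fun j k =>
        (A.continuous_weight l j k).measurable
      fun_prop
    set f : Fin (A.width (l + 1)) × Fin (A.width l) → A.Idx := fun q => Sum.inl ⟨⟨l, hl⟩, q⟩ with hf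
    have hfi : Function.Injective f := fun k k' h => by simpa [hf] using h
    have hmap := stdGaussian_map_of_adjoint_isometry L hLm
      (fun ξ => embedVec f fun q => ξ q.1 * (n⁻¹ * v q.2)) (fun θ ξ => by
        rw [inner_embedVec, Fintype.sum_prod_type]
        simp only [PiLp.inner_apply, hL, RCLike.inner_apply, conj_trivial, Finset.mul_sum]
        refine Finset.sum_congr rfl fun j _ => Finset.sum_congr rfl fun k _ => ?_
        rw [weight, dif_pos hl]
        ring) (fun ξ => by
        rw [norm_embedVec_sq hfi, EuclideanSpace.real_norm_sq_eq, Fintype.sum_prod_type]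
        refine Finset.sum_congr rfl fun j _ => ?_
        simp only [mul_pow]
        rw [← Finset.mul_sum, ← Finset.mul_sum, ← l2_sq, ← hn]
        field_simp)
    have hφ' : Measurable fun t => φ (n * t) := hφ.comp (measurable_const_mul n)
    have hm : Measurable fun y : EuclideanSpace ℝ (Fin (A.width (l + 1))) => ∏ i, φ (n * y i) :=
      Finset.measurable_prod _ fun i _ => hφ'.comp (by fun_prop)
    have h1 := lintegral_prod_stdGaussian (ι := Fin (A.width (l + 1))) hφ'
    rw [← hmap, lintegral_map hm hLm, Fintype.card_fin] at h1
    rw [← h1]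
    refine lintegral_congr fun θ => Finset.prod_congr rfl fun j _ => ?_
    congr 1
    simp only [hL, Finset.mul_sum]
    refine Finset.sum_congr rfl fun k _ => ?_
    field_simp

/-- The parameters with the weights of layer `l` replaced by those of `θ'`; the output weights
belong to the layer `depth`. -/
def mix (l : ℕ) (θ θ' : A.Param) : A.Param :=
  WithLp.toLp 2 fun i => match i with
    | Sum.inl q => if q.1.1 = l then θ' (Sum.inl q) else θ (Sum.inl q)
    | Sum.inr k => if l = A.depth then θ' (Sum.inr k) else θ (Sum.inr k)

theorem mix_inl (l : ℕ) (θ θ' : A.Param)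
    (q : Σ l : Fin A.depth, Fin (A.width (l + 1)) × Fin (A.width l)) :
    A.mix l θ θ' (Sum.inl q) = if q.1.1 = l then θ' (Sum.inl q) else θ (Sum.inl q) := rfl

theorem mix_inr (l : ℕ) (θ θ' : A.Param) (k : Fin (A.width A.depth)) :
    A.mix l θ θ' (Sum.inr k) = if l = A.depth then θ' (Sum.inr k) else θ (Sum.inr k) := rfl

theorem weight_mix (l : ℕ) (θ θ' : A.Param) (l' : ℕ) (j : Fin (A.width (l' + 1)))
    (k : Fin (A.width l')) :
    A.weight (A.mix l θ θ') l' j k = if l' = l then A.weight θ' l' j k else A.weight θ l' j k := by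
  unfold weight
  by_cases h1 : l' < A.depth
  · rw [dif_pos h1, dif_pos h1, dif_pos h1]
    rfl
  · rw [dif_neg h1, dif_neg h1, dif_neg h1, ite_self]

theorem measurable_mix (l : ℕ) : Measurable fun p : A.Param × A.Param => A.mix l p.1 p.2 := by
  refine (WithLp.measurable_toLp 2 _).comp (measurable_pi_iff.2 fun i => ?_)
  rcases i with q | k
  · by_cases h : q.1.1 = l
    · simp only [if_pos h]
      fun_prop
    · simp only [if_neg h]
      fun_prop
  · simp only
    split_ifs <;> fun_prop

/-- Keeping layer `l` and keeping everything else are complementary coordinate projections. The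
inner integral is the conditional expectation given all other layers. -/
theorem lintegral_mix (l : ℕ) {Φ : A.Param → ENNReal} (hΦ : Measurable Φ) :
    ∫⁻ θ, Φ θ ∂(stdGaussian A.Param)
      = ∫⁻ θ, ∫⁻ θ', Φ (A.mix l θ θ') ∂(stdGaussian A.Param) ∂(stdGaussian A.Param) := by
  have hadd : ∀ θ θ' : A.Param, A.mix l θ θ' = A.mix l θ 0 + A.mix l 0 θ' := by
    intro θ θ'
    ext i
    rcases i with q | k
    · simp only [PiLp.add_apply, mix_inl]
      split_ifs <;> simp
    · simp only [PiLp.add_apply, mix_inr]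
      split_ifs <;> simp
  refine (lintegral_stdGaussian_eq_prod (fun θ => A.mix l θ 0) (fun θ => A.mix l 0 θ)
    ((A.measurable_mix l).comp measurable_prodMk_right)
    ((A.measurable_mix l).comp measurable_prodMk_left)
    (fun θ => A.mix l θ 0) (fun θ => A.mix l 0 θ) (fun θ ξ => ?_) (fun θ ξ => ?_) (fun ξ => ?_) hΦ).trans
    (lintegral_congr fun θ => lintegral_congr fun θ' => by rw [← hadd])
  · simp only [PiLp.inner_apply]
    refine Finset.sum_congr rfl fun i _ => ?_
    rcases i with q | k
    · simp only [mix_inl]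
      split_ifs <;> simp
    · simp only [mix_inr]
      split_ifs <;> simp
  · simp only [PiLp.inner_apply]
    refine Finset.sum_congr rfl fun i _ => ?_
    rcases i with q | k
    · simp only [mix_inl]
      split_ifs <;> simp
    · simp only [mix_inr]
      split_ifs <;> simp
  · simp only [EuclideanSpace.real_norm_sq_eq, ← Finset.sum_add_distrib]
    refine Finset.sum_congr rfl fun i _ => ?_
    rcases i with q | k
    · simp only [mix_inl]
      split_ifs <;> simp
    · simp only [mix_inr]
      split_ifs <;> simp

/-- The rows of layer `l` are projected onto `a l`. -/
def projRow (l : ℕ) (a : (l : ℕ) → Fin (A.width l) → ℝ) (θ : A.Param) : A.Param :=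
  WithLp.toLp 2 fun i => match i with
    | Sum.inl q => if q.1.1 = l then
        (∑ k, θ (Sum.inl ⟨q.1, q.2.1, k⟩) * a q.1 k) * a q.1 q.2.2 else θ (Sum.inl q)
    | Sum.inr k => θ (Sum.inr k)

theorem measurable_projRow (l : ℕ) (a : (l : ℕ) → Fin (A.width l) → ℝ) :
    Measurable (A.projRow l a) := by
  refine (WithLp.measurable_toLp 2 _).comp (measurable_pi_iff.2 fun i => ?_)
  rcases i with q | k
  · simp only
    split_ifs <;> fun_prop
  · simp only
    fun_prop

theorem projRow_inl (l : ℕ) (a : (l : ℕ) → Fin (A.width l) → ℝ) (θ : A.Param)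
    (q : Σ l : Fin A.depth, Fin (A.width (l + 1)) × Fin (A.width l)) :
    A.projRow l a θ (Sum.inl q) = if q.1.1 = l then
        (∑ k, θ (Sum.inl ⟨q.1, q.2.1, k⟩) * a q.1 k) * a q.1 q.2.2 else θ (Sum.inl q) := rfl

theorem projRow_inr (l : ℕ) (a : (l : ℕ) → Fin (A.width l) → ℝ) (θ : A.Param)
    (k : Fin (A.width A.depth)) : A.projRow l a θ (Sum.inr k) = θ (Sum.inr k) := rfl

theorem weight_projRow (l : ℕ) (a : (l : ℕ) → Fin (A.width l) → ℝ) (θ : A.Param)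
    (j : Fin (A.width (l + 1))) (k : Fin (A.width l)) :
    A.weight (A.projRow l a θ) l j k = (∑ i, A.weight θ l j i * a l i) * a l k := by
  unfold weight
  split_ifs with h1
  · simp [projRow_inl]
  · simp

theorem inner_projRow (l : ℕ) (a : (l : ℕ) → Fin (A.width l) → ℝ) (θ ξ : A.Param) :
    inner ℝ (A.projRow l a θ) ξ = inner ℝ θ (A.projRow l a ξ) := by
  simp only [PiLp.inner_apply, RCLike.inner_apply, conj_trivial]
  rw [Fintype.sum_sum_type, Fintype.sum_sum_type]
  congr 1
  rw [Fintype.sum_sigma, Fintype.sum_sigma]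
  refine Finset.sum_congr rfl fun l' _ => ?_
  rw [Fintype.sum_prod_type, Fintype.sum_prod_type]
  refine Finset.sum_congr rfl fun j _ => ?_
  simp only [projRow_inl]
  by_cases h : l'.1 = l
  · simp only [h, if_true]
    have e1 : ∀ (u w : Fin (A.width l') → ℝ), ∑ k, u k * ((∑ i, w i * a l' i) * a l' k)
        = (∑ i, u i * a l' i) * ∑ i, w i * a l' i := by
      intro u w
      rw [Finset.sum_mul]
      exact Finset.sum_congr rfl fun k _ => by ring
    rw [e1]
    simp_rw [mul_comm (_ * a l' _) (θ _)]
    rw [e1, mul_comm]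
  · simp [h]

theorem inner_sub_projRow (l : ℕ) (a : (l : ℕ) → Fin (A.width l) → ℝ) (θ ξ : A.Param) :
    inner ℝ (θ - A.projRow l a θ) ξ = inner ℝ θ (ξ - A.projRow l a ξ) := by
  rw [inner_sub_left, inner_sub_right, inner_projRow]

theorem projRow_projRow {l : ℕ} {a : (l : ℕ) → Fin (A.width l) → ℝ} (ha : ∑ i, a l i ^ 2 = 1)
    (θ : A.Param) : A.projRow l a (A.projRow l a θ) = A.projRow l a θ := by
  ext i
  rcases i with ⟨l', j, k⟩ | k
  · by_cases h : l'.1 = l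
    · subst h
      simp only [projRow_inl, if_true]
      congr 1
      have e1 : ∀ S : ℝ, ∑ i, S * a l' i * a l' i = S := by
        intro S
        simp_rw [mul_assoc, ← sq]
        rw [← Finset.mul_sum, ha, mul_one]
      exact e1 (∑ k, θ (Sum.inl ⟨l', (j, k)⟩) * a l' k)
    · simp [projRow_inl, h]
  · simp [projRow_inr]

theorem norm_projRow_sq_add {l : ℕ} {a : (l : ℕ) → Fin (A.width l) → ℝ} (ha : ∑ i, a l i ^ 2 = 1)
    (ξ : A.Param) : ‖A.projRow l a ξ‖ ^ 2 + ‖ξ - A.projRow l a ξ‖ ^ 2 = ‖ξ‖ ^ 2 := by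
  have h0 : inner ℝ (A.projRow l a ξ) (ξ - A.projRow l a ξ) = (0 : ℝ) := by
    rw [inner_sub_right, ← A.inner_projRow, projRow_projRow A ha, sub_eq_zero]
  have h1 := norm_add_sq_real (A.projRow l a ξ) (ξ - A.projRow l a ξ)
  rw [add_sub_cancel, h0] at h1
  linarith

/-- For a unit vector `a l` the map `projRow l a` is self-adjoint and idempotent, so it and its
complement are complementary orthogonal projections. The complement touches only the rows of layer
`l`. -/
theorem lintegral_projRow {l : ℕ} {a : (l : ℕ) → Fin (A.width l) → ℝ} (ha : ∑ i, a l i ^ 2 = 1)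
    {Φ : A.Param → ENNReal} (hΦ : Measurable Φ) :
    ∫⁻ θ, Φ θ ∂(stdGaussian A.Param)
      = ∫⁻ θ, ∫⁻ θ', Φ (A.projRow l a θ + (θ' - A.projRow l a θ'))
        ∂(stdGaussian A.Param) ∂(stdGaussian A.Param) :=
  lintegral_stdGaussian_eq_prod (A.projRow l a) (fun θ => θ - A.projRow l a θ)
    (A.measurable_projRow l a) (measurable_id.sub (A.measurable_projRow l a)) (A.projRow l a)
    (fun θ => θ - A.projRow l a θ) (A.inner_projRow l a) (A.inner_sub_projRow l a)
    (A.norm_projRow_sq_add ha) hΦ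

theorem weight_sub (θ Δ : A.Param) (l : ℕ) (j : Fin (A.width (l + 1))) (k : Fin (A.width l)) :
    A.weight (θ - Δ) l j k = A.weight θ l j k - A.weight Δ l j k := by
  unfold weight
  split_ifs <;> simp

/-- Resampling the part of layer `l` orthogonal to `a l` does not change its action on `a l`. -/
theorem sum_weight_resample_mul {l : ℕ} {a : (l : ℕ) → Fin (A.width l) → ℝ}
    (ha : ∑ i, a l i ^ 2 = 1) (θ θ' : A.Param) (j : Fin (A.width (l + 1))) :
    ∑ k, A.weight (A.projRow l a θ + (θ' - A.projRow l a θ')) l j k * a l k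
      = ∑ k, A.weight θ l j k * a l k := by
  simp only [weight_add, weight_sub, weight_projRow, add_mul, sub_mul, mul_assoc, ← sq,
    Finset.sum_add_distrib, Finset.sum_sub_distrib]
  rw [← Finset.mul_sum, ← Finset.mul_sum, ha]
  ring

theorem act_mix_of_le (l : ℕ) (θ θ' : A.Param) (x : A.Input) :
    ∀ i ≤ l, A.act (A.mix l θ θ') x i = A.act θ x i := by
  intro i
  induction i with
  | zero => intro _; rfl
  | succ i ih =>
    intro hi
    funext j
    have hne : i ≠ l := by omega
    simp only [act, ih (by omega), weight_mix, if_neg hne]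

/-- Given the other layers, the network sees the weights of layer `l` only through the
preactivations they produce. Resampling that preserves these therefore preserves all activations and
gates. -/
theorem act_congr {l : ℕ} {θ₁ θ₂ : A.Param} {x : A.Input}
    (hw : ∀ l' ≠ l, A.weight θ₁ l' = A.weight θ₂ l') (hp : A.preact θ₁ x l = A.preact θ₂ x l) :
    ∀ i, A.act θ₁ x i = A.act θ₂ x i := by
  intro i
  induction i with
  | zero => rfl
  | succ i ih =>
    funext j
    rw [act_succ, act_succ]
    by_cases h : i = l
    · subst h
      rw [hp]
    · unfold preact
      rw [ih, hw i h]

theorem preact_congr {l : ℕ} {θ₁ θ₂ : A.Param} {x : A.Input}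
    (hw : ∀ l' ≠ l, A.weight θ₁ l' = A.weight θ₂ l') (hp : A.preact θ₁ x l = A.preact θ₂ x l)
    (i : ℕ) : A.preact θ₁ x i = A.preact θ₂ x i := by
  by_cases h : i = l
  · subst h
    exact hp
  · funext j
    unfold preact
    rw [A.act_congr hw hp i, hw i h]

theorem gate_congr {l : ℕ} {θ₁ θ₂ : A.Param} {x : A.Input}
    (hw : ∀ l' ≠ l, A.weight θ₁ l' = A.weight θ₂ l') (hp : A.preact θ₁ x l = A.preact θ₂ x l) :
    A.gate θ₁ x = A.gate θ₂ x := by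
  funext i j
  rw [gate_eq, gate_eq, A.preact_congr hw hp i]

theorem backFrom_congr {l : ℕ} {θ₁ θ₂ : A.Param} (g : (l : ℕ) → Fin (A.width (l + 1)) → ℝ)
    (hw : ∀ l' ≠ l, A.weight θ₁ l' = A.weight θ₂ l')
    (ho : ∀ k, θ₁ (Sum.inr k) = θ₂ (Sum.inr k)) :
    ∀ n i, l < i → A.backFrom g θ₁ n i = A.backFrom g θ₂ n i := by
  intro n
  induction n with
  | zero =>
    intro i _
    funext k
    simp only [backFrom, ho]
  | succ n ih =>
    intro i hi
    funext k
    simp only [backFrom]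
    rw [hw i (by omega), ih (i + 1) (by omega)]

theorem net_congr {l : ℕ} {θ₁ θ₂ : A.Param} {x : A.Input}
    (hw : ∀ l' ≠ l, A.weight θ₁ l' = A.weight θ₂ l') (ho : ∀ k, θ₁ (Sum.inr k) = θ₂ (Sum.inr k))
    (hp : A.preact θ₁ x l = A.preact θ₂ x l) : A.net θ₁ x = A.net θ₂ x := by
  unfold net
  rw [A.act_congr hw hp]
  simp only [ho]

theorem back_congr {l : ℕ} {θ₁ θ₂ : A.Param} {x : A.Input}
    (hw : ∀ l' ≠ l, A.weight θ₁ l' = A.weight θ₂ l') (ho : ∀ k, θ₁ (Sum.inr k) = θ₂ (Sum.inr k))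
    (hp : A.preact θ₁ x l = A.preact θ₂ x l) {i : ℕ} (hi : l < i) :
    A.back θ₁ x i = A.back θ₂ x i := by
  funext k
  rw [back, back, A.gate_congr hw hp, A.backFrom_congr _ hw ho _ _ hi]

theorem act_succ_eq_gate_mul (θ : A.Param) (x : A.Input) (l : ℕ) (j : Fin (A.width (l + 1))) :
    A.act θ x (l + 1) j = A.gate θ x l j * A.preact θ x l j := by
  rw [act_succ, gate_eq]
  split_ifs with h
  · rw [max_eq_left h.le]
  · rw [max_eq_right (not_lt.1 h)]
    simp

/-- Euler's identity: with frozen gates the output is linear in the activations of each layer, and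
the gates reproduce the actual activations. -/
theorem sum_back_mul_act (θ : A.Param) (x : A.Input) {l : ℕ} (hl : l ≤ A.depth) :
    ∑ k, A.back θ x l k * A.act θ x l k = A.net θ x := by
  have key : ∀ n ≤ A.depth, ∑ k, A.back θ x (A.depth - n) k * A.act θ x (A.depth - n) k
      = A.net θ x := by
    intro n
    induction n with
    | zero => intro _; simp [back_depth, net]
    | succ n ih =>
      intro hn
      have hlt : A.depth - (n + 1) < A.depth := by omega
      have hsucc : A.depth - (n + 1) + 1 = A.depth - n := by omega
      have ih' := ih (by omega)
      rw [← hsucc] at ih'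
      rw [← ih']
      simp_rw [A.back_of_lt θ x hlt, act_succ_eq_gate_mul, preact, Finset.sum_mul, Finset.mul_sum]
      rw [Finset.sum_comm]
      exact Finset.sum_congr rfl fun k _ => Finset.sum_congr rfl fun j _ => by ring
  have h := key (A.depth - l) (by omega)
  rwa [show A.depth - (A.depth - l) = l by omega] at h

end Arch

end

/-! ### Moments and tail bounds at Gaussian initialization. -/

noncomputable section

namespace Arch

variable (A : Arch)

theorem measurable_weight (l : ℕ) (j : Fin (A.width (l + 1))) (k : Fin (A.width l)) :
    Measurable fun θ : A.Param => A.weight θ l j k := (A.continuous_weight l j k).measurable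

theorem measurable_act_left (x : A.Input) (l : ℕ) (j : Fin (A.width l)) :
    Measurable fun θ : A.Param => A.act θ x l j :=
  (A.continuous_act l j).measurable.comp (measurable_id.prodMk measurable_const)

theorem measurable_gate_left (x : A.Input) (l : ℕ) (j : Fin (A.width (l + 1))) :
    Measurable fun θ : A.Param => A.gate θ x l j :=
  (A.measurable_gate l j).comp (measurable_id.prodMk measurable_const)

theorem measurable_preact_left (x : A.Input) (l : ℕ) (j : Fin (A.width (l + 1))) :
    Measurable fun θ : A.Param => A.preact θ x l j := by
  have h1 := fun k => A.measurable_weight l j k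
  have h2 := fun k => A.measurable_act_left x l k
  unfold preact
  fun_prop

theorem measurable_back_left (x : A.Input) (l : ℕ) (k : Fin (A.width l)) :
    Measurable fun θ : A.Param => A.back θ x l k := by
  have key : ∀ n l (k : Fin (A.width l)),
      Measurable fun θ : A.Param => A.backFrom (A.gate θ x) θ n l k := by
    intro n
    induction n with
    | zero =>
      intro l k
      simp only [backFrom]
      split_ifs <;> fun_prop
    | succ n ih =>
      intro l k
      have h1 := fun j => A.measurable_weight l j k
      have h2 := fun j => A.measurable_gate_left x l j
      have h3 := fun j => ih (l + 1) j
      simp only [backFrom]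
      fun_prop
  exact key _ l k

theorem measurable_l2 {Ω ι : Type*} [MeasurableSpace Ω] [Fintype ι] {f : Ω → ι → ℝ}
    (hf : ∀ i, Measurable fun ω => f ω i) : Measurable fun ω => l2 (f ω) := by
  have : ∀ ω, l2 (f ω) = Real.sqrt (∑ i, f ω i ^ 2) := fun ω => by
    rw [← l2_sq, Real.sqrt_sq (l2_nonneg _)]
  simp_rw [this]
  fun_prop

/-- The parameters where the output, the activations of layer `l` and the gated derivatives of
layer `l + 1` are under control. It is invariant under resampling the part of layer `l` that is
orthogonal to the activations. -/
def controlled (x : A.Input) (l : ℕ) (c C₁ C₂ : ℝ) : Set A.Param :=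
  {θ | |A.net θ x| ≤ C₁ ∧ c ≤ l2 (A.act θ x l) ∧
    l2 (fun k => A.gate θ x l k * A.back θ x (l + 1) k) ≤ C₂}

theorem measurableSet_controlled (x : A.Input) (l : ℕ) (c C₁ C₂ : ℝ) :
    MeasurableSet (A.controlled x l c C₁ C₂) := by
  have h1 : Measurable fun θ => A.net θ x := (A.continuous_net_left x).measurable
  have h2 : Measurable fun θ => l2 (A.act θ x l) := measurable_l2 fun k => A.measurable_act_left x l k
  have h3 : Measurable fun θ => l2 (fun k => A.gate θ x l k * A.back θ x (l + 1) k) :=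
    measurable_l2 fun k => (A.measurable_gate_left x l k).mul (A.measurable_back_left x (l + 1) k)
  exact (measurableSet_le (continuous_abs.measurable.comp h1) measurable_const).inter
    ((measurableSet_le measurable_const h2).inter (measurableSet_le h3 measurable_const))

theorem preact_mix (l : ℕ) (θ θ' : A.Param) (x : A.Input) (j : Fin (A.width (l + 1))) :
    A.preact (A.mix l θ θ') x l j = ∑ k, A.weight θ' l j k * A.act θ x l k := by
  unfold preact
  rw [A.act_mix_of_le l θ θ' x l le_rfl]
  simp only [weight_mix, if_true]

theorem add_pow_four_le (a b : ℝ) : (a + b) ^ 4 ≤ 8 * a ^ 4 + 8 * b ^ 4 := by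
  nlinarith [sq_nonneg (a - b), sq_nonneg (a + b), sq_nonneg (a ^ 2 - b ^ 2),
    sq_nonneg (a * b), mul_nonneg (sq_nonneg (a - b)) (sq_nonneg (a + b)),
    mul_nonneg (sq_nonneg (a - b)) (sq_nonneg (a - b)),
    mul_nonneg (sq_nonneg (a - b)) (add_nonneg (sq_nonneg a) (sq_nonneg b))]

theorem lintegral_add_inner_pow_four_le {E : Type*} [NormedAddCommGroup E] [InnerProductSpace ℝ E]
    [FiniteDimensional ℝ E] [MeasurableSpace E] [BorelSpace E] (ζ : E) {t C D : ℝ}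
    (ht : |t| ≤ D) (hζ : ‖ζ‖ ≤ C) :
    ∫⁻ θ : E, ENNReal.ofReal ((t + inner ℝ ζ θ) ^ 4) ∂(stdGaussian E)
      ≤ ENNReal.ofReal (8 * D ^ 4)
        + ENNReal.ofReal (8 * C ^ 4) * ∫⁻ t, ENNReal.ofReal (t ^ 4) ∂(gaussianReal 0 1) := by
  have h1 : ∀ θ : E, ENNReal.ofReal ((t + inner ℝ ζ θ) ^ 4)
      ≤ ENNReal.ofReal (8 * D ^ 4) + ENNReal.ofReal (8 * (inner ℝ ζ θ : ℝ) ^ 4) := by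
    intro θ
    rw [← ENNReal.ofReal_add (by positivity) (by positivity)]
    apply ENNReal.ofReal_le_ofReal
    refine (add_pow_four_le _ _).trans (add_le_add ?_ le_rfl)
    have : t ^ 4 ≤ D ^ 4 := by
      rw [← (show Even 4 by decide).pow_abs t]
      gcongr
    linarith
  refine (lintegral_mono h1).trans ?_
  rw [lintegral_add_left measurable_const, lintegral_const, measure_univ, mul_one,
    lintegral_inner_stdGaussian ζ (φ := fun y => ENNReal.ofReal (8 * y ^ 4)) (by fun_prop),
    ← lintegral_const_mul _ (by fun_prop)]
  refine add_le_add le_rfl (lintegral_mono fun y => ?_)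
  rw [← ENNReal.ofReal_mul (by have := norm_nonneg ζ; positivity)]
  apply ENNReal.ofReal_le_ofReal
  rw [mul_pow]
  have : ‖ζ‖ ^ 4 ≤ C ^ 4 := by gcongr
  have : ‖ζ‖ ^ 4 * y ^ 4 ≤ C ^ 4 * y ^ 4 := by gcongr
  linarith

theorem norm_sub_projRow_le {l : ℕ} {a : (l : ℕ) → Fin (A.width l) → ℝ} (ha : ∑ i, a l i ^ 2 = 1)
    (ξ : A.Param) : ‖ξ - A.projRow l a ξ‖ ≤ ‖ξ‖ := by
  refine le_of_sq_le_sq ?_ (norm_nonneg _)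
  have := A.norm_projRow_sq_add ha ξ
  have := sq_nonneg ‖A.projRow l a ξ‖
  linarith

/-- The backpropagated derivatives have bounded fourth moments. -/
theorem lintegral_back_pow_four_le (x : A.Input) {l : ℕ} (hl : l < A.depth) (j : Fin (A.width l))
    {c C₁ C₂ : ℝ} (hc : 0 < c) :
    ∫⁻ θ, (A.controlled x l c C₁ C₂).indicator
        (fun θ => ENNReal.ofReal (A.back θ x l j ^ 4)) θ ∂(stdGaussian A.Param)
      ≤ ENNReal.ofReal (8 * (C₁ / c) ^ 4)
        + ENNReal.ofReal (8 * C₂ ^ 4) * ∫⁻ t, ENNReal.ofReal (t ^ 4) ∂(gaussianReal 0 1) := by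
  set Φ : A.Param → ENNReal := (A.controlled x l c C₁ C₂).indicator
    (fun θ => ENNReal.ofReal (A.back θ x l j ^ 4)) with hΦ
  set R := ENNReal.ofReal (8 * (C₁ / c) ^ 4)
        + ENNReal.ofReal (8 * C₂ ^ 4) * ∫⁻ t, ENNReal.ofReal (t ^ 4) ∂(gaussianReal 0 1) with hR
  have hΦm : Measurable Φ := by
    refine Measurable.indicator ?_ (A.measurableSet_controlled x l c C₁ C₂)
    have := A.measurable_back_left x l j
    fun_prop
  rw [A.lintegral_mix l hΦm]
  suffices h : ∀ θ, ∫⁻ θ', Φ (A.mix l θ θ') ∂(stdGaussian A.Param) ≤ R by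
    refine (lintegral_mono h).trans ?_
    simp
  intro θ
  set n := l2 (A.act θ x l) with hn
  rcases lt_or_ge n c with hnc | hnc
  · have h0 : ∀ θ', Φ (A.mix l θ θ') = 0 := by
      intro θ'
      refine Set.indicator_of_notMem (fun hmem => ?_) _
      have := hmem.2.1
      rw [A.act_mix_of_le l θ θ' x l le_rfl] at this
      exact absurd this (not_le.2 hnc)
    simp [h0]
  have hn0 : 0 < n := hc.trans_le hnc
  -- The direction of the activations entering layer `l`. Only the component `a l` matters and is a
  -- unit vector; the other layers merely fit the type of `projRow`.
  set a : (l : ℕ) → Fin (A.width l) → ℝ := fun l' k => n⁻¹ * A.act θ x l' k with ha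
  have ha1 : ∑ i, a l i ^ 2 = 1 := by
    simp only [ha, mul_pow]
    rw [← Finset.mul_sum, ← l2_sq, ← hn]
    field_simp
  have haj : |a l j| ≤ 1 := by
    rw [← sq_le_one_iff_abs_le_one, ← ha1]
    exact Finset.single_le_sum (f := fun i => a l i ^ 2) (fun i _ => sq_nonneg _) (Finset.mem_univ j)
  have hΨm : Measurable fun θ' => Φ (A.mix l θ θ') :=
    hΦm.comp ((A.measurable_mix l).comp measurable_prodMk_left)
  rw [A.lintegral_projRow ha1 hΨm]
  suffices h : ∀ θ', ∫⁻ ω, Φ (A.mix l θ (A.projRow l a θ' + (ω - A.projRow l a ω)))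
      ∂(stdGaussian A.Param) ≤ R by
    refine (lintegral_mono h).trans ?_
    simp
  intro θ'
  set θ₁ := A.mix l θ θ' with hθ₁
  set u : Fin (A.width (l + 1)) → ℝ := fun k => A.gate θ₁ x l k * A.back θ₁ x (l + 1) k with hu
  have hw : ∀ ω, ∀ l' ≠ l, A.weight θ₁ l'
      = A.weight (A.mix l θ (A.projRow l a θ' + (ω - A.projRow l a ω))) l' := by
    intro ω l' hl'
    funext i k
    rw [hθ₁, weight_mix, weight_mix, if_neg hl', if_neg hl']
  -- Resampling rows orthogonally to the incoming activations keeps the preactivations, hence all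
  -- gates, the output, and the derivatives above layer `l`.
  have hp : ∀ ω, A.preact θ₁ x l
      = A.preact (A.mix l θ (A.projRow l a θ' + (ω - A.projRow l a ω))) x l := by
    intro ω
    funext i
    rw [hθ₁, preact_mix, preact_mix]
    have h1 := A.sum_weight_resample_mul ha1 θ' ω i
    have h2 : ∀ k, A.act θ x l k = n * a l k := fun k => by simp only [ha]; field_simp
    simp_rw [h2]
    have h3 : ∀ w : Fin (A.width l) → ℝ, ∑ k, w k * (n * a l k) = n * ∑ k, w k * a l k := by
      intro w
      rw [Finset.mul_sum]
      exact Finset.sum_congr rfl fun k _ => by ring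
    rw [h3, h3, h1]
  have hout : ∀ ω k, θ₁ (Sum.inr k)
      = A.mix l θ (A.projRow l a θ' + (ω - A.projRow l a ω)) (Sum.inr k) := fun ω k => by
    rw [hθ₁, mix_inr, mix_inr, if_neg hl.ne, if_neg hl.ne]
  set f : Fin (A.width (l + 1)) → A.Idx := fun k => Sum.inl ⟨⟨l, hl⟩, k, j⟩ with hf
  have hfi : Function.Injective f := fun k k' h => by simpa [hf] using h
  set η := embedVec f u with hη
  set t := a l j * n⁻¹ * A.net θ₁ x with ht
  -- As a function of `ω` the derivative is affine. Its constant part comes from the components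
  -- along the activations and equals `a l j * n⁻¹` times the output by Euler's identity; its linear
  -- part is a Gaussian with deviation at most `l2 u`.
  have hback : ∀ ω, A.back (A.mix l θ (A.projRow l a θ' + (ω - A.projRow l a ω))) x l j
      = t + inner ℝ (η - A.projRow l a η) ω := by
    intro ω
    rw [A.back_of_lt _ x hl, ← A.gate_congr (hw ω) (hp ω),
      ← A.back_congr (hw ω) (hout ω) (hp ω) (Nat.lt_succ_self l)]
    simp only [weight_mix, if_true]
    simp_rw [weight_add, add_mul]
    rw [Finset.sum_add_distrib]
    congr 1
    · simp_rw [weight_projRow]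
      have h1 : ∀ k, (∑ i, A.weight θ' l k i * a l i) = n⁻¹ * A.preact θ₁ x l k := by
        intro k
        rw [hθ₁, preact_mix, Finset.mul_sum]
        exact Finset.sum_congr rfl fun i _ => by simp only [ha]; ring
      rw [ht, ← A.sum_back_mul_act θ₁ x (Nat.succ_le_of_lt hl), Finset.mul_sum]
      refine Finset.sum_congr rfl fun k _ => ?_
      rw [h1, act_succ_eq_gate_mul]
      ring
    · rw [real_inner_comm, ← inner_sub_projRow, hη, inner_embedVec]
      refine Finset.sum_congr rfl fun k _ => ?_
      rw [weight, dif_pos hl, mul_comm]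
  -- Neither quantity depends on `ω`, so membership in the controlled set is decided before the
  -- resampling is integrated.
  by_cases hcond : |A.net θ₁ x| ≤ C₁ ∧ l2 u ≤ C₂
  · refine le_trans (lintegral_mono fun ω => ?_) (lintegral_add_inner_pow_four_le
      (η - A.projRow l a η) (t := t) (C := C₂) (D := C₁ / c) ?_ ?_)
    · refine (Set.indicator_le_self _ _ _).trans_eq ?_
      rw [hback]
    · have hC₁ : 0 ≤ C₁ := (abs_nonneg _).trans hcond.1
      rw [ht, abs_mul, abs_mul, abs_of_pos (inv_pos.2 hn0)]
      calc |a l j| * n⁻¹ * |A.net θ₁ x| ≤ 1 * c⁻¹ * C₁ := by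
            have := hcond.1
            gcongr
        _ = C₁ / c := by ring
    · refine (A.norm_sub_projRow_le ha1 η).trans ?_
      refine le_trans (le_of_eq ?_) hcond.2
      refine (sq_eq_sq₀ (norm_nonneg _) (l2_nonneg _)).1 ?_
      rw [hη, norm_embedVec_sq hfi, l2_sq]
  · have h0 : ∀ ω, Φ (A.mix l θ (A.projRow l a θ' + (ω - A.projRow l a ω))) = 0 := by
      intro ω
      refine Set.indicator_of_notMem (fun hmem => hcond ⟨?_, ?_⟩) _
      · rw [A.net_congr (hw ω) (hout ω) (hp ω)]
        exact hmem.1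
      · rw [hu, A.gate_congr (hw ω) (hp ω),
          A.back_congr (hw ω) (hout ω) (hp ω) (Nat.lt_succ_self l)]
        exact hmem.2.2
    simp [h0]

/-- The initial output is bounded in probability. -/
theorem measure_net_gt_le (x : A.Input) {C R : ℝ} (hR : 0 < R) :
    stdGaussian A.Param {θ | l2 (A.act θ x A.depth) ≤ C ∧ R < |A.net θ x|}
      ≤ ENNReal.ofReal ((C / R) ^ 4) * ∫⁻ t, ENNReal.ofReal (t ^ 4) ∂(gaussianReal 0 1) := by
  set S := {θ : A.Param | l2 (A.act θ x A.depth) ≤ C ∧ R < |A.net θ x|} with hS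
  have h1 : Measurable fun θ => A.net θ x := (A.continuous_net_left x).measurable
  have h2 : Measurable fun θ : A.Param => l2 (A.act θ x A.depth) :=
    measurable_l2 fun k => A.measurable_act_left x A.depth k
  have hSm : MeasurableSet S := (measurableSet_le h2 measurable_const).inter
    (measurableSet_lt measurable_const (continuous_abs.measurable.comp h1))
  rw [← lintegral_indicator_one hSm, A.lintegral_mix A.depth (measurable_one.indicator hSm)]
  suffices h : ∀ θ, ∫⁻ θ', S.indicator 1 (A.mix A.depth θ θ') ∂(stdGaussian A.Param)
      ≤ ENNReal.ofReal ((C / R) ^ 4) * ∫⁻ t, ENNReal.ofReal (t ^ 4) ∂(gaussianReal 0 1) by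
    refine (lintegral_mono h).trans ?_
    simp
  intro θ
  set n := l2 (A.act θ x A.depth) with hn
  have hn0 : 0 ≤ n := l2_nonneg _
  have hact := fun θ' => A.act_mix_of_le A.depth θ θ' x A.depth le_rfl
  by_cases hnC : n ≤ C
  -- Markov's inequality for the fourth power: given the hidden layers, the output is a centred
  -- Gaussian with deviation `n ≤ C`.
  · calc ∫⁻ θ', S.indicator 1 (A.mix A.depth θ θ') ∂(stdGaussian A.Param)
        ≤ ∫⁻ θ' : A.Param, ENNReal.ofReal
            ((R⁻¹ * ∑ k, θ' (Sum.inr k) * A.act θ x A.depth k) ^ 4) ∂(stdGaussian A.Param) := by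
          refine lintegral_mono fun θ' => ?_
          by_cases hmem : A.mix A.depth θ θ' ∈ S
          · rw [Set.indicator_of_mem hmem, Pi.one_apply, ← ENNReal.ofReal_one]
            refine ENNReal.ofReal_le_ofReal ?_
            have h3 := hmem.2
            simp only [net, mix_inr, if_true, hact] at h3
            rw [← (show Even 4 by decide).pow_abs, abs_mul, abs_of_pos (inv_pos.2 hR)]
            refine one_le_pow₀ ?_
            rw [inv_mul_eq_div, one_le_div hR]
            exact h3.le
          · rw [Set.indicator_of_notMem hmem]
            exact zero_le
      _ = ∫⁻ t, ENNReal.ofReal ((R⁻¹ * (n * t)) ^ 4) ∂(gaussianReal 0 1) :=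
          A.lintegral_output_sum _ (φ := fun y => ENNReal.ofReal ((R⁻¹ * y) ^ 4)) (by fun_prop)
      _ ≤ _ := by
          rw [← lintegral_const_mul _ (by fun_prop)]
          refine lintegral_mono fun t => ?_
          have hC : 0 ≤ C := hn0.trans hnC
          rw [← ENNReal.ofReal_mul (by positivity)]
          refine ENNReal.ofReal_le_ofReal ?_
          rw [← mul_assoc, mul_pow, inv_mul_eq_div]
          refine mul_le_mul_of_nonneg_right ?_ (by positivity)
          gcongr
  · have h0 : ∀ θ', S.indicator (1 : A.Param → ENNReal) (A.mix A.depth θ θ') = 0 := by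
      intro θ'
      refine Set.indicator_of_notMem (fun hmem => hnC ?_) _
      have := hmem.1
      rwa [hact] at this
    simp [h0]

/-- Preactivations are rarely small. -/
theorem lintegral_small_preact_le (x : A.Input) {l : ℕ} (hl : l < A.depth)
    (j : Fin (A.width (l + 1))) {c τ : ℝ} (hc : 0 < c) :
    ∫⁻ θ, {θ | c ≤ l2 (A.act θ x l)}.indicator
        (fun θ => ENNReal.ofReal (if |A.preact θ x l j| ≤ τ then 1 else 0)) θ
        ∂(stdGaussian A.Param) ≤ ENNReal.ofReal (τ / c) := by
  have hpm := A.measurable_preact_left x l j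
  have hite : Measurable fun y : ℝ => ENNReal.ofReal (if |y| ≤ τ then 1 else 0) := by
    refine ENNReal.measurable_ofReal.comp (Measurable.ite ?_ measurable_const measurable_const)
    exact measurableSet_le (by fun_prop) measurable_const
  set Φ : A.Param → ENNReal := {θ | c ≤ l2 (A.act θ x l)}.indicator
        (fun θ => ENNReal.ofReal (if |A.preact θ x l j| ≤ τ then 1 else 0)) with hΦ
  have hΦm : Measurable Φ := by
    refine Measurable.indicator (hite.comp hpm) (measurableSet_le measurable_const ?_)
    exact measurable_l2 fun k => A.measurable_act_left x l k
  rw [A.lintegral_mix l hΦm]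
  suffices h : ∀ θ, ∫⁻ θ', Φ (A.mix l θ θ') ∂(stdGaussian A.Param) ≤ ENNReal.ofReal (τ / c) by
    refine (lintegral_mono h).trans ?_
    simp
  intro θ
  set n := l2 (A.act θ x l) with hn
  rcases lt_or_ge n c with hnc | hnc
  · have h0 : ∀ θ', Φ (A.mix l θ θ') = 0 := by
      intro θ'
      refine Set.indicator_of_notMem (fun hmem => ?_) _
      have : c ≤ l2 (A.act (A.mix l θ θ') x l) := hmem
      rw [A.act_mix_of_le l θ θ' x l le_rfl] at this
      exact absurd this (not_le.2 hnc)
    simp [h0]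
  have hn0 : 0 < n := hc.trans_le hnc
  -- Given the lower layers, the preactivation is a centred Gaussian with deviation `n ≥ c`.
  calc ∫⁻ θ', Φ (A.mix l θ θ') ∂(stdGaussian A.Param)
      ≤ ∫⁻ θ', ENNReal.ofReal (if |∑ k, A.weight θ' l j k * A.act θ x l k| ≤ τ then 1 else 0)
          ∂(stdGaussian A.Param) := lintegral_mono fun θ' => by
        refine (Set.indicator_le_self _ _ _).trans_eq ?_
        rw [preact_mix]
    _ = ∫⁻ t, ENNReal.ofReal (if |n * t| ≤ τ then 1 else 0) ∂(gaussianReal 0 1) :=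
        A.lintegral_weight_mulVec hl j _ hite
    _ ≤ ∫⁻ t, {t : ℝ | |t| ≤ τ / c}.indicator 1 t ∂(gaussianReal 0 1) := by
        refine lintegral_mono fun t => ?_
        split_ifs with h
        · rw [Set.indicator_of_mem]
          · simp
          · rw [abs_mul, abs_of_pos hn0] at h
            change |t| ≤ τ / c
            rw [le_div_iff₀ hc, mul_comm]
            exact (mul_le_mul_of_nonneg_right hnc (abs_nonneg t)).trans h
        · simp
    _ ≤ ENNReal.ofReal (τ / c) := by
        rw [lintegral_indicator_one (measurableSet_le (by fun_prop) measurable_const)]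
        exact gaussianReal_abs_le_le _

/-- The activations do not collapse from one layer to the next. -/
theorem measure_preact_collapse_le (x : A.Input) {l : ℕ} (hl : l < A.depth) {c q : ℝ} (hc : 0 < c) :
    stdGaussian A.Param {θ | c ≤ l2 (A.act θ x l) ∧
        ∑ j, max (A.preact θ x l j) 0 ^ 2 < q * c ^ 2 * A.width (l + 1)}
      ≤ (∫⁻ t, ENNReal.ofReal (Real.exp (q - max t 0 ^ 2)) ∂(gaussianReal 0 1))
        ^ A.width (l + 1) := by
  set S := {θ : A.Param | c ≤ l2 (A.act θ x l) ∧
        ∑ j, max (A.preact θ x l j) 0 ^ 2 < q * c ^ 2 * A.width (l + 1)} with hS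
  set ρ := ∫⁻ t, ENNReal.ofReal (Real.exp (q - max t 0 ^ 2)) ∂(gaussianReal 0 1) with hρ
  have hSm : MeasurableSet S := by
    have h1 := fun j => A.measurable_preact_left x l j
    have h2 : Measurable fun θ : A.Param => ∑ j, max (A.preact θ x l j) 0 ^ 2 := by fun_prop
    have h3 : Measurable fun θ : A.Param => l2 (A.act θ x l) :=
      measurable_l2 fun k => A.measurable_act_left x l k
    exact (measurableSet_le measurable_const h3).inter (measurableSet_lt h2 measurable_const)
  rw [← lintegral_indicator_one hSm, A.lintegral_mix l (measurable_one.indicator hSm)]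
  suffices h : ∀ θ, ∫⁻ θ', S.indicator 1 (A.mix l θ θ') ∂(stdGaussian A.Param)
      ≤ ρ ^ A.width (l + 1) by
    refine (lintegral_mono h).trans ?_
    simp
  intro θ
  set n := l2 (A.act θ x l) with hn
  rcases lt_or_ge n c with hnc | hnc
  · have h0 : ∀ θ', S.indicator (1 : A.Param → ENNReal) (A.mix l θ θ') = 0 := by
      intro θ'
      refine Set.indicator_of_notMem (fun hmem => ?_) _
      have := hmem.1
      rw [A.act_mix_of_le l θ θ' x l le_rfl] at this
      exact absurd this (not_le.2 hnc)
    simp [h0]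
  have hφ : Measurable fun y : ℝ => ENNReal.ofReal (Real.exp (q - max (y / c) 0 ^ 2)) := by fun_prop
  -- A Chernoff bound: given the lower layers, the preactivations are independent Gaussians with
  -- deviation `n ≥ c`, and the exponential dominates the indicator.
  calc ∫⁻ θ', S.indicator 1 (A.mix l θ θ') ∂(stdGaussian A.Param)
      ≤ ∫⁻ θ', ∏ j, ENNReal.ofReal (Real.exp
          (q - max ((∑ k, A.weight θ' l j k * A.act θ x l k) / c) 0 ^ 2)) ∂(stdGaussian A.Param) := by
        refine lintegral_mono fun θ' => ?_
        refine Set.indicator_le' (s := S) (f := 1) (g := fun θ₁ : A.Param =>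
          ∏ j, ENNReal.ofReal (Real.exp (q - max (A.preact θ₁ x l j / c) 0 ^ 2))) ?_ ?_
          (A.mix l θ θ') |>.trans_eq ?_
        · intro θ₁ h₁
          rw [← ENNReal.ofReal_prod_of_nonneg fun j _ => (Real.exp_pos _).le, ← Real.exp_sum,
            Pi.one_apply, ← ENNReal.ofReal_one]
          apply ENNReal.ofReal_le_ofReal
          rw [Real.one_le_exp_iff, Finset.sum_sub_distrib]
          have h2 : ∀ y : ℝ, max (y / c) 0 ^ 2 = max y 0 ^ 2 / c ^ 2 := fun y => by
            rw [← div_pow]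
            congr 1
            have := max_div_div_right hc.le y 0
            rwa [zero_div] at this
          simp_rw [h2]
          rw [← Finset.sum_div]
          have h3 := h₁.2
          simp only [Finset.sum_const, Finset.card_univ, Fintype.card_fin, nsmul_eq_mul]
          rw [sub_nonneg, div_le_iff₀ (by positivity)]
          nlinarith
        · intro θ₁ _
          exact zero_le
        · simp only [preact_mix]
    _ = (∫⁻ t, ENNReal.ofReal (Real.exp (q - max (n * t / c) 0 ^ 2)) ∂(gaussianReal 0 1))
          ^ A.width (l + 1) := A.lintegral_prod_weight_mulVec hl _ hφ
    _ ≤ ρ ^ A.width (l + 1) := by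
        refine pow_le_pow_left' (lintegral_mono fun t =>
          ENNReal.ofReal_le_ofReal (Real.exp_le_exp.2 ?_)) _
        refine sub_le_sub_left (pow_le_pow_left₀ (le_max_right _ _) ?_ 2) q
        rcases le_or_gt 0 t with ht | ht
        · refine max_le_max ?_ le_rfl
          rw [le_div_iff₀ hc, mul_comm]
          gcongr
        · rw [max_eq_right ht.le]
          exact le_max_right _ _

theorem lintegral_exp_output_eq {b : ℝ} :
    ∫⁻ θ : A.Param, ENNReal.ofReal (Real.exp (b * l2 (fun k => θ (Sum.inr k)) ^ 2))
        ∂(stdGaussian A.Param)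
      = (∫⁻ t, ENNReal.ofReal (Real.exp (b * t ^ 2)) ∂(gaussianReal 0 1)) ^ A.width A.depth := by
  rw [← A.lintegral_prod_output (φ := fun t => ENNReal.ofReal (Real.exp (b * t ^ 2))) (by fun_prop)]
  refine lintegral_congr fun θ => ?_
  rw [← ENNReal.ofReal_prod_of_nonneg fun j _ => (Real.exp_pos _).le, ← Real.exp_sum, l2_sq,
    Finset.mul_sum]

theorem measure_output_gt_le {b T : ℝ} (hb : 0 < b) (hT : 0 ≤ T) :
    stdGaussian A.Param {θ | T < l2 (fun k => θ (Sum.inr k))}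
      ≤ ENNReal.ofReal (Real.exp (-(b * T ^ 2)))
        * (∫⁻ t, ENNReal.ofReal (Real.exp (b * t ^ 2)) ∂(gaussianReal 0 1)) ^ A.width A.depth := by
  rw [← lintegral_exp_output_eq]
  have hm : Measurable fun θ : A.Param =>
      ENNReal.ofReal (Real.exp (b * l2 (fun k => θ (Sum.inr k)) ^ 2)) := by
    have : Measurable fun θ : A.Param => l2 (fun k => θ (Sum.inr k)) :=
      measurable_l2 fun k => by fun_prop
    fun_prop
  have h1 := mul_meas_ge_le_lintegral (μ := stdGaussian A.Param) hm
    (ENNReal.ofReal (Real.exp (b * T ^ 2)))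
  have h2 : {θ : A.Param | T < l2 (fun k => θ (Sum.inr k))} ⊆ {θ | ENNReal.ofReal
      (Real.exp (b * T ^ 2)) ≤ ENNReal.ofReal (Real.exp (b * l2 (fun k => θ (Sum.inr k)) ^ 2))} := by
    intro θ hθ
    refine ENNReal.ofReal_le_ofReal (Real.exp_le_exp.2 ?_)
    have : T < l2 (fun k => θ (Sum.inr k)) := hθ
    gcongr
  calc stdGaussian A.Param {θ | T < l2 (fun k => θ (Sum.inr k))}
      = ENNReal.ofReal (Real.exp (-(b * T ^ 2))) * (ENNReal.ofReal (Real.exp (b * T ^ 2))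
        * stdGaussian A.Param {θ | T < l2 (fun k => θ (Sum.inr k))}) := by
        rw [← mul_assoc, ← ENNReal.ofReal_mul (Real.exp_pos _).le, ← Real.exp_add]
        simp
    _ ≤ _ := by
        gcongr
        exact (mul_le_mul_right (measure_mono h2) _).trans h1

theorem lintegral_exp_weight_mulVec_le {l : ℕ} (hl : l < A.depth) (v : Fin (A.width l) → ℝ)
    {b r : ℝ} (hb : 0 < b) (hr : 0 < r) (hv : l2 v ≤ r) :
    ∫⁻ θ : A.Param, ENNReal.ofReal (Real.exp
        (b / r ^ 2 * l2 (fun j => ∑ k, A.weight θ l j k * v k) ^ 2)) ∂(stdGaussian A.Param)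
      ≤ (∫⁻ t, ENNReal.ofReal (Real.exp (b * t ^ 2)) ∂(gaussianReal 0 1)) ^ A.width (l + 1) := by
  have h1 : ∀ θ : A.Param, ENNReal.ofReal (Real.exp
        (b / r ^ 2 * l2 (fun j => ∑ k, A.weight θ l j k * v k) ^ 2))
      = ∏ j, ENNReal.ofReal (Real.exp (b / r ^ 2 * (∑ k, A.weight θ l j k * v k) ^ 2)) := by
    intro θ
    rw [← ENNReal.ofReal_prod_of_nonneg fun j _ => (Real.exp_pos _).le, ← Real.exp_sum, l2_sq,
      Finset.mul_sum]
  simp_rw [h1]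
  rw [A.lintegral_prod_weight_mulVec hl v
    (φ := fun y => ENNReal.ofReal (Real.exp (b / r ^ 2 * y ^ 2))) (by fun_prop)]
  refine pow_le_pow_left' (lintegral_mono fun t =>
    ENNReal.ofReal_le_ofReal (Real.exp_le_exp.2 ?_)) _
  rw [mul_pow, ← mul_assoc]
  refine mul_le_mul_of_nonneg_right ?_ (sq_nonneg t)
  rw [div_mul_eq_mul_div, div_le_iff₀ (by positivity)]
  have := l2_nonneg v
  gcongr

/-- The operator norms of Gaussian weight matrices, by a volume argument. -/
theorem measure_weight_opNorm_gt_le {l : ℕ} (hl : l < A.depth) {b T : ℝ} (hb : 0 < b)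
    (hT : 0 ≤ T) :
    stdGaussian A.Param {θ | ∃ v, T * l2 v < l2 (fun j => ∑ k, A.weight θ l j k * v k)}
      ≤ ENNReal.ofReal (Real.exp (-(b / 16 * T ^ 2))) * (ENNReal.ofReal (8 ^ A.width l)
        * (∫⁻ t, ENNReal.ofReal (Real.exp (b * t ^ 2)) ∂(gaussianReal 0 1)) ^ A.width (l + 1)) := by
  set I := ∫⁻ t, ENNReal.ofReal (Real.exp (b * t ^ 2)) ∂(gaussianReal 0 1) with hI
  -- Averaging an exponential of the squared norm of the image over the ball of radius 2 replaces a
  -- union bound over a net.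
  set F : A.Param → EuclideanSpace ℝ (Fin (A.width l)) → ENNReal := fun θ v => ENNReal.ofReal (Real.exp
    (b / 2 ^ 2 * l2 (fun j => ∑ k, A.weight θ l j k * v k) ^ 2)) with hF
  have hFm : Measurable fun p : A.Param × EuclideanSpace ℝ (Fin (A.width l)) => F p.1 p.2 := by
    have : Measurable fun p : A.Param × EuclideanSpace ℝ (Fin (A.width l)) => l2 (fun j => ∑ k, A.weight p.1 l j k * p.2 k) := by
      refine measurable_l2 fun j => ?_
      have h1 : ∀ k, Measurable fun p : A.Param × EuclideanSpace ℝ (Fin (A.width l)) => A.weight p.1 l j k := fun k =>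
        (A.measurable_weight l j k).comp measurable_fst
      fun_prop
    fun_prop
  set vol₀ := volume (Metric.ball (0 : EuclideanSpace ℝ (Fin (A.width l))) 1) with hvol₀
  have hball : ∀ (v : EuclideanSpace ℝ (Fin (A.width l))) (r : ℝ), 0 < r → volume (Metric.ball v r)
      = ENNReal.ofReal (r ^ A.width l) * vol₀ := by
    intro v r hr
    rw [Measure.addHaar_ball_of_pos _ _ hr]
    simp [hvol₀]
  have hvpos : vol₀ ≠ 0 := (Metric.measure_ball_pos _ _ one_pos).ne'
  have hvfin : vol₀ ≠ ⊤ := measure_ball_lt_top.ne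
  set e := ENNReal.ofReal (Real.exp (b / 16 * T ^ 2)) with he
  set Bd := {θ : A.Param | ∃ v, T * l2 v < l2 (fun j => ∑ k, A.weight θ l j k * v k)} with hBd
  -- Some vector of the unit ball is stretched by more than `3 / 4` of the norm, and moving by less
  -- than `1 / 4` costs at most `1 / 4` of it. So all images from a ball of radius `1 / 4` have
  -- length at least `T / 2`, whence the exponent `b / 16`; the ratio of the radii 2 and `1 / 4`
  -- gives the base 8.
  have hlow : ∀ θ ∈ Bd, e * (ENNReal.ofReal ((1 / 4) ^ A.width l) * vol₀)
      ≤ ∫⁻ v in Metric.ball (0 : EuclideanSpace ℝ (Fin (A.width l))) 2, F θ v := by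
    rintro θ ⟨v₀, hv₀⟩
    set Wl : EuclideanSpace ℝ (Fin (A.width l)) →ₗ[ℝ] EuclideanSpace ℝ (Fin (A.width (l + 1))) :=
      { toFun := fun v => WithLp.toLp 2 fun j => ∑ k, A.weight θ l j k * v k
        map_add' := fun v w => by
          ext j
          simp [mul_add, Finset.sum_add_distrib]
        map_smul' := fun a v => by
          ext j
          simp only [PiLp.smul_apply, smul_eq_mul, RingHom.id_apply, Finset.mul_sum]
          exact Finset.sum_congr rfl fun k _ => by ring } with hWl
    set W := LinearMap.toContinuousLinearMap Wl with hW
    have hWT : T < ‖W‖ := by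
      by_contra hcon
      have h1 := W.le_of_opNorm_le (not_lt.1 hcon) (WithLp.toLp 2 v₀)
      exact absurd hv₀ (not_lt.2 h1)
    obtain ⟨v, hv1, hv⟩ := W.exists_lt_apply_of_lt_opNorm
      (r := 3 / 4 * ‖W‖) (by linarith [hT.trans_lt hWT])
    have hsub : Metric.ball v (1 / 4) ⊆ Metric.ball (0 : EuclideanSpace ℝ (Fin (A.width l))) 2 := by
      intro w hw
      rw [Metric.mem_ball, dist_eq_norm] at hw
      rw [mem_ball_zero_iff]
      have : ‖w‖ ≤ ‖w - v‖ + ‖v‖ := by simpa using norm_add_le (w - v) v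
      linarith
    have hlarge : ∀ w ∈ Metric.ball v (1 / 4), e ≤ F θ w := by
      intro w hw
      rw [Metric.mem_ball, dist_eq_norm] at hw
      have h1 : ‖W v‖ ≤ ‖W w‖ + ‖W‖ * (1 / 4) := by
        have h2 : W v = W w - W (w - v) := by rw [map_sub]; abel
        rw [h2]
        refine (norm_sub_le _ _).trans (add_le_add le_rfl ?_)
        exact (W.le_opNorm _).trans (mul_le_mul_of_nonneg_left hw.le (norm_nonneg _))
      have h3 : T / 2 ≤ ‖W w‖ := by linarith
      refine ENNReal.ofReal_le_ofReal (Real.exp_le_exp.2 ?_)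
      have h4 : l2 (fun j => ∑ k, A.weight θ l j k * w k) = ‖W w‖ := rfl
      rw [h4]
      calc b / 16 * T ^ 2 = b / 2 ^ 2 * (T / 2) ^ 2 := by ring
        _ ≤ b / 2 ^ 2 * ‖W w‖ ^ 2 := by gcongr
    calc e * (ENNReal.ofReal ((1 / 4) ^ A.width l) * vol₀)
        = ∫⁻ _w in Metric.ball v (1 / 4), e := by
          rw [setLIntegral_const, hball v _ (by norm_num)]
      _ ≤ ∫⁻ w in Metric.ball v (1 / 4), F θ w :=
          setLIntegral_mono' measurableSet_ball hlarge
      _ ≤ _ := lintegral_mono_set hsub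
  have hup : ∫⁻ θ, (∫⁻ v in Metric.ball (0 : EuclideanSpace ℝ (Fin (A.width l))) 2, F θ v)
      ∂(stdGaussian A.Param)
      ≤ I ^ A.width (l + 1) * (ENNReal.ofReal (2 ^ A.width l) * vol₀) := by
    rw [lintegral_lintegral_swap hFm.aemeasurable]
    calc _ ≤ ∫⁻ _v in Metric.ball (0 : EuclideanSpace ℝ (Fin (A.width l))) 2,
          I ^ A.width (l + 1) :=
          setLIntegral_mono' measurableSet_ball fun v hv =>
            A.lintegral_exp_weight_mulVec_le hl _ hb two_pos (mem_ball_zero_iff.1 hv).le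
      _ = _ := by rw [setLIntegral_const, hball 0 2 two_pos]
  have hmark := mul_meas_ge_le_lintegral (μ := stdGaussian A.Param)
    (f := fun θ => ∫⁻ v in Metric.ball (0 : EuclideanSpace ℝ (Fin (A.width l))) 2, F θ v) hFm.lintegral_prod_right'
    (e * (ENNReal.ofReal ((1 / 4) ^ A.width l) * vol₀))
  have hmain : e * (ENNReal.ofReal ((1 / 4) ^ A.width l) * vol₀) * stdGaussian A.Param Bd
      ≤ I ^ A.width (l + 1) * (ENNReal.ofReal (2 ^ A.width l) * vol₀) :=
    (mul_le_mul_right (measure_mono hlow) _).trans (hmark.trans hup)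
  have hmain2 : e * ENNReal.ofReal ((1 / 4) ^ A.width l) * stdGaussian A.Param Bd
      ≤ I ^ A.width (l + 1) * ENNReal.ofReal (2 ^ A.width l) := by
    refine (ENNReal.mul_le_mul_iff_left hvpos hvfin).1 ?_
    calc _ = e * (ENNReal.ofReal ((1 / 4) ^ A.width l) * vol₀) * stdGaussian A.Param Bd := by ring
      _ ≤ _ := hmain
      _ = _ := by ring
  calc stdGaussian A.Param Bd
      = (ENNReal.ofReal (Real.exp (-(b / 16 * T ^ 2))) * e)
        * (ENNReal.ofReal (4 ^ A.width l) * ENNReal.ofReal ((1 / 4) ^ A.width l))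
        * stdGaussian A.Param Bd := by
        rw [he, ← ENNReal.ofReal_mul (Real.exp_pos _).le, ← Real.exp_add,
          ← ENNReal.ofReal_mul (by positivity), ← mul_pow]
        simp
    _ = ENNReal.ofReal (Real.exp (-(b / 16 * T ^ 2))) * ENNReal.ofReal (4 ^ A.width l)
        * (e * ENNReal.ofReal ((1 / 4) ^ A.width l) * stdGaussian A.Param Bd) := by ring
    _ ≤ ENNReal.ofReal (Real.exp (-(b / 16 * T ^ 2))) * ENNReal.ofReal (4 ^ A.width l)
        * (I ^ A.width (l + 1) * ENNReal.ofReal (2 ^ A.width l)) := by gcongr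
    _ = _ := by
        have : (8 : ℝ) ^ A.width l = 4 ^ A.width l * 2 ^ A.width l := by
          rw [← mul_pow]
          norm_num
        rw [this, ENNReal.ofReal_mul (by positivity)]
        ring

end Arch

end

/-! ### The largest remainder on the ball, a majorant for every subfamily. -/

noncomputable section

/-- All cancellation between signs is given up; for the limit of infinite width the size of the
remainder suffices. -/
theorem rademacher_le {N : ℕ} {V : Set (Fin N → ℝ)} (hV : V.Nonempty) {b : Fin N → ℝ}
    (hb : ∀ a ∈ V, ∀ i, |a i| ≤ b i) : rademacher V ≤ (1 / (N : ℝ)) * ∑ i, b i := by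
  rw [rademacher, div_le_iff₀ (by positivity)]
  refine (Finset.sum_le_card_nsmul _ _ ((1 / (N : ℝ)) * ∑ i, b i) fun σ _ => ?_).trans_eq ?_
  · refine csSup_le (hV.image _) ?_
    rintro _ ⟨a, ha, rfl⟩
    refine mul_le_mul_of_nonneg_left (Finset.sum_le_sum fun i _ => ?_) (by positivity)
    refine (le_abs_self _).trans ?_
    rw [abs_mul]
    have : |((σ i : ℤ) : ℝ)| = 1 := by
      rcases Int.units_eq_one_or (σ i) with h | h <;> simp [h]
    rw [this, one_mul]
    exact hb a ha i
  · simp [mul_comm]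

theorem rademacher_empty {N : ℕ} : rademacher (∅ : Set (Fin N → ℝ)) = 0 := by
  simp [rademacher]

namespace Arch

variable (A : Arch)

/-- The largest Taylor remainder at `x` for parameters in the ball around `θ₀`. -/
def maxRemainder (ε : ℝ) (θ₀ : A.Param) (x : A.Input) : ENNReal :=
  ⨆ Δ : Metric.ball (0 : A.Param) ε, ENNReal.ofReal |A.remainder θ₀ (θ₀ + Δ) x|

theorem measurable_maxRemainder {ε : ℝ} (hε : 0 < ε) :
    Measurable fun p : A.Param × A.Input => A.maxRemainder ε p.1 p.2 := by
  have : Nonempty (Metric.ball (0 : A.Param) ε) := ⟨⟨0, Metric.mem_ball_self hε⟩⟩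
  -- Working with increments instead of endpoints lets one dense sequence serve all initial
  -- parameters, so the supremum is jointly measurable.
  obtain ⟨u, hu⟩ := TopologicalSpace.exists_dense_seq (Metric.ball (0 : A.Param) ε)
  have h : ∀ p : A.Param × A.Input, A.maxRemainder ε p.1 p.2
      = ⨆ n, ENNReal.ofReal |A.remainder p.1 (p.1 + u n) p.2| := by
    intro p
    refine le_antisymm (iSup_le fun Δ => ?_) (iSup_le fun n => le_iSup
      (fun Δ : Metric.ball (0 : A.Param) ε =>
        ENNReal.ofReal |A.remainder p.1 (p.1 + Δ) p.2|) (u n))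
    refine hu.induction_on (p := fun Δ : Metric.ball (0 : A.Param) ε =>
      ENNReal.ofReal |A.remainder p.1 (p.1 + Δ) p.2|
        ≤ ⨆ n, ENNReal.ofReal |A.remainder p.1 (p.1 + u n) p.2|) Δ
      (isClosed_le ?_ continuous_const) fun n => le_iSup
        (fun n => ENNReal.ofReal |A.remainder p.1 (p.1 + u n) p.2|) n
    have := (A.continuous_remainder p.1 p.2).comp
      (by fun_prop : Continuous fun Δ : Metric.ball (0 : A.Param) ε => p.1 + (Δ : A.Param))
    exact ENNReal.continuous_ofReal.comp (continuous_abs.comp this)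
  simp_rw [h]
  refine Measurable.iSup fun n => ?_
  exact ENNReal.measurable_ofReal.comp
    (continuous_abs.measurable.comp (A.measurable_remainder_add (u n)))

theorem ofReal_abs_remainder_le {ε : ℝ} {θ₀ θ : A.Param} (hθ : θ ∈ Metric.ball θ₀ ε)
    (x : A.Input) : ENNReal.ofReal |A.remainder θ₀ θ x| ≤ A.maxRemainder ε θ₀ x := by
  have h : θ - θ₀ ∈ Metric.ball (0 : A.Param) ε := by
    rw [mem_ball_zero_iff, ← dist_eq_norm]
    exact hθ
  have := le_iSup (fun Δ : Metric.ball (0 : A.Param) ε =>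
    ENNReal.ofReal |A.remainder θ₀ (θ₀ + Δ) x|) ⟨θ - θ₀, h⟩
  rwa [add_sub_cancel] at this

theorem maxRemainder_le_ofReal {ε b : ℝ} {θ₀ : A.Param} {x : A.Input}
    (h : ∀ Δ : A.Param, ‖Δ‖ ≤ ε → |A.remainder θ₀ (θ₀ + Δ) x| ≤ b) :
    A.maxRemainder ε θ₀ x ≤ ENNReal.ofReal b :=
  iSup_le fun Δ => ENNReal.ofReal_le_ofReal (h _ (mem_ball_zero_iff.1 Δ.2).le)

theorem exists_maxRemainder_le (ε Kx : ℝ) (θ₀ : A.Param) :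
    ∃ b : ℝ, ∀ x : A.Input, ‖x‖ ≤ Kx → A.maxRemainder ε θ₀ x ≤ ENNReal.ofReal b := by
  obtain ⟨b, hb⟩ := A.exists_abs_remainder_le θ₀ ε Kx
  exact ⟨b, fun x hx => A.maxRemainder_le_ofReal fun Δ hΔ => hb _ (by simpa using hΔ) x hx⟩

/-- Twice the mean over `P` of the largest Taylor remainder in the ball around `θ₀`. -/
def remainderBound (P : Measure (A.Input × ℝ)) (ε : ℝ) (θ₀ : A.Param) : ℝ :=
  (2 * ∫⁻ z, A.maxRemainder ε θ₀ z.1 ∂P).toReal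

theorem measurable_maxRemainder_fst {ε : ℝ} (hε : 0 < ε) (θ₀ : A.Param) :
    Measurable fun z : A.Input × ℝ => A.maxRemainder ε θ₀ z.1 := by
  have h : Measurable fun x : A.Input => A.maxRemainder ε θ₀ x :=
    Measurable.of_uncurry_left (f := fun (θ : A.Param) (x : A.Input) => A.maxRemainder ε θ x)
      (A.measurable_maxRemainder hε)
  exact h.comp measurable_fst

theorem ae_maxRemainder_lt_top (P : Measure (A.Input × ℝ)) {ε Kx : ℝ}
    (hx : ∀ᵐ z ∂P, ‖z.1‖ ≤ Kx) (θ₀ : A.Param) : ∀ᵐ z ∂P, A.maxRemainder ε θ₀ z.1 < ⊤ := by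
  obtain ⟨b, hb⟩ := A.exists_maxRemainder_le ε Kx θ₀
  filter_upwards [hx] with z hz using (hb z.1 hz).trans_lt ENNReal.ofReal_lt_top

theorem integrable_maxRemainder (P : Measure (A.Input × ℝ)) [IsProbabilityMeasure P] {ε Kx : ℝ}
    (hε : 0 < ε) (hx : ∀ᵐ z ∂P, ‖z.1‖ ≤ Kx) (θ₀ : A.Param) :
    Integrable (fun z : A.Input × ℝ => (A.maxRemainder ε θ₀ z.1).toReal) P := by
  obtain ⟨b, hb⟩ := A.exists_maxRemainder_le ε Kx θ₀
  refine Integrable.of_bound (C := |b|)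
    (A.measurable_maxRemainder_fst hε θ₀).ennreal_toReal.aestronglyMeasurable ?_
  filter_upwards [hx] with z hz
  rw [Real.norm_of_nonneg ENNReal.toReal_nonneg]
  exact ENNReal.toReal_le_of_le_ofReal (abs_nonneg b)
    ((hb z.1 hz).trans (ENNReal.ofReal_le_ofReal (le_abs_self b)))

theorem integral_maxRemainder (P : Measure (A.Input × ℝ)) {ε Kx : ℝ}
    (hε : 0 < ε) (hx : ∀ᵐ z ∂P, ‖z.1‖ ≤ Kx) (θ₀ : A.Param) :
    2 * ∫ z, (A.maxRemainder ε θ₀ z.1).toReal ∂P = A.remainderBound P ε θ₀ := by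
  rw [integral_toReal (A.measurable_maxRemainder_fst hε θ₀).aemeasurable
    (A.ae_maxRemainder_lt_top P hx θ₀), remainderBound, ENNReal.toReal_mul]
  rfl

/-- Each coordinate of a sample vector is at most the largest remainder at that input, and the
sample mean of the latter has its mean under `P` as expectation. The bound thus loses all reference
to the data, the loss derivative, the rates and the sample size. -/
theorem two_mul_remainderComplexity_le (P : Measure (A.Input × ℝ)) [IsProbabilityMeasure P]
    {N : ℕ} (hN : 0 < N) {ε Kx : ℝ} (hε : 0 < ε) (hx : ∀ᵐ z ∂P, ‖z.1‖ ≤ Kx) (dℓ : ℝ → ℝ) {n : ℕ}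
    (D : Fin n → A.Input × ℝ) (E : Set (ℕ → ℝ)) (θ₀ : A.Param) (C : ℝ) :
    2 * A.remainderComplexity P N dℓ D E θ₀ C ε ≤ A.remainderBound P ε θ₀ := by
  rcases (A.familyParam dℓ D E θ₀ C ε).eq_empty_or_nonempty with he | hne
  · have h0 : A.remainderComplexity P N dℓ D E θ₀ C ε = 0 := by
      unfold remainderComplexity
      rw [he]
      simp only [Set.image_empty, rademacher_empty, integral_zero]
    rw [h0, mul_zero]
    exact ENNReal.toReal_nonneg
  have hg := A.integrable_maxRemainder P hε hx θ₀
  rw [← A.integral_maxRemainder P hε hx θ₀, ← mean_integral_pi P hN hg]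
  refine mul_le_mul_of_nonneg_left (integral_mono_ae (A.integrable_rademacher_remainder P
    (A.familyParam_subset_closedBall dℓ D E θ₀ C ε) hne hx) ?_ ?_) zero_le_two
  · have hi : ∀ i : Fin N, Integrable (fun s : Fin N → A.Input × ℝ =>
        (A.maxRemainder ε θ₀ (s i).1).toReal) (Measure.pi fun _ => P) := fun i =>
      (measurePreserving_eval (fun _ : Fin N => P) i).integrable_comp_of_integrable hg
    exact (integrable_finsetSum _ fun i _ => hi i).const_mul _
  · filter_upwards [ae_forall_pi P (A.ae_maxRemainder_lt_top P hx θ₀)] with s hs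
    refine rademacher_le (hne.image _) ?_
    rintro _ ⟨θ, hθ, rfl⟩ i
    rw [← ENNReal.ofReal_le_iff_le_toReal (hs i).ne]
    exact A.ofReal_abs_remainder_le hθ.1.2 _

/-- The condition ranges over uncountably many vectors; closedness gives measurability without a
countable reduction. -/
theorem isClosed_weightsBounded (C : ℝ) : IsClosed {θ : A.Param | A.WeightsBounded θ C} := by
  have hl2 : ∀ {ι : Type} [Fintype ι] (f : A.Param → ι → ℝ), (∀ i, Continuous fun θ => f θ i) →
      Continuous fun θ => l2 (f θ) := by
    intro ι _ f hf
    unfold l2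
    fun_prop
  have h1 : {θ : A.Param | A.WeightsBounded θ C}
      = (⋂ (l) (_ : l < A.depth) (v), {θ : A.Param |
          l2 (fun j => ∑ k, A.weight θ l j k * v k) ≤ C * l2 v})
        ∩ {θ : A.Param | l2 (fun k => θ (Sum.inr k)) ≤ C} := by
    ext θ
    simp [WeightsBounded]
  rw [h1]
  refine IsClosed.inter (isClosed_iInter fun l => isClosed_iInter fun _ => isClosed_iInter fun v =>
    isClosed_le (hl2 _ fun j => ?_) continuous_const) (isClosed_le (hl2 _ fun k => ?_)
      continuous_const)
  · have := fun k => A.continuous_weight l j k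
    fun_prop
  · fun_prop

end Arch

end

/-! ### Mean of the largest remainder at a fixed input. -/

noncomputable section

namespace Arch

variable (A : Arch)

theorem measurable_l2_act (x : A.Input) (l : ℕ) :
    Measurable fun θ : A.Param => l2 (A.act θ x l) :=
  measurable_l2 fun k => A.measurable_act_left x l k

/-- The parameters for which the activations of some layer are small. -/
def collapsed (x : A.Input) (c : ℝ) : Set A.Param :=
  {θ | ∃ l ≤ A.depth, l2 (A.act θ x l) < c}

theorem measurableSet_collapsed (x : A.Input) (c : ℝ) : MeasurableSet (A.collapsed x c) := by
  have h : A.collapsed x c = ⋃ (l) (_ : l ≤ A.depth), {θ | l2 (A.act θ x l) < c} := by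
    ext θ
    simp [collapsed]
  rw [h]
  exact MeasurableSet.iUnion fun l => MeasurableSet.iUnion fun _ =>
    measurableSet_lt (A.measurable_l2_act x l) measurable_const

theorem measure_collapsed_le {s : ℝ} (hs0 : 0 < s) (hs : ∀ l, A.scale l = s) {m : ℕ}
    (hm : ∀ l, A.width (l + 1) = m) (hsm : s ^ 2 * m = 1) {x : A.Input} (hx : x ≠ 0) {q : ℝ}
    (hq : 0 < q) (hq1 : q ≤ 1) :
    stdGaussian A.Param (A.collapsed x (‖x‖ * Real.sqrt q ^ A.depth))
      ≤ A.depth * (∫⁻ t, ENNReal.ofReal (Real.exp (q - max t 0 ^ 2)) ∂(gaussianReal 0 1)) ^ m := by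
  set c : ℕ → ℝ := fun l => ‖x‖ * Real.sqrt q ^ l with hc
  have hx0 : 0 < ‖x‖ := norm_pos_iff.2 hx
  have hq0 : 0 < Real.sqrt q := Real.sqrt_pos.2 hq
  have hc0 : ∀ l, 0 < c l := fun l => by positivity
  have hmc : ∀ l, (A.width (l + 1) : ℝ) = m := fun l => by rw [hm]
  set S : ℕ → Set A.Param := fun l => {θ | c l ≤ l2 (A.act θ x l) ∧
        ∑ j, max (A.preact θ x l j) 0 ^ 2 < q * c l ^ 2 * A.width (l + 1)} with hS
  -- If every layer retains a fraction `√q` of the length threshold, all layers stay above `c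
  -- A.depth`, since the thresholds decrease for `q ≤ 1`. A small layer therefore requires a
  -- collapse at some single step.
  have hsub : A.collapsed x (c A.depth) ⊆ ⋃ l ∈ Finset.range A.depth, S l := by
    rintro θ ⟨l, hl, hlt⟩
    by_contra hcon
    have hcon' : ∀ l < A.depth, c l ≤ l2 (A.act θ x l) →
        q * c l ^ 2 * A.width (l + 1) ≤ ∑ j, max (A.preact θ x l j) 0 ^ 2 := by
      intro l hl h1
      by_contra h2
      exact hcon (Set.mem_biUnion (Finset.mem_coe.2 (Finset.mem_range.2 hl)) ⟨h1, not_le.1 h2⟩)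
    have hind : ∀ l ≤ A.depth, c l ≤ l2 (A.act θ x l) := by
      intro l
      induction l with
      | zero =>
        intro _
        simp only [hc, pow_zero, mul_one]
        exact le_rfl
      | succ l ih =>
        intro hl
        have h1 := hcon' l hl (ih (by omega))
        refine le_of_sq_le_sq ?_ (l2_nonneg _)
        rw [l2_sq]
        simp only [act_succ, hs, mul_pow]
        rw [← Finset.mul_sum]
        rw [hmc] at h1
        calc c (l + 1) ^ 2 = Real.sqrt q ^ 2 * c l ^ 2 := by simp only [hc]; ring
          _ = s ^ 2 * (q * c l ^ 2 * m) := by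
            rw [Real.sq_sqrt hq.le]
            linear_combination (-(q * c l ^ 2)) * hsm
          _ ≤ _ := by gcongr
    have h2 : c A.depth ≤ c l := by
      simp only [hc]
      refine mul_le_mul_of_nonneg_left (pow_le_pow_of_le_one hq0.le ?_ hl) hx0.le
      exact Real.sqrt_le_one.2 hq1
    exact absurd hlt (not_lt.2 (h2.trans (hind l hl)))
  refine (measure_mono hsub).trans ((measure_biUnion_finset_le _ _).trans
    ((Finset.sum_le_card_nsmul _ _ ((∫⁻ t, ENNReal.ofReal (Real.exp (q - max t 0 ^ 2))
      ∂(gaussianReal 0 1)) ^ m) fun l hl => ?_).trans_eq (by simp)))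
  exact (A.measure_preact_collapse_le x (Finset.mem_range.1 hl) (hc0 l) (q := q)).trans_eq
    (by rw [hm])

/-- The parameters with bounded weights and bounded output where the activations of no layer are
small. -/
def regular (x : A.Input) (C c R : ℝ) : Set A.Param :=
  {θ | A.WeightsBounded θ C} ∩ ((A.collapsed x c)ᶜ ∩ {θ | |A.net θ x| ≤ R})

theorem measurable_abs_net (x : A.Input) : Measurable fun θ : A.Param => |A.net θ x| :=
  continuous_abs.measurable.comp (A.continuous_net_left x).measurable

theorem measurableSet_regular (x : A.Input) (C c R : ℝ) : MeasurableSet (A.regular x C c R) :=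
  (A.isClosed_weightsBounded C).measurableSet.inter
    ((A.measurableSet_collapsed x c).compl.inter
      (measurableSet_le (A.measurable_abs_net x) measurable_const))

theorem le_l2_act_of_mem_regular {x : A.Input} {C c R : ℝ} {θ : A.Param}
    (hθ : θ ∈ A.regular x C c R) {l : ℕ} (hl : l ≤ A.depth) : c ≤ l2 (A.act θ x l) :=
  not_lt.1 fun h => hθ.2.1 ⟨l, hl, h⟩

theorem lintegral_regular_small_le (x : A.Input) {l : ℕ} (hl : l < A.depth)
    (j : Fin (A.width (l + 1))) {C c R τ : ℝ} (hc : 0 < c) :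
    ∫⁻ θ, (A.regular x C c R).indicator
        (fun θ => ENNReal.ofReal (if |A.preact θ x l j| ≤ τ then 1 else 0)) θ
        ∂(stdGaussian A.Param) ≤ ENNReal.ofReal (τ / c) :=
  (lintegral_mono fun θ => Set.indicator_le_indicator_of_subset
    (fun _ h => A.le_l2_act_of_mem_regular h hl.le) (fun _ => zero_le) θ).trans
    (A.lintegral_small_preact_le x hl j hc)

theorem lintegral_regular_back_le {s M K : ℝ} (hs : ∀ l, A.scale l = s) (hs0 : 0 ≤ s)
    (hsM : s * M ≤ 1) (hM : 0 ≤ M) (hK : 1 ≤ K) (x : A.Input) {l : ℕ} (hl : l ≤ A.depth)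
    (j : Fin (A.width l)) {c R : ℝ} (hc : 0 < c) :
    ∫⁻ θ, (A.regular x (K * M) c R).indicator
        (fun θ => ENNReal.ofReal (A.back θ x l j ^ 4)) θ ∂(stdGaussian A.Param)
      ≤ ENNReal.ofReal (8 * (R / c) ^ 4) + (ENNReal.ofReal (8 * (K ^ (A.depth + 1)) ^ 4) + 1)
        * ∫⁻ t, ENNReal.ofReal (t ^ 4) ∂(gaussianReal 0 1) := by
  -- At the last layer the derivatives are the output weights themselves, standard Gaussian; the
  -- summand `1` in the coefficient accounts for this case.
  rcases hl.eq_or_lt with rfl | hlt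
  · have h1 : ∫⁻ θ, ENNReal.ofReal (A.back θ x A.depth j ^ 4) ∂(stdGaussian A.Param)
        = ∫⁻ t, ENNReal.ofReal (t ^ 4) ∂(gaussianReal 0 1) := by
      simp only [back_depth]
      exact A.lintegral_output j (φ := fun t => ENNReal.ofReal (t ^ 4)) (by fun_prop)
    refine (lintegral_mono fun θ => Set.indicator_le_self _ _ _).trans (h1.trans_le ?_)
    rw [add_mul, one_mul]
    exact le_add_self.trans le_add_self
  · have hsub : A.regular x (K * M) c R ⊆ A.controlled x l c R (K ^ (A.depth + 1)) := by
      intro θ hθ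
      refine ⟨hθ.2.2, A.le_l2_act_of_mem_regular hθ hl, ?_⟩
      refine (l2_gate_mul_le hs hs0 l _).trans ?_
      calc s * l2 (A.back θ x (l + 1)) ≤ s * (K ^ (A.depth + 1) * M) :=
            mul_le_mul_of_nonneg_left (l2_back_le hs hs0 hsM hM hK hθ.1 hlt) hs0
        _ = (s * M) * K ^ (A.depth + 1) := by ring
        _ ≤ 1 * K ^ (A.depth + 1) := by gcongr
        _ = _ := one_mul _
    calc _ ≤ ∫⁻ θ, (A.controlled x l c R (K ^ (A.depth + 1))).indicator
          (fun θ => ENNReal.ofReal (A.back θ x l j ^ 4)) θ ∂(stdGaussian A.Param) :=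
          lintegral_mono fun θ => Set.indicator_le_indicator_of_subset hsub
            (fun _ => zero_le) θ
      _ ≤ _ := A.lintegral_back_pow_four_le x hlt j hc
      _ ≤ _ := by
          gcongr
          exact le_self_add

/-- The bound of `abs_remainder_le_const`. -/
def remainderConst (L : ℕ) (X ε K : ℝ) : ℝ :=
  ε * incrementBound X ε K L + L * (K ^ (L + 1) * (ε * incrementBound X ε K L)
    + K ^ (L + 1) * incrementBound X ε K L)

theorem maxRemainder_le_const {s M K ε X : ℝ} (hs : ∀ l, A.scale l = s) (hs0 : 0 ≤ s)
    (hs1 : s ≤ 1) (hsM : s * M ≤ 1) (hM : 0 ≤ M) (hK : 1 ≤ K) (hε : 0 ≤ ε) {θ : A.Param}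
    {x : A.Input} (hθ : A.WeightsBounded θ (K * M)) (hX : ‖x‖ ≤ X) :
    A.maxRemainder ε θ x ≤ ENNReal.ofReal (remainderConst A.depth X ε K) :=
  A.maxRemainder_le_ofReal fun _ hΔ => abs_remainder_le_const hs hs0 hs1 hsM hM hK hε hΔ hθ hX

/-- The scales are powers of one small `u` with `s = u ^ 12`, in the application `u = m ^ (-1/24)`:
kink distance `u ^ 8`, Young parameters `κ = u` and `lam = u ^ 6`. They give the coefficients `u ^
29` and `u ^ 17`, and a factor `u` in the remaining terms. -/
theorem maxRemainder_le_flips {u K ε X : ℝ} (hu : 0 < u) (hu1 : u ≤ 1)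
    (hs : ∀ l, A.scale l = u ^ 12) (hK : 1 ≤ K) (hε : 0 ≤ ε) {θ : A.Param} {x : A.Input}
    (hθ : A.WeightsBounded θ (K * (u ^ 12)⁻¹)) (hX : ‖x‖ ≤ X) :
    A.maxRemainder ε θ x ≤ ENNReal.ofReal u
        * ENNReal.ofReal (ε * incrementBound X ε K A.depth)
      + ∑ l ∈ Finset.range A.depth, (ENNReal.ofReal u
          * ENNReal.ofReal (K ^ (A.depth + 1) * (ε * incrementBound X ε K A.depth)
            + incrementBound X ε K A.depth + incrementBound X ε K A.depth ^ 3)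
        + ENNReal.ofReal (incrementBound X ε K A.depth) *
          (ENNReal.ofReal (u ^ 29) * ∑ j, ENNReal.ofReal (A.back θ x (l + 1) j ^ 4)
            + ENNReal.ofReal (u ^ 17)
              * ∑ j, ENNReal.ofReal (if |A.preact θ x l j| ≤ u ^ 8 then (1 : ℝ) else 0))) := by
  set I := incrementBound X ε K A.depth with hI
  have hI0 : 0 ≤ I := incrementBound_nonneg ((norm_nonneg _).trans hX) hε hK _
  have hu12 : u ^ 12 ≤ u := pow_le_of_le_one hu.le hu1 (by norm_num)
  have hK0 : 0 ≤ K := by linarith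
  have hite : ∀ l j, 0 ≤ if |A.preact θ x l j| ≤ u ^ 8 then (1 : ℝ) else 0 := by
    intro l j
    split_ifs <;> norm_num
  have hsite : ∀ l, 0 ≤ ∑ j, if |A.preact θ x l j| ≤ u ^ 8 then (1 : ℝ) else 0 := fun l =>
    Finset.sum_nonneg fun j _ => hite l j
  have hsb : ∀ l, 0 ≤ ∑ j, A.back θ x (l + 1) j ^ 4 := fun l =>
    Finset.sum_nonneg fun j _ => by positivity
  set J := K ^ (A.depth + 1) * (ε * I) + I + I ^ 3 with hJ
  have hJ0 : 0 ≤ J := by positivity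
  have key : A.maxRemainder ε θ x ≤ ENNReal.ofReal (u * (ε * I)
      + ∑ l ∈ Finset.range A.depth, (u * J
        + I * (u ^ 29 * ∑ j, A.back θ x (l + 1) j ^ 4
            + u ^ 17 * ∑ j, if |A.preact θ x l j| ≤ u ^ 8 then (1 : ℝ) else 0))) := by
    refine A.maxRemainder_le_ofReal fun Δ hΔ => ?_
    refine (abs_remainder_le_flips (M := (u ^ 12)⁻¹) (τ := u ^ 8) (κ := u) (lam := u ^ 6) hs
      (by positivity) (hu12.trans hu1)
      (mul_inv_cancel₀ (by positivity)).le (by positivity) hK hε hΔ hθ hX (by positivity) hu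
      (by positivity)).trans ?_
    rw [← hI]
    have h1 : u ^ 12 * I ≤ u * I := by gcongr
    refine add_le_add ?_ (Finset.sum_le_sum fun l _ => ?_)
    · calc ε * (u ^ 12 * I) ≤ ε * (u * I) := by gcongr
        _ = _ := by ring
    · set Sb := ∑ j, A.back θ x (l + 1) j ^ 4
      set Sp := ∑ j, if |A.preact θ x l j| ≤ u ^ 8 then (1 : ℝ) else 0
      have h2 : (u ^ 12) ^ 2 / u * (u ^ 6 * Sb + (Sp + I ^ 2 / (u ^ 8) ^ 2) / u ^ 6)
          = u ^ 29 * Sb + u ^ 17 * Sp + u * I ^ 2 := by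
        field_simp
        ring
      rw [h2]
      calc K ^ (A.depth + 1) * (ε * (u ^ 12 * I)) + I * (u + (u ^ 29 * Sb + u ^ 17 * Sp + u * I ^ 2))
          ≤ K ^ (A.depth + 1) * (ε * (u * I))
            + I * (u + (u ^ 29 * Sb + u ^ 17 * Sp + u * I ^ 2)) := by gcongr
        _ = _ := by rw [hJ]; ring
  refine key.trans_eq ?_
  have hterm : ∀ l, 0 ≤ I * (u ^ 29 * ∑ j, A.back θ x (l + 1) j ^ 4
            + u ^ 17 * ∑ j, if |A.preact θ x l j| ≤ u ^ 8 then (1 : ℝ) else 0) := fun l =>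
    mul_nonneg hI0 (add_nonneg (mul_nonneg (by positivity) (hsb l))
      (mul_nonneg (by positivity) (hsite l)))
  rw [ENNReal.ofReal_add (by positivity) (Finset.sum_nonneg fun l _ =>
    add_nonneg (by positivity) (hterm l)), ENNReal.ofReal_mul hu.le,
    ENNReal.ofReal_sum_of_nonneg fun l _ => add_nonneg (by positivity) (hterm l)]
  congr 1
  refine Finset.sum_congr rfl fun l _ => ?_
  rw [ENNReal.ofReal_add (by positivity) (hterm l), ENNReal.ofReal_mul hu.le,
    ENNReal.ofReal_mul hI0, ENNReal.ofReal_add (mul_nonneg (by positivity) (hsb l))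
      (mul_nonneg (by positivity) (hsite l)), ENNReal.ofReal_mul (by positivity),
    ENNReal.ofReal_mul (by positivity), ENNReal.ofReal_sum_of_nonneg fun j _ => by positivity,
    ENNReal.ofReal_sum_of_nonneg fun j _ => hite l j]

/-- The factor of the rate of convergence of the mean of the largest Taylor remainder. -/
def rateConst (L : ℕ) (X ε K c : ℝ) : ENNReal :=
  ENNReal.ofReal (remainderConst L X ε K) * (ENNReal.ofReal ((K ^ L * X) ^ 4)
      * ∫⁻ t, ENNReal.ofReal (t ^ 4) ∂(gaussianReal 0 1))
    + (ENNReal.ofReal (ε * incrementBound X ε K L)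
      + L * (ENNReal.ofReal (K ^ (L + 1) * (ε * incrementBound X ε K L)
            + incrementBound X ε K L + incrementBound X ε K L ^ 3)
        + ENNReal.ofReal (incrementBound X ε K L) *
          ((ENNReal.ofReal (8 / c ^ 4) + (ENNReal.ofReal (8 * (K ^ (L + 1)) ^ 4) + 1)
            * ∫⁻ t, ENNReal.ofReal (t ^ 4) ∂(gaussianReal 0 1)) + ENNReal.ofReal (1 / c))))

theorem rateConst_lt_top (L : ℕ) (X ε K c : ℝ) : rateConst L X ε K c < ⊤ := by
  have h := lintegral_pow_four_gaussianReal_lt_top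
  unfold rateConst
  refine ENNReal.add_lt_top.2 ⟨ENNReal.mul_lt_top ENNReal.ofReal_lt_top
    (ENNReal.mul_lt_top ENNReal.ofReal_lt_top h), ENNReal.add_lt_top.2 ⟨ENNReal.ofReal_lt_top,
    ENNReal.mul_lt_top (ENNReal.natCast_lt_top L) (ENNReal.add_lt_top.2 ⟨ENNReal.ofReal_lt_top,
    ENNReal.mul_lt_top ENNReal.ofReal_lt_top (ENNReal.add_lt_top.2 ⟨ENNReal.add_lt_top.2
      ⟨ENNReal.ofReal_lt_top, ENNReal.mul_lt_top (ENNReal.add_lt_top.2 ⟨ENNReal.ofReal_lt_top,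
        ENNReal.one_lt_top⟩) h⟩, ENNReal.ofReal_lt_top⟩)⟩)⟩⟩

/-- Counting powers with `m = u ^ (-24)`: fourth moments of order `u ^ (-4)`, the output being
allowed up to `u⁻¹`, contribute `u ^ (29 - 24 - 4)`; small preactivations, of probability of order
`u ^ 8`, contribute `u ^ (17 - 24 + 8)`. Both are `u`. -/
theorem lintegral_regular_maxRemainder_le {u K ε X c : ℝ} (hu : 0 < u) (hu1 : u ≤ 1)
    (hs : ∀ l, A.scale l = u ^ 12) {m : ℕ} (hm : ∀ l, A.width (l + 1) = m) (hum : u ^ 24 * m = 1)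
    (hK : 1 ≤ K) (hε : 0 ≤ ε) {x : A.Input} (hX : ‖x‖ ≤ X) (hc : 0 < c) :
    ∫⁻ θ, (A.regular x (K * (u ^ 12)⁻¹) c u⁻¹).indicator (fun θ => A.maxRemainder ε θ x) θ
        ∂(stdGaussian A.Param)
      ≤ ENNReal.ofReal u * (ENNReal.ofReal (ε * incrementBound X ε K A.depth)
      + A.depth * (ENNReal.ofReal (K ^ (A.depth + 1) * (ε * incrementBound X ε K A.depth)
            + incrementBound X ε K A.depth + incrementBound X ε K A.depth ^ 3)
        + ENNReal.ofReal (incrementBound X ε K A.depth) *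
          ((ENNReal.ofReal (8 / c ^ 4) + (ENNReal.ofReal (8 * (K ^ (A.depth + 1)) ^ 4) + 1)
            * ∫⁻ t, ENNReal.ofReal (t ^ 4) ∂(gaussianReal 0 1)) + ENNReal.ofReal (1 / c)))) := by
  set μ := stdGaussian A.Param with hμ
  set S := A.regular x (K * (u ^ 12)⁻¹) c u⁻¹ with hS
  have hSm : MeasurableSet S := A.measurableSet_regular _ _ _ _
  set I := incrementBound X ε K A.depth with hI
  set J := K ^ (A.depth + 1) * (ε * I) + I + I ^ 3 with hJ
  set G := ∫⁻ t, ENNReal.ofReal (t ^ 4) ∂(gaussianReal 0 1) with hG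
  set Q := (ENNReal.ofReal (8 * (K ^ (A.depth + 1)) ^ 4) + 1) * G with hQ
  set Bk : ∀ l, Fin (A.width (l + 1)) → A.Param → ENNReal := fun l j =>
    S.indicator fun θ => ENNReal.ofReal (A.back θ x (l + 1) j ^ 4) with hBk
  set Sm : ∀ l, Fin (A.width (l + 1)) → A.Param → ENNReal := fun l j =>
    S.indicator fun θ => ENNReal.ofReal (if |A.preact θ x l j| ≤ u ^ 8 then (1 : ℝ) else 0) with hSmd
  have hBkm : ∀ l j, Measurable (Bk l j) := fun l j => by
    refine Measurable.indicator ?_ hSm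
    have := A.measurable_back_left x (l + 1) j
    fun_prop
  have hSmm : ∀ l j, Measurable (Sm l j) := fun l j => by
    refine Measurable.indicator (ENNReal.measurable_ofReal.comp (Measurable.ite ?_ measurable_const
      measurable_const)) hSm
    exact measurableSet_le (continuous_abs.measurable.comp (A.measurable_preact_left x l j))
      measurable_const
  have hpt : ∀ θ, S.indicator (fun θ => A.maxRemainder ε θ x) θ
      ≤ ENNReal.ofReal u * ENNReal.ofReal (ε * I)
        + ∑ l ∈ Finset.range A.depth, (ENNReal.ofReal u * ENNReal.ofReal J
          + ENNReal.ofReal I * (ENNReal.ofReal (u ^ 29) * ∑ j, Bk l j θ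
            + ENNReal.ofReal (u ^ 17) * ∑ j, Sm l j θ)) := by
    intro θ
    by_cases hθ : θ ∈ S
    · simp only [hBk, hSmd, Set.indicator_of_mem hθ]
      exact A.maxRemainder_le_flips hu hu1 hs hK hε hθ.1 hX
    · rw [Set.indicator_of_notMem hθ]
      exact zero_le
  have hb : ∀ l ∈ Finset.range A.depth, ∀ j, ∫⁻ θ, Bk l j θ ∂μ
      ≤ ENNReal.ofReal (8 * (u⁻¹ / c) ^ 4) + Q := fun l hl j =>
    A.lintegral_regular_back_le hs (by positivity) (mul_inv_cancel₀ (by positivity)).le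
      (by positivity) hK x (Nat.succ_le_of_lt (Finset.mem_range.1 hl)) j hc
  have hsm : ∀ l ∈ Finset.range A.depth, ∀ j, ∫⁻ θ, Sm l j θ ∂μ ≤ ENNReal.ofReal (u ^ 8 / c) :=
    fun l hl j => A.lintegral_regular_small_le x (Finset.mem_range.1 hl) j hc
  have hmpos : (0 : ℝ) ≤ m := Nat.cast_nonneg m
  have e1 : ENNReal.ofReal (u ^ 29) * (m * (ENNReal.ofReal (8 * (u⁻¹ / c) ^ 4) + Q))
      ≤ ENNReal.ofReal u * (ENNReal.ofReal (8 / c ^ 4) + Q) := by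
    rw [← mul_assoc, ← ENNReal.ofReal_natCast m, ← ENNReal.ofReal_mul (by positivity),
      mul_add, mul_add, ← ENNReal.ofReal_mul (by positivity), ← ENNReal.ofReal_mul (by positivity)]
    have h5 : u ^ 29 * m = u ^ 5 := by linear_combination u ^ 5 * hum
    rw [h5]
    have h6 : u ^ 5 * (8 * (u⁻¹ / c) ^ 4) = u * (8 / c ^ 4) := by field_simp
    rw [h6]
    gcongr
    exact pow_le_of_le_one hu.le hu1 (by norm_num)
  have e2 : ENNReal.ofReal (u ^ 17) * (m * ENNReal.ofReal (u ^ 8 / c))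
      ≤ ENNReal.ofReal u * ENNReal.ofReal (1 / c) := by
    rw [← mul_assoc, ← ENNReal.ofReal_natCast m, ← ENNReal.ofReal_mul (by positivity),
      ← ENNReal.ofReal_mul (by positivity), ← ENNReal.ofReal_mul (by positivity)]
    refine ENNReal.ofReal_le_ofReal (le_of_eq ?_)
    calc u ^ 17 * m * (u ^ 8 / c) = u * (u ^ 24 * m) * (1 / c) := by ring
      _ = _ := by rw [hum]; ring
  have hlayer : ∀ l ∈ Finset.range A.depth,
      ∫⁻ θ, (ENNReal.ofReal u * ENNReal.ofReal J
          + ENNReal.ofReal I * (ENNReal.ofReal (u ^ 29) * ∑ j, Bk l j θ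
            + ENNReal.ofReal (u ^ 17) * ∑ j, Sm l j θ)) ∂μ
        ≤ ENNReal.ofReal u * (ENNReal.ofReal J + ENNReal.ofReal I *
          ((ENNReal.ofReal (8 / c ^ 4) + Q) + ENNReal.ofReal (1 / c))) := by
    intro l hl
    have hBs : Measurable fun θ => ∑ j, Bk l j θ := Finset.measurable_sum _ fun j _ => hBkm l j
    have hSs : Measurable fun θ => ∑ j, Sm l j θ := Finset.measurable_sum _ fun j _ => hSmm l j
    have hBS : Measurable fun θ => ENNReal.ofReal (u ^ 29) * ∑ j, Bk l j θ
        + ENNReal.ofReal (u ^ 17) * ∑ j, Sm l j θ := (hBs.const_mul _).add (hSs.const_mul _)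
    rw [lintegral_add_left measurable_const, lintegral_const, measure_univ, mul_one,
      lintegral_const_mul _ hBS,
      lintegral_add_left (hBs.const_mul _), lintegral_const_mul _ hBs, lintegral_const_mul _ hSs,
      lintegral_finsetSum _ fun j _ => hBkm l j, lintegral_finsetSum _ fun j _ => hSmm l j]
    have hB : ∑ j, ∫⁻ θ, Bk l j θ ∂μ ≤ m * (ENNReal.ofReal (8 * (u⁻¹ / c) ^ 4) + Q) :=
      (Finset.sum_le_card_nsmul _ _ _ fun j _ => hb l hl j).trans_eq
        (by rw [Finset.card_univ, Fintype.card_fin, hm, nsmul_eq_mul])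
    have hS' : ∑ j, ∫⁻ θ, Sm l j θ ∂μ ≤ m * ENNReal.ofReal (u ^ 8 / c) :=
      (Finset.sum_le_card_nsmul _ _ _ fun j _ => hsm l hl j).trans_eq (by simp [hm])
    calc _ ≤ ENNReal.ofReal u * ENNReal.ofReal J + ENNReal.ofReal I *
          (ENNReal.ofReal u * (ENNReal.ofReal (8 / c ^ 4) + Q)
            + ENNReal.ofReal u * ENNReal.ofReal (1 / c)) := by
          exact add_le_add le_rfl (mul_le_mul_right (add_le_add
            ((mul_le_mul_right hB _).trans e1) ((mul_le_mul_right hS' _).trans e2)) _)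
      _ = _ := by ring
  refine (lintegral_mono hpt).trans ?_
  rw [lintegral_add_left measurable_const, lintegral_const, measure_univ, mul_one,
    lintegral_finsetSum]
  · refine (add_le_add le_rfl ((Finset.sum_le_card_nsmul _ _ _ hlayer).trans_eq ?_)).trans_eq
      (mul_add _ _ _).symm
    rw [Finset.card_range, nsmul_eq_mul]
    ring
  · intro l _
    have hBs : Measurable fun θ => ∑ j, Bk l j θ := Finset.measurable_sum _ fun j _ => hBkm l j
    have hSs : Measurable fun θ => ∑ j, Sm l j θ := Finset.measurable_sum _ fun j _ => hSmm l j
    fun_prop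

/-- The mean of the largest Taylor remainder over the parameters with bounded weights. -/
theorem lintegral_maxRemainder_le {u K ε X c : ℝ} (hu : 0 < u) (hu1 : u ≤ 1)
    (hs : ∀ l, A.scale l = u ^ 12) {m : ℕ} (hm : ∀ l, A.width (l + 1) = m) (hum : u ^ 24 * m = 1)
    (hK : 1 ≤ K) (hε : 0 ≤ ε) {x : A.Input} (hX : ‖x‖ ≤ X) (hc : 0 < c) :
    ∫⁻ θ, {θ | A.WeightsBounded θ (K * (u ^ 12)⁻¹)}.indicator
        (fun θ => A.maxRemainder ε θ x) θ ∂(stdGaussian A.Param)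
      ≤ ENNReal.ofReal (remainderConst A.depth X ε K)
          * stdGaussian A.Param (A.collapsed x c)
        + ENNReal.ofReal u * rateConst A.depth X ε K c := by
  set b := ENNReal.ofReal (remainderConst A.depth X ε K) with hb
  set S := A.regular x (K * (u ^ 12)⁻¹) c u⁻¹ with hS
  set T := {θ : A.Param | l2 (A.act θ x A.depth) ≤ K ^ A.depth * X ∧ u⁻¹ < |A.net θ x|} with hT
  have hTm : MeasurableSet T := (measurableSet_le (A.measurable_l2_act x _) measurable_const).inter
    (measurableSet_lt measurable_const (A.measurable_abs_net x))
  have hCm := A.measurableSet_collapsed x c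
  have hs1 : u ^ 12 ≤ 1 := pow_le_one₀ hu.le hu1
  -- On bounded weights the remainder is bounded by a constant. It suffices to pay this constant
  -- when a layer collapses or the output exceeds `u⁻¹`; otherwise the parameter is regular.
  have hpt : ∀ θ, {θ | A.WeightsBounded θ (K * (u ^ 12)⁻¹)}.indicator
        (fun θ => A.maxRemainder ε θ x) θ
      ≤ b * (A.collapsed x c).indicator 1 θ + (b * T.indicator 1 θ
        + S.indicator (fun θ => A.maxRemainder ε θ x) θ) := by
    intro θ
    by_cases hθ : A.WeightsBounded θ (K * (u ^ 12)⁻¹)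
    · rw [Set.indicator_of_mem (s := {θ | A.WeightsBounded θ (K * (u ^ 12)⁻¹)}) hθ]
      have hle : A.maxRemainder ε θ x ≤ b := A.maxRemainder_le_const hs (by positivity) hs1
        (mul_inv_cancel₀ (by positivity)).le (by positivity) hK hε hθ hX
      by_cases h1 : θ ∈ A.collapsed x c
      · rw [Set.indicator_of_mem h1, Pi.one_apply, mul_one]
        exact hle.trans le_self_add
      by_cases h2 : θ ∈ T
      · rw [Set.indicator_of_mem h2, Pi.one_apply, mul_one]
        exact hle.trans (le_self_add.trans le_add_self)
      · have hmem : θ ∈ S := by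
          refine ⟨hθ, h1, not_lt.1 fun h3 => h2 ⟨?_, h3⟩⟩
          exact l2_act_le hs (by positivity) (mul_inv_cancel₀ (by positivity)).le hK hθ hX _ le_rfl
        rw [Set.indicator_of_mem hmem]
        exact le_add_self.trans le_add_self
    · rw [Set.indicator_of_notMem (s := {θ | A.WeightsBounded θ (K * (u ^ 12)⁻¹)}) hθ]
      exact zero_le
  refine (lintegral_mono hpt).trans ?_
  rw [lintegral_add_left ((measurable_one.indicator hCm).const_mul b),
    lintegral_add_left ((measurable_one.indicator hTm).const_mul b),
    lintegral_const_mul _ (measurable_one.indicator hCm),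
    lintegral_const_mul _ (measurable_one.indicator hTm), lintegral_indicator_one hCm,
    lintegral_indicator_one hTm, rateConst, mul_add (ENNReal.ofReal u)]
  refine add_le_add le_rfl (add_le_add ?_
    (A.lintegral_regular_maxRemainder_le hu hu1 hs hm hum hK hε hX hc))
  rw [← mul_assoc, mul_comm (ENNReal.ofReal u), mul_assoc]
  -- The threshold `u⁻¹` gives a tail of order `u ^ 4`, more than the factor `u` that is needed.
  refine mul_le_mul_right ((A.measure_net_gt_le x (inv_pos.2 hu)).trans ?_) b
  rw [← mul_assoc, ← ENNReal.ofReal_mul hu.le]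
  gcongr
  rw [div_inv_eq_mul, mul_pow, mul_comm u]
  refine mul_le_mul_of_nonneg_left ?_ (by positivity)
  exact pow_le_of_le_one hu.le hu1 (by norm_num)

end Arch

end

/-! ### The infinite width limit. -/

noncomputable section

namespace Arch

section

variable (A : Arch)

theorem measurable_maxRemainder_comp {Ω : Type*} [MeasurableSpace Ω] {ε : ℝ} (hε : 0 < ε)
    {f : Ω → A.Param} {g : Ω → A.Input} (hf : Measurable f) (hg : Measurable g) :
    Measurable fun ω => A.maxRemainder ε (f ω) (g ω) := by
  have h := (A.measurable_maxRemainder hε).comp (hf.prodMk hg)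
  exact h

theorem measurable_indicator_maxRemainder {ε : ℝ} (hε : 0 < ε) {W : Set A.Param}
    (hW : MeasurableSet W) : Measurable fun p : (A.Input × ℝ) × A.Param =>
      W.indicator (fun θ => A.maxRemainder ε θ p.1.1) p.2 := by
  have h1 : Measurable fun p : (A.Input × ℝ) × A.Param => A.maxRemainder ε p.2 p.1.1 :=
    A.measurable_maxRemainder_comp hε measurable_snd (measurable_fst.comp measurable_fst)
  exact h1.indicator (measurable_snd hW)

/-- Markov's inequality after discarding the complement of `W`, with the order of integration
exchanged so that the input can be fixed first. -/
theorem measure_le_remainderBound_le (P : Measure (A.Input × ℝ)) [IsProbabilityMeasure P]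
    {ε τ : ℝ} (hε : 0 < ε) (hτ : 0 < τ) {W : Set A.Param} (hW : MeasurableSet W) :
    stdGaussian A.Param {θ | τ ≤ |A.remainderBound P ε θ|} ≤ stdGaussian A.Param Wᶜ
      + 2 * (∫⁻ z, ∫⁻ θ, W.indicator (fun θ => A.maxRemainder ε θ z.1) θ
          ∂(stdGaussian A.Param) ∂P) / ENNReal.ofReal τ := by
  set f : A.Param → ENNReal := fun θ =>
    ∫⁻ z, W.indicator (fun θ => A.maxRemainder ε θ z.1) θ ∂P with hf
  have hm := A.measurable_indicator_maxRemainder hε hW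
  have hm' : Measurable (Function.uncurry fun (θ : A.Param) (z : A.Input × ℝ) =>
      W.indicator (fun θ => A.maxRemainder ε θ z.1) θ) := by
    have h := hm.comp measurable_swap
    exact h
  have hfm : Measurable f := Measurable.lintegral_prod_left' hm
  have hsub : {θ | τ ≤ |A.remainderBound P ε θ|} ⊆ Wᶜ ∪ {θ | ENNReal.ofReal τ ≤ 2 * f θ} := by
    intro θ hθ
    by_cases hmem : θ ∈ W
    · right
      have h1 : τ ≤ |A.remainderBound P ε θ| := hθ
      rw [remainderBound, abs_of_nonneg ENNReal.toReal_nonneg] at h1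
      have h2 : f θ = ∫⁻ z, A.maxRemainder ε θ z.1 ∂P := by
        simp only [hf, Set.indicator_of_mem hmem]
      change ENNReal.ofReal τ ≤ 2 * f θ
      rw [h2]
      exact ENNReal.ofReal_le_of_le_toReal h1
    · exact Or.inl hmem
  refine (measure_mono hsub).trans ((measure_union_le _ _).trans (add_le_add le_rfl ?_))
  refine (meas_ge_le_lintegral_div (hfm.const_mul 2).aemeasurable
    (ENNReal.ofReal_pos.2 hτ).ne' ENNReal.ofReal_ne_top).trans_eq ?_
  have hswap : ∫⁻ θ, f θ ∂(stdGaussian A.Param) = ∫⁻ z, ∫⁻ θ,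
      W.indicator (fun θ => A.maxRemainder ε θ z.1) θ ∂(stdGaussian A.Param) ∂P :=
    lintegral_lintegral_swap hm'.aemeasurable
  rw [lintegral_const_mul _ hfm, hswap]

theorem measure_not_weightsBounded_le {b T : ℝ} (hb : 0 < b) (hT : 0 ≤ T) :
    stdGaussian A.Param {θ | A.WeightsBounded θ T}ᶜ
      ≤ (∑ l ∈ Finset.range A.depth, ENNReal.ofReal (Real.exp (-(b / 16 * T ^ 2)))
          * (ENNReal.ofReal (8 ^ A.width l)
          * (∫⁻ t, ENNReal.ofReal (Real.exp (b * t ^ 2)) ∂(gaussianReal 0 1)) ^ A.width (l + 1)))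
        + ENNReal.ofReal (Real.exp (-(b * T ^ 2)))
          * (∫⁻ t, ENNReal.ofReal (Real.exp (b * t ^ 2)) ∂(gaussianReal 0 1)) ^ A.width A.depth := by
  have hsub : {θ | A.WeightsBounded θ T}ᶜ ⊆ (⋃ l ∈ Finset.range A.depth,
      {θ | ∃ v, T * l2 v < l2 (fun j => ∑ k, A.weight θ l j k * v k)})
        ∪ {θ | T < l2 (fun k => θ (Sum.inr k))} := by
    intro θ hθ
    by_contra hcon
    refine hθ ⟨fun l hl v => ?_, ?_⟩
    · by_contra h
      exact hcon (Or.inl (Set.mem_biUnion (Finset.mem_coe.2 (Finset.mem_range.2 hl))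
        ⟨v, not_le.1 h⟩))
    · by_contra h
      exact hcon (Or.inr (not_le.1 h))
  refine (measure_mono hsub).trans ((measure_union_le _ _).trans (add_le_add
    ((measure_biUnion_finset_le _ _).trans (Finset.sum_le_sum fun l hl => ?_))
    (A.measure_output_gt_le hb hT)))
  exact A.measure_weight_opNorm_gt_le (Finset.mem_range.1 hl) hb hT

end

/-- One bound for the input layer and the hidden layers, so that the per-layer tail bounds combine
into a single `m`-th power. -/
theorem width_wide_le (d L : ℕ) {m : ℕ} (hm : 1 ≤ m) (l : ℕ) :
    (wide d L m).width l ≤ (d + 1) * m := by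
  cases l with
  | zero =>
    change d ≤ (d + 1) * m
    nlinarith
  | succ l =>
    change m ≤ (d + 1) * m
    nlinarith

/-- With high probability the weight matrices of a wide network have norms of order `√m`. -/
theorem exists_tendsto_measure_not_weightsBounded (d L : ℕ) :
    ∃ K : ℝ, 1 ≤ K ∧ Tendsto (fun m => stdGaussian (wide d L m).Param
      {θ | (wide d L m).WeightsBounded θ (K * Real.sqrt m)}ᶜ) atTop (𝓝 0) := by
  obtain ⟨b, hb, hI⟩ := exists_lintegral_exp_sq_lt_top
  set I := ∫⁻ t, ENNReal.ofReal (Real.exp (b * t ^ 2)) ∂(gaussianReal 0 1) with hIdef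
  have hI1 : 1 ≤ I := by
    calc (1 : ENNReal) = ∫⁻ _t : ℝ, 1 ∂(gaussianReal 0 1) := by simp
      _ ≤ I := lintegral_mono fun t => by
        rw [← ENNReal.ofReal_one]
        exact ENNReal.ofReal_le_ofReal (Real.one_le_exp (by positivity))
  set Z := ENNReal.ofReal (8 ^ (d + 1)) * I ^ (d + 1) with hZ
  have hZtop : Z ≠ ⊤ := ENNReal.mul_ne_top ENNReal.ofReal_ne_top (ENNReal.pow_ne_top hI.ne)
  have hlim : Tendsto (fun K : ℝ => ENNReal.ofReal (Real.exp (-(b / 16 * K ^ 2))) * Z) atTop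
      (𝓝 0) := by
    have h1 : Tendsto (fun K : ℝ => Real.exp (-(b / 16 * K ^ 2))) atTop (𝓝 0) :=
      Real.tendsto_exp_neg_atTop_nhds_zero.comp
        ((tendsto_pow_atTop two_ne_zero).const_mul_atTop (by positivity))
    have h2 := ENNReal.tendsto_ofReal h1
    rw [ENNReal.ofReal_zero] at h2
    simpa using ENNReal.Tendsto.mul_const h2 (Or.inr hZtop)
  -- `K` is taken so large that the Gaussian tail beats the volume and moment factors; each failure
  -- probability is then at most `r ^ m` with `r < 1`.
  obtain ⟨K, hK1, hKr⟩ := ((eventually_ge_atTop 1).and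
    (hlim.eventually_lt_const one_pos)).exists
  set r := ENNReal.ofReal (Real.exp (-(b / 16 * K ^ 2))) * Z with hr
  refine ⟨K, hK1, ?_⟩
  have hupper : Tendsto (fun m : ℕ => ((L : ENNReal) + 1) * r ^ m) atTop (𝓝 0) := by
    have := ENNReal.Tendsto.const_mul (ENNReal.tendsto_pow_atTop_nhds_zero_of_lt_one hKr)
      (Or.inr (by finiteness : (L : ENNReal) + 1 ≠ ⊤))
    simpa using this
  refine tendsto_of_tendsto_of_tendsto_of_le_of_le' tendsto_const_nhds hupper
    (Eventually.of_forall fun _ => zero_le) ?_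
  filter_upwards [eventually_ge_atTop 1] with m hm
  refine ((wide d L m).measure_not_weightsBounded_le hb (by positivity)).trans ?_
  have hT : (K * Real.sqrt m) ^ 2 = K ^ 2 * m := by
    rw [mul_pow, Real.sq_sqrt (Nat.cast_nonneg m)]
  have hexp : ENNReal.ofReal (Real.exp (-(b / 16 * (K * Real.sqrt m) ^ 2)))
      = ENNReal.ofReal (Real.exp (-(b / 16 * K ^ 2))) ^ m := by
    rw [← ENNReal.ofReal_pow (Real.exp_pos _).le, ← Real.exp_nat_mul, hT]
    congr 2
    ring
  have hIw : ∀ l, I ^ (wide d L m).width l ≤ (I ^ (d + 1)) ^ m := fun l => by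
    rw [← pow_mul]
    exact pow_le_pow_right₀ hI1 (width_wide_le d L hm l)
  have h8w : ∀ l, ENNReal.ofReal (8 ^ (wide d L m).width l) ≤ ENNReal.ofReal (8 ^ (d + 1)) ^ m := by
    intro l
    rw [← ENNReal.ofReal_pow (by positivity), ← pow_mul]
    exact ENNReal.ofReal_le_ofReal
      (pow_le_pow_right₀ (by norm_num) (width_wide_le d L hm l))
  have hrm : r ^ m = ENNReal.ofReal (Real.exp (-(b / 16 * K ^ 2))) ^ m
      * (ENNReal.ofReal (8 ^ (d + 1)) ^ m * (I ^ (d + 1)) ^ m) := by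
    rw [hr, hZ, mul_pow, mul_pow]
  rw [add_mul, one_mul]
  refine add_le_add ((Finset.sum_le_card_nsmul _ _ (r ^ m) fun l _ => ?_).trans_eq ?_) ?_
  · rw [hexp, hrm]
    exact mul_le_mul_right (mul_le_mul' (h8w l) (hIw (l + 1))) _
  · rw [Finset.card_range, nsmul_eq_mul]
  · rw [hrm, ← hexp]
    refine mul_le_mul' (ENNReal.ofReal_le_ofReal (Real.exp_le_exp.2 ?_)) ?_
    · have : 0 ≤ b * (K * Real.sqrt m) ^ 2 := by positivity
      linarith
    · refine (hIw _).trans (le_mul_of_one_le_left' (one_le_pow₀ ?_))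
      rw [← ENNReal.ofReal_one]
      exact ENNReal.ofReal_le_ofReal (one_le_pow₀ (by norm_num))

/-- A bound independent of the width: the majorant for dominated convergence over the inputs. -/
theorem lintegral_wide_maxRemainder_le (d L : ℕ) {m : ℕ} (hm : 1 ≤ m) {ε K X : ℝ} (hε : 0 ≤ ε)
    (hK : 1 ≤ K) {x : EuclideanSpace ℝ (Fin d)} (hX : ‖x‖ ≤ X) :
    ∫⁻ θ, {θ | (wide d L m).WeightsBounded θ (K * Real.sqrt m)}.indicator
        (fun θ => (wide d L m).maxRemainder ε θ x) θ ∂(stdGaussian (wide d L m).Param)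
      ≤ ENNReal.ofReal (remainderConst L X ε K) := by
  have hm1 : 1 ≤ Real.sqrt m := Real.one_le_sqrt.2 (by exact_mod_cast hm)
  have hm0 : 0 < Real.sqrt m := by linarith
  have h : ∀ θ, {θ | (wide d L m).WeightsBounded θ (K * Real.sqrt m)}.indicator
        (fun θ => (wide d L m).maxRemainder ε θ x) θ
      ≤ ENNReal.ofReal (remainderConst L X ε K) := by
    intro θ
    refine Set.indicator_apply_le' (fun hθ => ?_) fun _ => zero_le
    exact (wide d L m).maxRemainder_le_const (s := 1 / Real.sqrt m) (fun _ => rfl) (by positivity)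
      ((div_le_one hm0).2 hm1) (one_div_mul_cancel hm0.ne').le hm0.le hK hε hθ hX
  refine (lintegral_mono h).trans ?_
  simp

/-- The mean of the largest Taylor remainder at a fixed input vanishes in the infinite width
limit. -/
theorem tendsto_lintegral_maxRemainder (d L : ℕ) {ε K : ℝ} (hε : 0 ≤ ε) (hK : 1 ≤ K)
    (x : EuclideanSpace ℝ (Fin d)) :
    Tendsto (fun m => ∫⁻ θ, {θ | (wide d L m).WeightsBounded θ (K * Real.sqrt m)}.indicator
        (fun θ => (wide d L m).maxRemainder ε θ x) θ ∂(stdGaussian (wide d L m).Param))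
      atTop (𝓝 0) := by
  obtain ⟨q₀, hq₀, hρ₀⟩ := exists_lintegral_exp_sub_relu_sq_lt_one
  set q := min q₀ 1 with hq
  have hq0 : 0 < q := lt_min hq₀ one_pos
  set ρ := ∫⁻ t, ENNReal.ofReal (Real.exp (q - max t 0 ^ 2)) ∂(gaussianReal 0 1) with hρ
  have hρ1 : ρ < 1 := by
    refine lt_of_le_of_lt (lintegral_mono fun t => ?_) hρ₀
    refine ENNReal.ofReal_le_ofReal (Real.exp_le_exp.2 (sub_le_sub_right (min_le_left _ _) _))
  -- The exponent makes `u ^ 12` the activation scale `1 / √m` and `u ^ 24 * m = 1`.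
  set u : ℕ → ℝ := fun m => (m : ℝ) ^ (-(1 / 24) : ℝ) with hu
  have hu0 : Tendsto u atTop (𝓝 0) :=
    (tendsto_rpow_neg_atTop (by norm_num)).comp tendsto_natCast_atTop_atTop
  -- At the origin there is no lower bound on the activations, but the constant bound is
  -- proportional to `X = 0`.
  by_cases hx : x = 0
  · refine tendsto_const_nhds.congr' ?_
    filter_upwards [eventually_ge_atTop 1] with m hm
    have h := lintegral_wide_maxRemainder_le d L hm hε hK (x := x) (X := 0) (by simp [hx])
    simp only [remainderConst, incrementBound, zero_mul, mul_zero, add_zero,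
      ENNReal.ofReal_zero] at h
    exact (nonpos_iff_eq_zero.1 h).symm
  set c := ‖x‖ * Real.sqrt q ^ L with hc
  have hc0 : 0 < c := by
    have := norm_pos_iff.2 hx
    have := Real.sqrt_pos.2 hq0
    positivity
  set b := ENNReal.ofReal (remainderConst L ‖x‖ ε K) with hb
  have hupper : Tendsto (fun m : ℕ => b * (L * ρ ^ m)
      + ENNReal.ofReal (u m) * rateConst L ‖x‖ ε K c) atTop (𝓝 0) := by
    have h1 := ENNReal.Tendsto.const_mul (ENNReal.Tendsto.const_mul
      (ENNReal.tendsto_pow_atTop_nhds_zero_of_lt_one hρ1)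
      (Or.inr (ENNReal.natCast_ne_top L))) (Or.inr (ENNReal.ofReal_ne_top : b ≠ ⊤))
    have h2 := ENNReal.Tendsto.mul_const (ENNReal.tendsto_ofReal hu0)
      (Or.inr (rateConst_lt_top L ‖x‖ ε K c).ne)
    simpa using h1.add h2
  refine tendsto_of_tendsto_of_tendsto_of_le_of_le' tendsto_const_nhds hupper
    (Eventually.of_forall fun _ => zero_le) ?_
  filter_upwards [eventually_ge_atTop 1] with m hm
  have hm0 : (0 : ℝ) < m := by exact_mod_cast hm
  have hum0 : 0 < u m := Real.rpow_pos_of_pos hm0 _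
  have hum1 : u m ≤ 1 := Real.rpow_le_one_of_one_le_of_nonpos (by exact_mod_cast hm) (by norm_num)
  have h24 : u m ^ 24 * m = 1 := by
    have : u m ^ 24 = (m : ℝ)⁻¹ := by
      simp only [hu]
      rw [← Real.rpow_natCast, ← Real.rpow_mul hm0.le, ← Real.rpow_neg_one]
      norm_num
    rw [this, inv_mul_cancel₀ hm0.ne']
  have h12 : u m ^ 12 = 1 / Real.sqrt m := by
    rw [eq_div_iff (Real.sqrt_pos.2 hm0).ne',
      ← pow_eq_one_iff_of_nonneg (by positivity) two_ne_zero, mul_pow,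
      Real.sq_sqrt hm0.le]
    linear_combination h24
  have hs : ∀ l, (wide d L m).scale l = u m ^ 12 := fun _ => h12.symm
  have h := (wide d L m).lintegral_maxRemainder_le hum0 hum1 hs (fun _ => rfl) h24 hK hε
    (le_refl ‖x‖) hc0
  rw [h12, one_div, inv_inv] at h
  refine h.trans (add_le_add (mul_le_mul_right ?_ b) le_rfl)
  refine (wide d L m).measure_collapsed_le (s := u m ^ 12) (by positivity) hs (fun _ => rfl) ?_ hx
    hq0 (min_le_right _ _)
  linear_combination h24

theorem tendsto_remainderBound (d L : ℕ) (P : Measure (EuclideanSpace ℝ (Fin d) × ℝ))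
    [IsProbabilityMeasure P] {ε Kx : ℝ} (hε : 0 < ε) (hx : ∀ᵐ z ∂P, ‖z.1‖ ≤ Kx) {τ : ℝ}
    (hτ : 0 < τ) :
    Tendsto (fun m => stdGaussian (wide d L m).Param
      {θ₀ | τ ≤ |(wide d L m).remainderBound P ε θ₀|}) atTop (𝓝 0) := by
  obtain ⟨K, hK, hbad⟩ := exists_tendsto_measure_not_weightsBounded d L
  have hF : Tendsto (fun m => ∫⁻ z, ∫⁻ θ,
      {θ | (wide d L m).WeightsBounded θ (K * Real.sqrt m)}.indicator
        (fun θ => (wide d L m).maxRemainder ε θ z.1) θ ∂(stdGaussian (wide d L m).Param) ∂P)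
      atTop (𝓝 0) := by
    rw [← lintegral_zero (μ := P)]
    -- The rate at a fixed input deteriorates as `x` approaches zero, through the lower bound on the
    -- activations. Uniformity in `x` is not needed: pointwise convergence with a constant majorant
    -- is enough.
    refine tendsto_lintegral_filter_of_dominated_convergence
      (fun _ => ENNReal.ofReal (remainderConst L Kx ε K)) ?_ ?_ ?_ ?_
    · refine Eventually.of_forall fun m => ?_
      exact Measurable.lintegral_prod_right' ((wide d L m).measurable_indicator_maxRemainder hε
        ((wide d L m).isClosed_weightsBounded _).measurableSet)
    · filter_upwards [eventually_ge_atTop 1] with m hm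
      filter_upwards [hx] with z hz
      exact lintegral_wide_maxRemainder_le d L hm hε.le hK hz
    · simp
    · exact Eventually.of_forall fun z => tendsto_lintegral_maxRemainder d L hε.le hK z.1
  have hlim : Tendsto (fun m => stdGaussian (wide d L m).Param
      {θ | (wide d L m).WeightsBounded θ (K * Real.sqrt m)}ᶜ + 2 * (∫⁻ z, ∫⁻ θ,
      {θ | (wide d L m).WeightsBounded θ (K * Real.sqrt m)}.indicator
        (fun θ => (wide d L m).maxRemainder ε θ z.1) θ ∂(stdGaussian (wide d L m).Param) ∂P)
      / ENNReal.ofReal τ) atTop (𝓝 0) := by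
    have h1 := ENNReal.Tendsto.const_mul hF (Or.inr (ENNReal.ofNat_ne_top (n := 2)))
    have h2 := ENNReal.Tendsto.div_const h1 (Or.inr (ENNReal.ofReal_pos.2 hτ).ne')
    simpa using hbad.add h2
  refine tendsto_of_tendsto_of_tendsto_of_le_of_le tendsto_const_nhds hlim
    (fun _ => zero_le) fun m => ?_
  exact (wide d L m).measure_le_remainderBound_le P hε hτ
    ((wide d L m).isClosed_weightsBounded _).measurableSet

end Arch

end

/-! ### The theorem. -/

theorem theorem1 :
    -- The generalization bound.
    (∀ (A : Arch) (P : Measure (A.Input × ℝ)) [IsProbabilityMeasure P]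
        (n : ℕ) (D : Fin n → A.Input × ℝ) (N : ℕ) (ℓ dℓ : ℝ → ℝ) (E : Set (ℕ → ℝ))
        (θ₀ : A.Param) (ε : ℝ) (KL : NNReal) (K₀ Kg Kx CTS CGD B H δ : ℝ),
      0 < N → 0 < ε → 0 < CTS → 0 < CGD → 0 < δ → δ < 1 →
      -- `dℓ` is the derivative of `ℓ` (any convention where `ℓ` is not differentiable)
      (∀ u v, HasDerivAt ℓ v u → dℓ u = v) →
      -- learning rates are positive
      (∀ η ∈ E, ∀ t, 0 < η t) →
      -- Lipschitz loss
      LipschitzWith KL ℓ →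
      -- bounded tangent sensitivity on the training set
      (∀ θ ∈ A.reach dℓ D E θ₀ ε, ∀ i, Arch.frobNorm (A.tangentSens θ (D i).1) ≤ CTS) →
      -- bounded initial output, initial gradient and inputs
      (∀ᵐ z ∂P, |A.net θ₀ z.1| ≤ K₀) →
      (∀ᵐ z ∂P, ‖A.paramGrad θ₀ z.1‖ ≤ Kg) →
      (∀ᵐ z ∂P, ‖z.1‖ ≤ Kx) →
      (∀ i, ‖(D i).1‖ ≤ Kx) →
      -- bounded total learning signal along every trajectory
      (∀ η ∈ E, ∀ T : ℕ, ∑ t ∈ Finset.range T, η (t + 1) *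
        ((1 / (n : ℝ)) * ∑ i, |dℓ (A.net (A.gd dℓ D η θ₀ t) (D i).1 - (D i).2)|) ≤ CGD) →
      -- `B` bounds the loss
      (∀ f ∈ A.family dℓ D E θ₀ CTS ε, ∀ᵐ z ∂P, |ℓ (f z.1 - z.2)| ≤ B) →
      -- `H` bounds the contribution of the Taylor remainder
      2 * A.remainderComplexity P N dℓ D E θ₀ CTS ε ≤ H →
      ENNReal.ofReal (1 - δ) ≤ (Measure.pi fun _ : Fin N => P)
        {s | ∀ f ∈ A.family dℓ D E θ₀ CTS ε,
          risk ℓ P f - empRisk ℓ s f ≤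
            KL * K₀ + 2 * KL * Kx * Kg * CTS * CGD / Real.sqrt N + KL * H
              + B * Real.sqrt (2 * Real.log (4 / δ) / N)}) ∧
    -- The error term vanishes in the infinite width limit.
    (∀ (d L N : ℕ) (P : Measure (EuclideanSpace ℝ (Fin d) × ℝ)) [IsProbabilityMeasure P]
        (ε Kx : ℝ),
      0 < N → 0 < ε → (∀ᵐ z ∂P, ‖z.1‖ ≤ Kx) →
      ∃ H : (m : ℕ) → (Arch.wide d L m).Param → ℝ,
        (∀ (m n : ℕ) (D : Fin n → (Arch.wide d L m).Input × ℝ) (dℓ : ℝ → ℝ) (E : Set (ℕ → ℝ))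
            (θ₀ : (Arch.wide d L m).Param) (C : ℝ),
          2 * (Arch.wide d L m).remainderComplexity P N dℓ D E θ₀ C ε ≤ H m θ₀) ∧
        ∀ τ : ℝ, 0 < τ →
          Tendsto (fun m => stdGaussian (Arch.wide d L m).Param {θ₀ | τ ≤ |H m θ₀|})
            atTop (𝓝 0)) := by
  refine ⟨?_, ?_⟩
  · intro A P _ n D N ℓ dℓ E θ₀ ε KL K₀ Kg Kx CTS CGD B H δ hN _ hCTS _ hδ hδ1 _ hη hℓ hTS h₀ hgrad
      hx hxD hGD hB hH
    exact generalization_bound_of_reach A P n D N ℓ dℓ E θ₀ ε KL K₀ Kg Kx CTS CGD B H δ hN hCTS hδ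
      hδ1 hη hℓ hTS h₀ hgrad hx hxD hGD hB hH
  · intro d L N P _ ε Kx hN hε hx
    -- The witness depends only on `P`, `ε` and the initial parameter, hence is valid for all
    -- training data, loss derivatives, rates and sensitivity bounds.
    exact ⟨fun m => (Arch.wide d L m).remainderBound P ε,
      fun m n D dℓ E θ₀ C => (Arch.wide d L m).two_mul_remainderComplexity_le P hN hε hx dℓ D E θ₀ C,
      fun τ hτ => Arch.tendsto_remainderBound d L P hε hx hτ⟩
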